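/- Let $G$ be a tree with $n$ nodes, rooted at a node $r$, and write $\mathrm{dist}$ for the graph distance. There are $k\ge 1$ servers, numbered $1,\dots,k$, located at (not necessarily distinct) nodes $v_1,\dots,v_k$. When a node $q$ is requested, the servers are moved by the Chrobak--Larmore rule: server $i$ is \emph{active} if no other server lies on the path from $v_i$ to $q$, except possibly servers with a larger number at the node $v_i$ itself; in one phase all active servers simultaneously move one step towards $q$; phases are repeated (the active servers being determined anew before each phase) until, for the first time, some server is at $q$ (there is no phase if this holds already). The model of computation is a unit-cost word RAM with words of $w$ bits: each reading or writing of a register or an array cell, each arithmetic, bitwise or comparison operation on words and each test costs one step. A tree is given to the machine by $n$, $r$ and the array of the parents of its nodes. \textbf{Theorem.} There are RAM programs $\mathsf{Preprocess}$, $\mathsf{LCA}$, $\mathsf{LA}$, $\mathsf{Query}$ and a constant $C$ such that the following holds for every rooted tree with $n$ nodes and every word length $w$ with $(n+2)^C\le 2^w$. (1) $\mathsf{Preprocess}$, run once on the tree, halts after at most $Cn$ steps. (2) In the memory it leaves, $\mathsf{LCA}$ computes the lowest common ancestor of any two given nodes in at most $C$ steps, and $\mathsf{LA}$ computes, for any node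 $v$ and any $d\le\mathrm{dist}(r,v)$, the ancestor of $v$ at distance $d$ from the root in at most $C$ steps. (3) Let $k\ge 1$ with $(n+k+2)^C\le 2^w$, let the servers have arbitrary initial positions, and let $q_1,q_2,\dots$ be any sequence of requested nodes, delivered one at a time. Then, for every $i$, $\mathsf{Query}$ handles the request $q_i$ in at most $C\,k\,(1+\lfloor\log_2 k\rfloor)$ steps, that is, in time $O(k\log k)$ independent of $n$, and when it halts the array of server positions holds exactly the positions that the Chrobak--Larmore rule produces from the positions before the request. -/

import Mathlib

/-! ## A word RAM

Programs are finite structured programs over scalar registers and arrays of machine words.  A word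
has `w` bits; every arithmetic result is truncated to `w` bits, so that a single step can never
handle a number of more than `w` bits.  Every elementary operation costs one unit of time. -/

namespace WordRAM

/-- The arithmetic, bitwise and comparison operations of the machine. -/
inductive Op
  | add | sub | mul | div | mod | land | lor | xor | shl | shr | lt | eq

/-- The effect of an operation before truncation to a word. Subtraction is cut off at zero, division
by zero gives zero, and comparisons return `1` for true and `0` for false. -/
def Op.apply : Op → ℕ → ℕ → ℕ
  | .add, a, b => a + b
  | .sub, a, b => a - b
  | .mul, a, b => a * b
  | .div, a, b => a / b
  | .mod, a, b => a % b
  | .land, a, b => a &&& b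
  | .lor, a, b => a ||| b
  | .xor, a, b => a ^^^ b
  | .shl, a, b => a <<< b
  | .shr, a, b => a >>> b
  | .lt, a, b => if a < b then 1 else 0
  | .eq, a, b => if a = b then 1 else 0

/-- Expressions: constants, scalar registers, array reads, and binary operations. -/
inductive Expr
  | const (c : ℕ)
  | var (x : ℕ)
  | get (a : ℕ) (i : Expr)
  | bin (o : Op) (e₁ e₂ : Expr)

/-- Structured programs. `assign x e` is `x := e`, `store a i e` is `a[i] := e`, and a condition is
true when its value is nonzero. -/
inductive Stmt
  | skip
  | assign (x : ℕ) (e : Expr)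
  | store (a : ℕ) (i e : Expr)
  | seq (s₁ s₂ : Stmt)
  | ite (e : Expr) (s₁ s₂ : Stmt)
  | loop (e : Expr) (s : Stmt)

/-- The memory: scalar registers `var x` and array cells `arr a i`. -/
@[ext]
structure State where
  var : ℕ → ℕ
  arr : ℕ → ℕ → ℕ

/-- Overwrite one scalar register. -/
def State.setVar (σ : State) (x v : ℕ) : State :=
  { σ with var := Function.update σ.var x v }

/-- Overwrite one array cell. -/
def State.setArr (σ : State) (a i v : ℕ) : State :=
  { σ with arr := Function.update σ.arr a (Function.update (σ.arr a) i v) }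

/-- The value of an expression on a machine with `w`-bit words. -/
def Expr.eval (w : ℕ) (σ : State) : Expr → ℕ
  | .const c => c % 2 ^ w
  | .var x => σ.var x
  | .get a i => σ.arr a (i.eval w σ)
  | .bin o e₁ e₂ => o.apply (e₁.eval w σ) (e₂.eval w σ) % 2 ^ w

/-- The time for evaluating an expression: one unit for each node of the expression. -/
def Expr.cost : Expr → ℕ
  | .const _ => 1
  | .var _ => 1
  | .get _ i => i.cost + 1
  | .bin _ e₁ e₂ => e₁.cost + e₂.cost + 1

/-- `Exec w s σ σ' t`: on a machine with `w`-bit words, the program `s` started in the memory `σ`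
halts in the memory `σ'` after exactly `t` elementary steps. -/
inductive Exec (w : ℕ) : Stmt → State → State → ℕ → Prop
  | skip (σ : State) : Exec w .skip σ σ 1
  | assign (x : ℕ) (e : Expr) (σ : State) :
      Exec w (.assign x e) σ (σ.setVar x (e.eval w σ)) (e.cost + 1)
  | store (a : ℕ) (i e : Expr) (σ : State) :
      Exec w (.store a i e) σ (σ.setArr a (i.eval w σ) (e.eval w σ)) (i.cost + e.cost + 1)
  | seq {s₁ s₂ : Stmt} {σ σ' σ'' : State} {t₁ t₂ : ℕ} :
      Exec w s₁ σ σ' t₁ → Exec w s₂ σ' σ'' t₂ → Exec w (.seq s₁ s₂) σ σ'' (t₁ + t₂)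
  | ite_true {e : Expr} {s₁ s₂ : Stmt} {σ σ' : State} {t : ℕ} :
      e.eval w σ ≠ 0 → Exec w s₁ σ σ' t → Exec w (.ite e s₁ s₂) σ σ' (e.cost + 1 + t)
  | ite_false {e : Expr} {s₁ s₂ : Stmt} {σ σ' : State} {t : ℕ} :
      e.eval w σ = 0 → Exec w s₂ σ σ' t → Exec w (.ite e s₁ s₂) σ σ' (e.cost + 1 + t)
  | loop_true {e : Expr} {s : Stmt} {σ σ' σ'' : State} {t₁ t₂ : ℕ} :
      e.eval w σ ≠ 0 → Exec w s σ σ' t₁ → Exec w (.loop e s) σ' σ'' t₂ →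
        Exec w (.loop e s) σ σ'' (e.cost + 1 + t₁ + t₂)
  | loop_false {e : Expr} {s : Stmt} {σ : State} :
      e.eval w σ = 0 → Exec w (.loop e s) σ σ (e.cost + 1)

end WordRAM

/-! ## Trees and the Chrobak–Larmore rule -/

namespace KServer

variable {V : Type*}

/-- In a tree: `x` lies on the unique path between `u` and `v` (end points included). -/
def OnPath (G : SimpleGraph V) (u v x : V) : Prop :=
  G.dist u x + G.dist x v = G.dist u v

/-- `a` is an ancestor of `v` in the tree `G` rooted at `r` (every node is its own ancestor). -/
def IsAncestor (G : SimpleGraph V) (r a v : V) : Prop :=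
  OnPath G r v a

/-- `a` is the lowest common ancestor of `u` and `v` in the tree `G` rooted at `r`: among the common
ancestors it is the closest one to `u` and to `v`. -/
def IsLCA (G : SimpleGraph V) (r u v a : V) : Prop :=
  IsAncestor G r a u ∧ IsAncestor G r a v ∧
    ∀ b, IsAncestor G r b u → IsAncestor G r b v →
      G.dist a u ≤ G.dist b u ∧ G.dist a v ≤ G.dist b v

open Classical in
/-- In a tree: the node reached from `v` by one step towards `q`, that is, the neighbour of `v` that
is closer to `q`; it is `v` itself if `v = q`. -/
noncomputable def stepToward (G : SimpleGraph V) (v q : V) : V :=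
  if h : ∃ u, G.Adj v u ∧ G.dist u q + 1 = G.dist v q then h.choose else v

/-- Server `i` is active in the configuration `c` for the request `q`: no other server is on the
path from its node to `q`, except for servers of larger index in the same node. -/
def Active {k : ℕ} (G : SimpleGraph V) (q : V) (c : Fin k → V) (i : Fin k) : Prop :=
  ∀ j, j ≠ i → OnPath G (c i) q (c j) → c j = c i ∧ i < j

open Classical in
/-- One phase: simultaneously, every active server moves one step towards the request. -/
noncomputable def phase {k : ℕ} (G : SimpleGraph V) (q : V) (c : Fin k → V) : Fin k → V :=
  fun i => if Active G q c i then stepToward G (c i) q else c i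

/-- `c'` is the configuration in which the Chrobak–Larmore rule leaves the servers when the request
`q` arrives in the configuration `c`: phases are repeated until, for the first time, some server is
in `q`. -/
def ChrobakLarmore {k : ℕ} (G : SimpleGraph V) (q : V) (c c' : Fin k → V) : Prop :=
  ∃ m : ℕ, c' = (phase G q)^[m] c ∧ (∃ i, c' i = q) ∧ ∀ m' < m, ∀ i, (phase G q)^[m'] c i ≠ q

end KServer

/-! ## Input and output conventions -/

namespace KServer

open WordRAM

/-- The initial memory for the tree `G` on the nodes `0, …, n - 1` rooted at `r`: register `0` holds
`n`, register `1` holds the root, array `0` holds the parent of every node (with the root as its own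
parent), and everything else is zero. -/
noncomputable def treeInput {n : ℕ} (G : SimpleGraph (Fin n)) (r : Fin n) : State where
  var := fun x => if x = 0 then n else if x = 1 then r else 0
  arr := fun a i => if h : a = 0 ∧ i < n then (stepToward G ⟨i, h.2⟩ r : Fin n) else 0

/-- Deliver the initial positions of the `k` servers: register `2` receives `k` and cell `i` of
array `1` receives the node of server `i`. -/
def loadServers {n k : ℕ} (σ : State) (c : Fin k → Fin n) : State where
  var := Function.update σ.var 2 k
  arr := Function.update σ.arr 1 (fun i => if h : i < k then c ⟨i, h⟩ else σ.arr 1 i)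

/-- Deliver a request: register `3` receives the requested node. -/
def loadRequest {n : ℕ} (σ : State) (q : Fin n) : State :=
  σ.setVar 3 q

/-- The current positions of the servers, as kept in array `1`, are given by `c`. -/
def HoldsServers {n k : ℕ} (σ : State) (c : Fin k → Fin n) : Prop :=
  ∀ i : Fin k, σ.arr 1 i = c i

end KServer

/-! Root the tree at the request `q`. Paths to `q` become chains of ancestors. Order the servers by
`rank`: distance to `q`, ties broken by index. Walking freely, server `j` reaches the chain of
server `i` at time `dist q (c j)` minus the depth of the lowest common ancestor of the two
(`meetDepth`). The number of steps of `i` is the least such time over all `j` of smaller rank,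
capped by the least distance `m` of any server to `q` (`chrobakLarmore_of_steps`). That `j` may
itself have been stopped earlier does no harm: at every time up to `m`, some server of no larger
rank is still walking and is at least as far ahead on the same chain.

The `k` minima are found without comparing all pairs. An Euler tour traverses each directed edge at
most once. Read cyclically from a visit of `q`, it therefore visits every subtree of the tree rooted
at `q` in one interval, although it was built for the root `r` (`inSubtree_of_between`). With the
servers sorted by this cyclic order, the meeting depth of two of them is the minimum over the
consecutive gaps between them. One pass with a monotone stack from the left and one from the right
then find all minima in time `O(k)` (`passCode_run`, `chrobakLarmore_of_passes`). Only the sorting,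
by a tournament tree, costs `k log k` (`extractLoop_run`). Each distance needs one lowest common
ancestor, and each final position one more and a level ancestor (`walkToward_eq`).

Both kinds of ancestor query take constant time after linear preprocessing. The tour is cut into
blocks of `B = log n + 1` visits, so a set of visits in a block is a word below `2 ^ B ≤ 2 n`, and a
table of logarithms gives its leading bit. The depth of a lowest common ancestor is a range minimum
of depths over the tour: bit masks answer it inside a block, a sparse table across blocks. A level
ancestor at distance at most `B` is the last visit of its depth, or, if this lies before the current
block, one of the near ancestors of the start of the block (`shortLA_run`). For a longer distance
one first jumps by a multiple of `B` from the start of a block whose number is rounded down to a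
power of two fitting the distance (`levelAncestorCode_run`). Tables with `log nb` levels over `nb`
blocks stay linear because `nb * B` is at most `3 n`. -/

namespace WordRAM

/-! ### Reasoning about RAM programs: overflow, frames and running times -/

instance : Add Expr := ⟨.bin .add⟩
instance : Sub Expr := ⟨.bin .sub⟩
instance : Mul Expr := ⟨.bin .mul⟩
instance : Div Expr := ⟨.bin .div⟩
instance : Mod Expr := ⟨.bin .mod⟩

/-- The test `a < b` as an expression. -/
def Expr.lt (a b : Expr) : Expr := .bin .lt a b
/-- The test `a = b` as an expression. -/
def Expr.eq (a b : Expr) : Expr := .bin .eq a b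
/-- `a` shifted left by `b` bits. -/
def Expr.shl (a b : Expr) : Expr := .bin .shl a b
/-- `a` shifted right by `b` bits. -/
def Expr.shr (a b : Expr) : Expr := .bin .shr a b
/-- Bitwise disjunction. -/
def Expr.lor (a b : Expr) : Expr := .bin .lor a b

prefix:max "♯" => Expr.const
infixr:35 " ;; " => Stmt.seq
infix:40 " ≔ " => Stmt.assign

/-- The value of an expression when nothing overflows. -/
def Expr.val (σ : State) : Expr → ℕ
  | .const c => c
  | .var x => σ.var x
  | .get a i => σ.arr a (i.val σ)
  | .bin o e₁ e₂ => o.apply (e₁.val σ) (e₂.val σ)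

/-- The result of the operation has to be checked for overflow. -/
def Op.Fits (w : ℕ) : Op → ℕ → ℕ → Prop
  | .add, a, b => a + b < 2 ^ w
  | .mul, a, b => a * b < 2 ^ w
  | .shl, a, b => a <<< b < 2 ^ w
  | _, _, _ => True

/-- No operation of the expression overflows. -/
def Expr.Safe (w : ℕ) (σ : State) : Expr → Prop
  | .const c => c < 2 ^ w
  | .var _ => True
  | .get _ i => i.Safe w σ
  | .bin o e₁ e₂ => e₁.Safe w σ ∧ e₂.Safe w σ ∧ o.Fits w (e₁.val σ) (e₂.val σ)

/-- All cells of the memory hold words of `w` bits. -/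
structure State.WF (w : ℕ) (σ : State) : Prop where
  one_lt : 1 < 2 ^ w
  var : ∀ x, σ.var x < 2 ^ w
  arr : ∀ a i, σ.arr a i < 2 ^ w

theorem Op.apply_lt {w a b : ℕ} (o : Op) (h₁ : 1 < 2 ^ w) (ha : a < 2 ^ w) (hb : b < 2 ^ w) (h : o.Fits w a b) :
    o.apply a b < 2 ^ w := by
  cases o <;> simp only [Op.apply, Op.Fits] at *
  case add => exact h
  case mul => exact h
  case shl => exact h
  case sub => omega
  case div => exact (Nat.div_le_self _ _).trans_lt ha
  case mod => exact (Nat.mod_le _ _).trans_lt ha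
  case land => exact Nat.and_lt_two_pow _ hb
  case lor => exact Nat.or_lt_two_pow ha hb
  case xor => exact Nat.xor_lt_two_pow ha hb
  case shr => exact (Nat.shiftRight_le _ _).trans_lt ha
  all_goals split <;> omega

theorem Expr.val_lt {w : ℕ} {σ : State} (hσ : σ.WF w) : ∀ e : Expr, e.Safe w σ → e.val σ < 2 ^ w
  | .const _, h => h
  | .var x, _ => hσ.var x
  | .get a _, _ => hσ.arr a _
  | .bin o e₁ e₂, h => o.apply_lt hσ.one_lt (e₁.val_lt hσ h.1) (e₂.val_lt hσ h.2.1) h.2.2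

theorem Expr.eval_lt {w : ℕ} {σ : State} (hσ : σ.WF w) (e : Expr) : e.eval w σ < 2 ^ w := by
  cases e with
  | const c => exact Nat.mod_lt _ (by positivity)
  | var x => exact hσ.var x
  | get a i => exact hσ.arr _ _
  | bin o e₁ e₂ => exact Nat.mod_lt _ (by positivity)

/-- Lets programs be analysed with exact arithmetic: truncation to words enters only through the
side condition `Safe`. -/
theorem Expr.eval_eq_val {w : ℕ} {σ : State} (hσ : σ.WF w) :
    ∀ e : Expr, e.Safe w σ → e.eval w σ = e.val σ
  | .const _, h => Nat.mod_eq_of_lt h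
  | .var _, _ => rfl
  | .get a i, h => congrArg (σ.arr a) (i.eval_eq_val hσ h)
  | .bin o e₁ e₂, h => by
      have h₁ := e₁.eval_eq_val hσ h.1
      have h₂ := e₂.eval_eq_val hσ h.2.1
      simp only [Expr.eval, h₁, h₂, Expr.val]
      exact Nat.mod_eq_of_lt (o.apply_lt hσ.one_lt (e₁.val_lt hσ h.1) (e₂.val_lt hσ h.2.1) h.2.2)

theorem State.WF.setVar {w : ℕ} {σ : State} (hσ : σ.WF w) (x : ℕ) {v : ℕ} (hv : v < 2 ^ w) :
    (σ.setVar x v).WF w := by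
  refine ⟨hσ.one_lt, fun y => ?_, hσ.arr⟩
  simp only [State.setVar, Function.update_apply]
  split
  · exact hv
  · exact hσ.var y

theorem State.WF.setArr {w : ℕ} {σ : State} (hσ : σ.WF w) (a i : ℕ) {v : ℕ} (hv : v < 2 ^ w) :
    (σ.setArr a i v).WF w := by
  refine ⟨hσ.one_lt, hσ.var, fun b j => ?_⟩
  simp only [State.setArr, Function.update_apply]
  split
  · simp only [Function.update_apply]
    split
    · exact hv
    · exact hσ.arr _ _
  · exact hσ.arr b j

theorem Exec.wf {w : ℕ} {s : Stmt} {σ σ' : State} {t : ℕ} (h : Exec w s σ σ' t) :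
    σ.WF w → σ'.WF w := by
  induction h with
  | skip => exact id
  | assign x e σ => exact fun hσ => hσ.setVar x (e.eval_lt hσ)
  | store a i e σ => exact fun hσ => hσ.setArr a _ (e.eval_lt hσ)
  | seq _ _ h₁ h₂ => exact fun hσ => h₂ (h₁ hσ)
  | ite_true _ _ h => exact h
  | ite_false _ _ h => exact h
  | loop_true _ _ _ h₁ h₂ => exact fun hσ => h₂ (h₁ hσ)
  | loop_false => exact id

/-- The program never assigns to the register. -/
def Stmt.keepsVar : Stmt → ℕ → Bool
  | .skip, _ => true
  | .assign x _, y => !Nat.beq x y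
  | .store _ _ _, _ => true
  | .seq s₁ s₂, y => s₁.keepsVar y && s₂.keepsVar y
  | .ite _ s₁ s₂, y => s₁.keepsVar y && s₂.keepsVar y
  | .loop _ s, y => s.keepsVar y

/-- The program never writes to the array. -/
def Stmt.keepsArr : Stmt → ℕ → Bool
  | .skip, _ => true
  | .assign _ _, _ => true
  | .store a _ _, b => !Nat.beq a b
  | .seq s₁ s₂, b => s₁.keepsArr b && s₂.keepsArr b
  | .ite _ s₁ s₂, b => s₁.keepsArr b && s₂.keepsArr b
  | .loop _ s, b => s.keepsArr b

/-- The memories differ at most where the program may write. -/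
structure Frame (s : Stmt) (σ σ' : State) : Prop where
  var : ∀ x, s.keepsVar x = true → σ'.var x = σ.var x
  arr : ∀ a, s.keepsArr a = true → σ'.arr a = σ.arr a

theorem Frame.refl (s : Stmt) (σ : State) : Frame s σ σ := ⟨fun _ _ => rfl, fun _ _ => rfl⟩

theorem Frame.trans {s : Stmt} {σ σ' σ'' : State} (h : Frame s σ σ') (h' : Frame s σ' σ'') :
    Frame s σ σ'' :=
  ⟨fun x hx => (h'.var x hx).trans (h.var x hx), fun a ha => (h'.arr a ha).trans (h.arr a ha)⟩

theorem Frame.mono {s s' : Stmt} {σ σ' : State} (h : Frame s σ σ')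
    (hv : ∀ x, s'.keepsVar x = true → s.keepsVar x = true)
    (ha : ∀ x, s'.keepsArr x = true → s.keepsArr x = true) : Frame s' σ σ' :=
  ⟨fun x hx => h.var x (hv x hx), fun a hx => h.arr a (ha a hx)⟩

/-- What a program leaves unchanged is a Boolean computation on its text, so later uses are
discharged by `rfl`. -/
theorem Exec.frame {w : ℕ} {s : Stmt} {σ σ' : State} {t : ℕ} (h : Exec w s σ σ' t) :
    Frame s σ σ' := by
  induction h with
  | skip => exact .refl _ _
  | assign x e σ =>
    refine ⟨fun y hy => ?_, fun _ _ => rfl⟩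
    have : y ≠ x := by rintro rfl; simp [Stmt.keepsVar] at hy
    simp [State.setVar, this]
  | store a i e σ =>
    refine ⟨fun _ _ => rfl, fun y hy => ?_⟩
    have : y ≠ a := by rintro rfl; simp [Stmt.keepsArr] at hy
    simp [State.setArr, this]
  | seq _ _ h₁ h₂ =>
    refine (h₁.mono ?_ ?_).trans (h₂.mono ?_ ?_) <;>
      · intro x hx; simp [Stmt.keepsVar, Stmt.keepsArr] at hx; tauto
  | ite_true _ _ h =>
    refine h.mono ?_ ?_ <;> · intro x hx; simp [Stmt.keepsVar, Stmt.keepsArr] at hx; tauto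
  | ite_false _ _ h =>
    refine h.mono ?_ ?_ <;> · intro x hx; simp [Stmt.keepsVar, Stmt.keepsArr] at hx; tauto
  | loop_true _ _ _ h₁ h₂ => exact Frame.trans (h₁.mono (fun _ h => h) (fun _ h => h)) h₂
  | loop_false => exact .refl _ _

/-- The program halts from `σ` after at most `T` steps, in a memory that satisfies `Q`. -/
def Run (w : ℕ) (s : Stmt) (σ : State) (T : ℕ) (Q : State → Prop) : Prop :=
  ∃ σ' t, Exec w s σ σ' t ∧ t ≤ T ∧ Q σ'

theorem Run.mono {w : ℕ} {s : Stmt} {σ : State} {T T' : ℕ} {Q Q' : State → Prop}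
    (h : Run w s σ T Q) (hσ : σ.WF w) (hT : T ≤ T')
    (hQ : ∀ σ', σ'.WF w → Frame s σ σ' → Q σ' → Q' σ') : Run w s σ T' Q' := by
  obtain ⟨σ', t, he, ht, hq⟩ := h
  exact ⟨σ', t, he, ht.trans hT, hQ _ (he.wf hσ) he.frame hq⟩

theorem Run.mono_time {w : ℕ} {s : Stmt} {σ : State} {T T' : ℕ} {Q : State → Prop}
    (h : Run w s σ T Q) (hT : T ≤ T') : Run w s σ T' Q := by
  obtain ⟨σ', t, he, ht, hq⟩ := h
  exact ⟨σ', t, he, ht.trans hT, hq⟩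

theorem Run.seq {w : ℕ} {s₁ s₂ : Stmt} {σ : State} {T₁ T₂ : ℕ} {P Q : State → Prop}
    (hσ : σ.WF w) (h₁ : Run w s₁ σ T₁ P)
    (h₂ : ∀ σ', σ'.WF w → Frame s₁ σ σ' → P σ' → Run w s₂ σ' T₂ Q) :
    Run w (s₁ ;; s₂) σ (T₁ + T₂) Q := by
  obtain ⟨σ', t, he, ht, hp⟩ := h₁
  obtain ⟨σ'', t', he', ht', hq⟩ := h₂ σ' (he.wf hσ) he.frame hp
  exact ⟨σ'', t + t', he.seq he', by omega, hq⟩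

/-- An upper bound for the running time of a program without loops. -/
def Stmt.time : Stmt → ℕ
  | .skip => 1
  | .assign _ e => e.cost + 1
  | .store _ i e => i.cost + e.cost + 1
  | .seq s₁ s₂ => s₁.time + s₂.time
  | .ite e s₁ s₂ => e.cost + 1 + (s₁.time + s₂.time)
  | .loop _ _ => 0

/-- Weakest preconditions of programs without loops. -/
def Stmt.wp (w : ℕ) : Stmt → (State → Prop) → State → Prop
  | .skip, Q, σ => Q σ
  | .assign x e, Q, σ => e.Safe w σ ∧ ∀ v, v = e.val σ → Q (σ.setVar x v)
  | .store a i e, Q, σ => i.Safe w σ ∧ e.Safe w σ ∧ Q (σ.setArr a (i.val σ) (e.val σ))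
  | .seq s₁ s₂, Q, σ => s₁.wp w (s₂.wp w Q) σ
  | .ite e s₁ s₂, Q, σ => e.Safe w σ ∧ (e.val σ ≠ 0 → s₁.wp w Q σ) ∧ (e.val σ = 0 → s₂.wp w Q σ)
  | .loop _ _, _, _ => False

/-- The time bound of a loop-free program depends on its text alone. The value `0` that `Stmt.time`
gives to a loop does no harm here, since `wp` of a loop is `False`. -/
theorem Run.of_wp {w : ℕ} : ∀ {s : Stmt} {σ : State} {Q : State → Prop}, σ.WF w → s.wp w Q σ →
    Run w s σ s.time Q
  | .skip, σ, _, _, h => ⟨σ, 1, .skip σ, le_rfl, h⟩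
  | .assign x e, σ, _, hσ, h => ⟨_, _, .assign x e σ, le_rfl, by
      rw [e.eval_eq_val hσ h.1]; exact h.2 _ rfl⟩
  | .store a i e, σ, _, hσ, h => ⟨_, _, .store a i e σ, le_rfl, by
      rw [i.eval_eq_val hσ h.1, e.eval_eq_val hσ h.2.1]; exact h.2.2⟩
  | .seq s₁ s₂, σ, Q, hσ, h => by
      obtain ⟨σ', t, he, ht, hp⟩ := Run.of_wp (s := s₁) hσ h
      obtain ⟨σ'', t', he', ht', hq⟩ := Run.of_wp (s := s₂) (he.wf hσ) hp
      exact ⟨σ'', t + t', he.seq he', by simp only [Stmt.time]; omega, hq⟩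
  | .ite e s₁ s₂, σ, Q, hσ, h => by
      by_cases hc : e.val σ = 0
      · obtain ⟨σ', t, he, ht, hq⟩ := Run.of_wp (s := s₂) hσ (h.2.2 hc)
        exact ⟨σ', _, .ite_false (by rw [e.eval_eq_val hσ h.1]; exact hc) he,
          by simp only [Stmt.time]; omega, hq⟩
      · obtain ⟨σ', t, he, ht, hq⟩ := Run.of_wp (s := s₁) hσ (h.2.1 hc)
        exact ⟨σ', _, .ite_true (by rw [e.eval_eq_val hσ h.1]; exact hc) he,
          by simp only [Stmt.time]; omega, hq⟩

theorem Run.ite {w : ℕ} {e : Expr} {s₁ s₂ : Stmt} {σ : State} {T₁ T₂ : ℕ} {Q : State → Prop}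
    (hσ : σ.WF w) (hs : e.Safe w σ) (h₁ : e.val σ ≠ 0 → Run w s₁ σ T₁ Q)
    (h₂ : e.val σ = 0 → Run w s₂ σ T₂ Q) : Run w (.ite e s₁ s₂) σ (e.cost + 1 + (T₁ + T₂)) Q := by
  by_cases hc : e.val σ = 0
  · obtain ⟨σ', t, he, ht, hq⟩ := h₂ hc
    exact ⟨σ', _, .ite_false (by rw [e.eval_eq_val hσ hs]; exact hc) he, by omega, hq⟩
  · obtain ⟨σ', t, he, ht, hq⟩ := h₁ hc
    exact ⟨σ', _, .ite_true (by rw [e.eval_eq_val hσ hs]; exact hc) he, by omega, hq⟩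

/-- The measure `μ` drops in every round, so there are at most `μ σ` rounds and one final test. -/
theorem Run.loop {w : ℕ} {e : Expr} {s : Stmt} {σ : State} (I : State → Prop) (μ : State → ℕ)
    (c : ℕ) (hσ : σ.WF w) (h₀ : I σ) (hs : ∀ σ', σ'.WF w → I σ' → e.Safe w σ')
    (step : ∀ σ', σ'.WF w → Frame s σ σ' → I σ' → e.val σ' ≠ 0 →
      Run w s σ' c (fun σ'' => I σ'' ∧ μ σ'' < μ σ')) :
    Run w (.loop e s) σ ((μ σ + 1) * (c + e.cost + 1)) (fun σ' => I σ' ∧ e.val σ' = 0) := by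
  suffices H : ∀ m σ', μ σ' ≤ m → σ'.WF w → Frame s σ σ' → I σ' →
      Run w (.loop e s) σ' ((m + 1) * (c + e.cost + 1)) (fun σ' => I σ' ∧ e.val σ' = 0) from
    H _ _ le_rfl hσ (.refl _ _) h₀
  intro m
  induction m with
  | zero =>
    intro σ' hm hw hf hI
    by_cases hc : e.val σ' = 0
    · refine ⟨σ', _, .loop_false (by rw [e.eval_eq_val hw (hs _ hw hI)]; exact hc), ?_, hI, hc⟩
      omega
    · obtain ⟨σ'', t, he, ht, hI', hlt⟩ := step σ' hw hf hI hc
      omega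
  | succ m ih =>
    intro σ' hm hw hf hI
    by_cases hc : e.val σ' = 0
    · refine ⟨σ', _, .loop_false (by rw [e.eval_eq_val hw (hs _ hw hI)]; exact hc), ?_, hI, hc⟩
      rw [Nat.add_mul]; omega
    · obtain ⟨σ'', t, he, ht, hI', hlt⟩ := step σ' hw hf hI hc
      obtain ⟨σ₃, t', he', ht', hq⟩ := ih σ'' (by omega) (he.wf hw) (hf.trans he.frame) hI'
      refine ⟨σ₃, _, .loop_true (by rw [e.eval_eq_val hw (hs _ hw hI)]; exact hc) he he', ?_, hq⟩
      rw [Nat.add_mul (m + 1)]; omega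

/-- `for x := 0, …, y - 1 do s`, where the bound is the register `y`. -/
def Stmt.for (x y : ℕ) (s : Stmt) : Stmt :=
  x ≔ ♯0 ;; .loop (.lt (.var x) (.var y)) (s ;; x ≔ .var x + ♯1)

/-- The increment of the counter is built into the postcondition of the body, which can thus be
verified without it. The frame handed to each round tells which registers and arrays still have
their values from before the loop. -/
theorem Run.for {w x y N : ℕ} {s : Stmt} {σ : State} (J : ℕ → State → Prop) (c : ℕ) (hσ : σ.WF w)
    (hxy : Nat.beq x y = false) (hx : s.keepsVar x = true) (hy : s.keepsVar y = true)
    (hN : σ.var y = N) (h₀ : J 0 (σ.setVar x 0))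
    (step : ∀ i < N, ∀ σ', σ'.WF w → Frame (.for x y s) σ σ' → σ'.var x = i → J i σ' →
      Run w s σ' c (fun σ'' => J (i + 1) (σ''.setVar x (i + 1)))) :
    Run w (.for x y s) σ (2 + (N + 1) * (c + 8)) (fun σ' => J N σ' ∧ σ'.var x = N) := by
  have hne : x ≠ y := by rintro rfl; simp at hxy
  have hNw : N < 2 ^ w := hN ▸ hσ.var y
  have h1w : 0 < 2 ^ w := by positivity
  refine Run.seq hσ (P := fun σ' => σ' = σ.setVar x 0)
    ⟨_, _, .assign _ _ _, le_rfl, by simp [Expr.eval]⟩ ?_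
  rintro σ₁ hw₁ hf₁ rfl
  refine (Run.loop (fun σ' => ∃ i ≤ N, σ'.var x = i ∧ σ'.var y = N ∧ J i σ' ∧
    Frame (.for x y s) σ σ') (fun σ' => N - σ'.var x) (c + 4) hw₁
    ⟨0, Nat.zero_le _, by simp [State.setVar], by simp [State.setVar, hne.symm, hN], h₀,
      hf₁.mono ?_ ?_⟩ ?_ ?_).mono hw₁ ?_ ?_
  · intro z hz; simp [Stmt.for, Stmt.keepsVar] at hz ⊢; tauto
  · intro z hz; rfl
  · intro σ' _ _; exact ⟨trivial, trivial, trivial⟩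
  · rintro σ' hw hf ⟨i, hi, hxi, hyN, hJ, hF⟩ hc
    have hiN : i < N := by
      simp only [Expr.lt, Expr.val, Op.apply, hxi, hyN] at hc
      by_contra h; simp [h] at hc
    refine Run.seq hw (step i hiN σ' hw hF hxi hJ) ?_
    intro σ'' hw'' hf'' hJ''
    have e1 : σ''.var x = i := (hf''.var x hx).trans hxi
    refine ⟨_, _, .assign _ _ _, le_rfl, ?_⟩
    have ev : (Expr.var x + ♯1).eval w σ'' = i + 1 := by
      show (σ''.var x + 1 % 2 ^ w) % 2 ^ w = i + 1
      rw [e1, Nat.mod_eq_of_lt (a := 1) (by omega), Nat.mod_eq_of_lt (by omega)]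
    rw [ev]
    refine ⟨⟨i + 1, hiN, by simp [State.setVar], ?_, hJ'', ?_⟩, ?_⟩
    · simp [State.setVar, hne.symm, hf''.var y hy, hyN]
    · refine hF.trans ⟨fun z hz => ?_, fun z hz => ?_⟩
      · have hzx : z ≠ x := by rintro rfl; simp [Stmt.for, Stmt.keepsVar] at hz
        simp only [State.setVar, Function.update_of_ne hzx]
        refine hf''.var z ?_
        simp [Stmt.for, Stmt.keepsVar] at hz; tauto
      · refine hf''.arr z ?_
        simp [Stmt.for, Stmt.keepsArr] at hz; tauto
    · simp only [State.setVar, Function.update_self, hxi]; omega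
  · have : (σ.setVar x 0).var x = 0 := by simp [State.setVar]
    rw [this]
    exact Nat.mul_le_mul le_rfl (by simp [Expr.lt, Expr.cost])
  · rintro σ' hw hf ⟨⟨i, hi, hxi, hyN, hJ, hF⟩, hc⟩
    have hiN : i = N := by
      simp only [Expr.lt, Expr.val, Op.apply, hxi, hyN] at hc
      by_contra h
      rw [if_pos (by omega)] at hc; omega
    subst hiN
    exact ⟨hJ, hxi⟩

@[simp] theorem Expr.val_const (σ : State) (c : ℕ) : (Expr.const c).val σ = c := rfl
@[simp] theorem Expr.val_var (σ : State) (x : ℕ) : (Expr.var x).val σ = σ.var x := rfl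
@[simp] theorem Expr.val_get (σ : State) (a : ℕ) (i : Expr) :
    (Expr.get a i).val σ = σ.arr a (i.val σ) := rfl
@[simp] theorem Expr.val_add (σ : State) (a b : Expr) : (a + b).val σ = a.val σ + b.val σ := rfl
@[simp] theorem Expr.val_sub (σ : State) (a b : Expr) : (a - b).val σ = a.val σ - b.val σ := rfl
@[simp] theorem Expr.val_mul (σ : State) (a b : Expr) : (a * b).val σ = a.val σ * b.val σ := rfl
@[simp] theorem Expr.val_div (σ : State) (a b : Expr) : (a / b).val σ = a.val σ / b.val σ := rfl
@[simp] theorem Expr.val_mod (σ : State) (a b : Expr) : (a % b).val σ = a.val σ % b.val σ := rfl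
@[simp] theorem Expr.val_lt_eq (σ : State) (a b : Expr) :
    (a.lt b).val σ = if a.val σ < b.val σ then 1 else 0 := rfl
@[simp] theorem Expr.val_eq_eq (σ : State) (a b : Expr) :
    (a.eq b).val σ = if a.val σ = b.val σ then 1 else 0 := rfl
@[simp] theorem Expr.val_shl (σ : State) (a b : Expr) :
    (a.shl b).val σ = a.val σ * 2 ^ b.val σ := Nat.shiftLeft_eq _ _
@[simp] theorem Expr.val_shr (σ : State) (a b : Expr) :
    (a.shr b).val σ = a.val σ / 2 ^ b.val σ := Nat.shiftRight_eq_div_pow _ _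
@[simp] theorem Expr.val_lor (σ : State) (a b : Expr) :
    (a.lor b).val σ = a.val σ ||| b.val σ := rfl

@[simp] theorem Expr.safe_const (w : ℕ) (σ : State) (c : ℕ) :
    (Expr.const c).Safe w σ ↔ c < 2 ^ w := Iff.rfl
@[simp] theorem Expr.safe_var (w : ℕ) (σ : State) (x : ℕ) : (Expr.var x).Safe w σ := trivial
@[simp] theorem Expr.safe_get (w : ℕ) (σ : State) (a : ℕ) (i : Expr) :
    (Expr.get a i).Safe w σ ↔ i.Safe w σ := Iff.rfl
@[simp] theorem Expr.safe_add (w : ℕ) (σ : State) (a b : Expr) :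
    (a + b).Safe w σ ↔ a.Safe w σ ∧ b.Safe w σ ∧ a.val σ + b.val σ < 2 ^ w := Iff.rfl
@[simp] theorem Expr.safe_mul (w : ℕ) (σ : State) (a b : Expr) :
    (a * b).Safe w σ ↔ a.Safe w σ ∧ b.Safe w σ ∧ a.val σ * b.val σ < 2 ^ w := Iff.rfl
@[simp] theorem Expr.safe_shl (w : ℕ) (σ : State) (a b : Expr) :
    (a.shl b).Safe w σ ↔ a.Safe w σ ∧ b.Safe w σ ∧ a.val σ * 2 ^ b.val σ < 2 ^ w := by
  rw [← Nat.shiftLeft_eq]; exact Iff.rfl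
@[simp] theorem Expr.safe_sub (w : ℕ) (σ : State) (a b : Expr) :
    (a - b).Safe w σ ↔ a.Safe w σ ∧ b.Safe w σ := ⟨fun h => ⟨h.1, h.2.1⟩, fun h => ⟨h.1, h.2, trivial⟩⟩
@[simp] theorem Expr.safe_div (w : ℕ) (σ : State) (a b : Expr) :
    (a / b).Safe w σ ↔ a.Safe w σ ∧ b.Safe w σ := ⟨fun h => ⟨h.1, h.2.1⟩, fun h => ⟨h.1, h.2, trivial⟩⟩
@[simp] theorem Expr.safe_mod (w : ℕ) (σ : State) (a b : Expr) :
    (a % b).Safe w σ ↔ a.Safe w σ ∧ b.Safe w σ := ⟨fun h => ⟨h.1, h.2.1⟩, fun h => ⟨h.1, h.2, trivial⟩⟩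
@[simp] theorem Expr.safe_lt (w : ℕ) (σ : State) (a b : Expr) :
    (a.lt b).Safe w σ ↔ a.Safe w σ ∧ b.Safe w σ := ⟨fun h => ⟨h.1, h.2.1⟩, fun h => ⟨h.1, h.2, trivial⟩⟩
@[simp] theorem Expr.safe_eq (w : ℕ) (σ : State) (a b : Expr) :
    (a.eq b).Safe w σ ↔ a.Safe w σ ∧ b.Safe w σ := ⟨fun h => ⟨h.1, h.2.1⟩, fun h => ⟨h.1, h.2, trivial⟩⟩
@[simp] theorem Expr.safe_shr (w : ℕ) (σ : State) (a b : Expr) :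
    (a.shr b).Safe w σ ↔ a.Safe w σ ∧ b.Safe w σ := ⟨fun h => ⟨h.1, h.2.1⟩, fun h => ⟨h.1, h.2, trivial⟩⟩
@[simp] theorem Expr.safe_lor (w : ℕ) (σ : State) (a b : Expr) :
    (a.lor b).Safe w σ ↔ a.Safe w σ ∧ b.Safe w σ := ⟨fun h => ⟨h.1, h.2.1⟩, fun h => ⟨h.1, h.2, trivial⟩⟩

@[simp] theorem State.setVar_arr (σ : State) (x v : ℕ) : (σ.setVar x v).arr = σ.arr := rfl
@[simp] theorem State.setVar_var (σ : State) (x v y : ℕ) :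
    (σ.setVar x v).var y = if y = x then v else σ.var y := by
  simp [State.setVar, Function.update_apply]
@[simp] theorem State.setArr_var (σ : State) (a i v : ℕ) : (σ.setArr a i v).var = σ.var := rfl
@[simp] theorem State.setArr_arr (σ : State) (a i v b j : ℕ) :
    (σ.setArr a i v).arr b j = if b = a ∧ j = i then v else σ.arr b j := by
  simp only [State.setArr, Function.update_apply]
  split <;> simp_all [Function.update_apply]

@[simp] theorem Stmt.wp_skip (w : ℕ) (Q : State → Prop) (σ : State) :
    Stmt.skip.wp w Q σ ↔ Q σ := Iff.rfl
@[simp] theorem Stmt.wp_assign (w x : ℕ) (e : Expr) (Q : State → Prop) (σ : State) :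
    (x ≔ e).wp w Q σ ↔ e.Safe w σ ∧ ∀ v, v = e.val σ → Q (σ.setVar x v) := Iff.rfl
@[simp] theorem Stmt.wp_store (w a : ℕ) (i e : Expr) (Q : State → Prop) (σ : State) :
    (Stmt.store a i e).wp w Q σ ↔ i.Safe w σ ∧ e.Safe w σ ∧ Q (σ.setArr a (i.val σ) (e.val σ)) :=
  Iff.rfl
@[simp] theorem Stmt.wp_seq (w : ℕ) (s₁ s₂ : Stmt) (Q : State → Prop) (σ : State) :
    (s₁ ;; s₂).wp w Q σ ↔ s₁.wp w (s₂.wp w Q) σ := Iff.rfl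
@[simp] theorem Stmt.wp_ite (w : ℕ) (e : Expr) (s₁ s₂ : Stmt) (Q : State → Prop) (σ : State) :
    (Stmt.ite e s₁ s₂).wp w Q σ ↔
      e.Safe w σ ∧ (e.val σ ≠ 0 → s₁.wp w Q σ) ∧ (e.val σ = 0 → s₂.wp w Q σ) := Iff.rfl

/-- The value is named `v` at once, so that the remaining goal speaks of a mathematical quantity
instead of an ever growing expression. -/
theorem Stmt.wp_assign_seq {w x : ℕ} {e : Expr} {s : Stmt} {Q : State → Prop} {σ : State} (v : ℕ)
    (hs : e.Safe w σ) (hv : e.val σ = v) (h : s.wp w Q (σ.setVar x v)) :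
    (x ≔ e ;; s).wp w Q σ :=
  ⟨hs, fun _ hv' => by rw [hv', hv]; exact h⟩

theorem Stmt.wp_assign_of {w x : ℕ} {e : Expr} {Q : State → Prop} {σ : State} (v : ℕ)
    (hs : e.Safe w σ) (hv : e.val σ = v) (h : Q (σ.setVar x v)) : (x ≔ e).wp w Q σ :=
  ⟨hs, fun _ hv' => by rw [hv', hv]; exact h⟩

theorem Stmt.wp_store_seq {w a : ℕ} {i e : Expr} {s : Stmt} {Q : State → Prop} {σ : State}
    (j v : ℕ) (hi : i.Safe w σ) (hj : i.val σ = j) (hs : e.Safe w σ) (hv : e.val σ = v)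
    (h : s.wp w Q (σ.setArr a j v)) : (Stmt.store a i e ;; s).wp w Q σ :=
  ⟨hi, hs, by rw [hj, hv]; exact h⟩

theorem Stmt.wp_store_of {w a : ℕ} {i e : Expr} {Q : State → Prop} {σ : State}
    (j v : ℕ) (hi : i.Safe w σ) (hj : i.val σ = j) (hs : e.Safe w σ) (hv : e.val σ = v)
    (h : Q (σ.setArr a j v)) : (Stmt.store a i e).wp w Q σ :=
  ⟨hi, hs, by rw [hj, hv]; exact h⟩

end WordRAM

/-! ### Rooted trees, ancestors and meeting depths -/

namespace KServer

/-- `par` and `dep` are the parent and the depth function of a tree rooted at `r`. -/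
structure RootedTree {V : Type*} (r : V) (par : V → V) (dep : V → ℕ) : Prop where
  par_root : par r = r
  dep_root : dep r = 0
  dep_par : ∀ v, v ≠ r → dep v = dep (par v) + 1

/-- The ancestor of `v` at depth `d`. -/
def anc {V : Type*} (par : V → V) (dep : V → ℕ) (v : V) (d : ℕ) : V := par^[dep v - d] v

open Classical in
/-- The largest depth at which `u` and `v` have the same ancestor. -/
noncomputable def meet {V : Type*} (par : V → V) (dep : V → ℕ) (u v : V) : ℕ :=
  Nat.findGreatest (fun d => d ≤ dep v ∧ anc par dep u d = anc par dep v d) (dep u)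

namespace RootedTree

variable {V : Type*} {r : V} {par : V → V} {dep : V → ℕ}

theorem dep_par_eq (T : RootedTree r par dep) (v : V) : dep (par v) = dep v - 1 := by
  by_cases h : v = r
  · subst h; rw [T.par_root, T.dep_root]
  · have := T.dep_par v h; omega

theorem eq_root (T : RootedTree r par dep) {v : V} (h : dep v = 0) : v = r := by
  by_contra hv
  have := T.dep_par v hv; omega

theorem dep_iterate (T : RootedTree r par dep) (m : ℕ) (v : V) : dep (par^[m] v) = dep v - m := by
  induction m with
  | zero => simp
  | succ m ih => rw [Function.iterate_succ_apply', T.dep_par_eq, ih]; omega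

theorem dep_anc (T : RootedTree r par dep) {v : V} {d : ℕ} (h : d ≤ dep v) :
    dep (anc par dep v d) = d := by
  rw [anc, T.dep_iterate]; omega

theorem anc_zero (T : RootedTree r par dep) (v : V) : anc par dep v 0 = r :=
  T.eq_root (T.dep_anc (Nat.zero_le _))

theorem anc_iterate (T : RootedTree r par dep) {v : V} {m d : ℕ} (h : d + m ≤ dep v) :
    anc par dep (par^[m] v) d = anc par dep v d := by
  rw [anc, anc, T.dep_iterate, ← Function.iterate_add_apply]
  congr 1; omega

theorem anc_par (T : RootedTree r par dep) {v : V} {d : ℕ} (h : d < dep v) :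
    anc par dep (par v) d = anc par dep v d := T.anc_iterate (m := 1) h

theorem anc_anc (T : RootedTree r par dep) {v : V} {d e : ℕ} (hd : d ≤ e) (he : e ≤ dep v) :
    anc par dep (anc par dep v e) d = anc par dep v d := by
  conv_lhs => rw [anc]
  rw [T.dep_anc he, anc, anc, ← Function.iterate_add_apply]
  congr 1; omega

theorem anc_eq_of_le (T : RootedTree r par dep) {u v : V} {d e : ℕ} (hd : d ≤ e) (hu : e ≤ dep u)
    (hv : e ≤ dep v) (h : anc par dep u e = anc par dep v e) :
    anc par dep u d = anc par dep v d := by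
  rw [← T.anc_anc hd hu, ← T.anc_anc hd hv, h]

theorem anc_step (T : RootedTree r par dep) {u v : V} {d : ℕ} (h : par u = v ∨ par v = u)
    (hu : d ≤ dep u) (hv : d ≤ dep v) : anc par dep u d = anc par dep v d := by
  wlog h' : par u = v generalizing u v
  · exact (this h.symm hv hu (h.resolve_left h')).symm
  by_cases hr : u = r
  · subst hr; rw [← h', T.par_root]
  · subst h'
    have := T.dep_par u hr
    exact (T.anc_par (by omega)).symm

theorem dep_step (T : RootedTree r par dep) {u v : V} (h : par u = v ∨ par v = u) :
    dep u ≤ dep v + 1 ∧ dep v ≤ dep u + 1 := by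
  rcases h with rfl | rfl <;> rw [T.dep_par_eq] <;> omega

theorem meet_spec (T : RootedTree r par dep) (u v : V) :
    meet par dep u v ≤ dep u ∧ meet par dep u v ≤ dep v ∧
      anc par dep u (meet par dep u v) = anc par dep v (meet par dep u v) := by
  classical
  have h := Nat.findGreatest_spec (P := fun d => d ≤ dep v ∧ anc par dep u d = anc par dep v d)
    (Nat.zero_le (dep u)) ⟨Nat.zero_le _, by rw [T.anc_zero, T.anc_zero]⟩
  unfold meet
  exact ⟨Nat.findGreatest_le _, by convert h.1, by convert h.2⟩

theorem le_meet (_T : RootedTree r par dep) {u v : V} {d : ℕ} (hu : d ≤ dep u) (hv : d ≤ dep v)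
    (h : anc par dep u d = anc par dep v d) : d ≤ meet par dep u v := by
  classical
  have := Nat.le_findGreatest (P := fun d => d ≤ dep v ∧ anc par dep u d = anc par dep v d)
    hu ⟨hv, h⟩
  unfold meet
  convert this

theorem anc_eq_of_le_meet (T : RootedTree r par dep) {u v : V} {d : ℕ}
    (h : d ≤ meet par dep u v) : anc par dep u d = anc par dep v d :=
  T.anc_eq_of_le h (T.meet_spec u v).1 (T.meet_spec u v).2.1 (T.meet_spec u v).2.2

theorem meet_comm (T : RootedTree r par dep) (u v : V) :
    meet par dep u v = meet par dep v u := by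
  apply le_antisymm
  · exact T.le_meet (T.meet_spec u v).2.1 (T.meet_spec u v).1 (T.meet_spec u v).2.2.symm
  · exact T.le_meet (T.meet_spec v u).2.1 (T.meet_spec v u).1 (T.meet_spec v u).2.2.symm

theorem meet_self (T : RootedTree r par dep) (u : V) : meet par dep u u = dep u :=
  le_antisymm (T.meet_spec u u).1 (T.le_meet le_rfl le_rfl rfl)

/-- Having the same ancestor at a given depth is transitive, so meeting depths satisfy the
ultrametric inequality. -/
theorem min_meet_le (T : RootedTree r par dep) (u v x : V) :
    min (meet par dep u v) (meet par dep v x) ≤ meet par dep u x := by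
  refine T.le_meet ((min_le_left _ _).trans (T.meet_spec u v).1)
    ((min_le_right _ _).trans (T.meet_spec v x).2.1) ?_
  rw [T.anc_eq_of_le_meet (min_le_left _ _), T.anc_eq_of_le_meet (min_le_right _ _)]

end RootedTree

/-! ### Distances and ancestors in a tree graph -/

section Graph

variable {V : Type*} {G : SimpleGraph V}

theorem stepToward_self (q : V) : stepToward G q q = q := by
  unfold stepToward
  rw [dif_neg]
  rintro ⟨u, _, h⟩
  simp at h

theorem stepToward_spec (hG : G.IsTree) {v q : V} (h : v ≠ q) :
    G.Adj v (stepToward G v q) ∧ G.dist (stepToward G v q) q + 1 = G.dist v q := by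
  have hex : ∃ u, G.Adj v u ∧ G.dist u q + 1 = G.dist v q := by
    obtain ⟨p, hp⟩ := hG.connected.exists_walk_length_eq_dist v q
    cases p with
    | nil => exact absurd rfl h
    | @cons _ u _ hadj p =>
      refine ⟨u, hadj, ?_⟩
      rw [SimpleGraph.Walk.length_cons] at hp
      have h1 := SimpleGraph.dist_le p
      have h2 := hG.dist_eq_dist_add_one_of_adj q hadj
      rw [G.dist_comm (u := q), G.dist_comm (u := q)] at h2
      omega
  rw [stepToward, dif_pos hex]
  exact hex.choose_spec

/-- Two different neighbours closer to `q` would start two different shortest paths from `v` to `q`,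
but in an acyclic graph there is only one path. -/
theorem eq_of_closer (hG : G.IsTree) {v q a b : V} (ha : G.Adj v a) (hb : G.Adj v b)
    (hda : G.dist a q + 1 = G.dist v q) (hdb : G.dist b q + 1 = G.dist v q) : a = b := by
  obtain ⟨p, hp⟩ := hG.connected.exists_walk_length_eq_dist a q
  obtain ⟨p', hp'⟩ := hG.connected.exists_walk_length_eq_dist b q
  have h1 := SimpleGraph.Walk.isPath_of_length_eq_dist (SimpleGraph.Walk.cons ha p) (by simp; omega)
  have h2 := SimpleGraph.Walk.isPath_of_length_eq_dist (SimpleGraph.Walk.cons hb p') (by simp; omega)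
  have := congrArg Subtype.val ((hG.isAcyclic.subsingleton_path v q).elim ⟨_, h1⟩ ⟨_, h2⟩)
  simp only [SimpleGraph.Walk.cons.injEq] at this
  exact this.1

/-- The root is free: the tables use the fixed root `r`, the analysis of a request uses the root
`q`. -/
theorem rootedTree_of_isTree (hG : G.IsTree) (q : V) :
    RootedTree q (fun v => stepToward G v q) (fun v => G.dist q v) where
  par_root := stepToward_self q
  dep_root := by simp
  dep_par v hv := by
    rw [G.dist_comm, G.dist_comm (u := q)]
    exact (stepToward_spec hG hv).2.symm

theorem stepToward_of_adj (hG : G.IsTree) (q : V) {u v : V} (h : G.Adj u v) :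
    stepToward G u q = v ∨ stepToward G v q = u := by
  rcases hG.dist_eq_dist_add_one_of_adj q h with h' | h' <;>
    rw [G.dist_comm, G.dist_comm (u := q)] at h'
  · left
    have hu : u ≠ q := by rintro rfl; simp at h'
    have := stepToward_spec hG hu
    exact eq_of_closer hG this.1 h this.2 h'.symm
  · right
    have hu : v ≠ q := by rintro rfl; simp at h'
    have := stepToward_spec hG hu
    exact eq_of_closer hG this.1 h.symm this.2 h'.symm

theorem adj_or_eq_of_stepToward (hG : G.IsTree) {r u v : V} (h : stepToward G u r = v) :
    G.Adj u v ∨ u = v := by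
  subst h
  by_cases hu : u = r
  · right; subst hu; exact (stepToward_self _).symm
  · exact Or.inl (stepToward_spec hG hu).1

/-- A step between neighbours in the tree rooted at `r` is one in the tree rooted at `q`. -/
theorem stepToward_reroot (hG : G.IsTree) {r u v : V} (q : V)
    (h : stepToward G u r = v ∨ stepToward G v r = u) :
    u = v ∨ stepToward G u q = v ∨ stepToward G v q = u := by
  rcases h with h | h
  · rcases adj_or_eq_of_stepToward hG h with h | h
    · exact Or.inr (stepToward_of_adj hG q h)
    · exact Or.inl h
  · rcases adj_or_eq_of_stepToward hG h with h | h
    · exact Or.inr (stepToward_of_adj hG q h.symm)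
    · exact Or.inl h.symm

theorem dist_iterate_le (hG : G.IsTree) (q v : V) (m : ℕ) :
    G.dist ((fun v => stepToward G v q)^[m] v) v ≤ m := by
  induction m with
  | zero => simp
  | succ m ih =>
    rw [Function.iterate_succ_apply']
    set x := (fun v => stepToward G v q)^[m] v
    have h1 : G.dist (stepToward G x q) x ≤ 1 := by
      rcases adj_or_eq_of_stepToward hG (rfl : stepToward G x q = _) with h | h
      · rw [SimpleGraph.dist_eq_one_iff_adj.2 h.symm]
      · rw [← h]; simp
    have := hG.connected.dist_triangle (u := stepToward G x q) (v := x) (w := v)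
    omega

/-- The depth of the lowest common ancestor in the tree rooted at `q`. -/
noncomputable def meetDepth (G : SimpleGraph V) (q u v : V) : ℕ :=
  meet (fun v => stepToward G v q) (fun v => G.dist q v) u v

/-- The ancestor at depth `d` in the tree rooted at `q`. -/
noncomputable def ancAt (G : SimpleGraph V) (q v : V) (d : ℕ) : V :=
  anc (fun v => stepToward G v q) (fun v => G.dist q v) v d

theorem meetDepth_spec (hG : G.IsTree) (q u v : V) :
    meetDepth G q u v ≤ G.dist q u ∧ meetDepth G q u v ≤ G.dist q v ∧
      ancAt G q u (meetDepth G q u v) = ancAt G q v (meetDepth G q u v) :=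
  (rootedTree_of_isTree hG q).meet_spec u v

theorem le_meetDepth (hG : G.IsTree) {q u v : V} {d : ℕ} (hu : d ≤ G.dist q u)
    (hv : d ≤ G.dist q v) (h : ancAt G q u d = ancAt G q v d) : d ≤ meetDepth G q u v :=
  (rootedTree_of_isTree hG q).le_meet hu hv h

theorem ancAt_eq_of_le_meetDepth (hG : G.IsTree) {q u v : V} {d : ℕ} (h : d ≤ meetDepth G q u v) :
    ancAt G q u d = ancAt G q v d :=
  (rootedTree_of_isTree hG q).anc_eq_of_le_meet h

theorem ancAt_self (G : SimpleGraph V) (q v : V) : ancAt G q v (G.dist q v) = v := by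
  simp [ancAt, anc]

theorem ancAt_stepToward (hG : G.IsTree) {q v : V} {d : ℕ} (h : d < G.dist q v) :
    ancAt G q (stepToward G v q) d = ancAt G q v d :=
  (rootedTree_of_isTree hG q).anc_par h

theorem ancAt_ancAt (hG : G.IsTree) {q v : V} {d e : ℕ} (hd : d ≤ e) (he : e ≤ G.dist q v) :
    ancAt G q (ancAt G q v e) d = ancAt G q v d :=
  (rootedTree_of_isTree hG q).anc_anc hd he

theorem dist_stepToward (hG : G.IsTree) {q v : V} (h : v ≠ q) :
    G.dist q v = G.dist q (stepToward G v q) + 1 :=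
  (rootedTree_of_isTree hG q).dep_par v h

/-- The way through the common ancestor gives one inequality. The other follows along any walk from
`u` to `v`: stepping from `u` to its parent lowers the depth by one and does not raise the meeting
depth, and stepping to a child raises the meeting depth by at most one. -/
theorem dist_add_meetDepth (hG : G.IsTree) (q u v : V) :
    G.dist u v + 2 * meetDepth G q u v = G.dist q u + G.dist q v := by
  obtain ⟨a1, a2, a3⟩ := meetDepth_spec hG q u v
  apply le_antisymm
  · have h1 := dist_iterate_le hG q u (G.dist q u - meetDepth G q u v)
    have h2 := dist_iterate_le hG q v (G.dist q v - meetDepth G q u v)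
    change G.dist (ancAt G q u _) u ≤ _ at h1
    change G.dist (ancAt G q v _) v ≤ _ at h2
    rw [a3] at h1
    have := hG.connected.dist_triangle (u := u)
      (v := ancAt G q v (meetDepth G q u v)) (w := v)
    rw [G.dist_comm (u := u) (v := ancAt G q v _)] at this
    omega
  · obtain ⟨p, hp⟩ := hG.connected.exists_walk_length_eq_dist u v
    rw [← hp]
    clear hp a1 a2 a3
    induction p with
    | @nil u =>
      have : G.dist q u ≤ meetDepth G q u u := le_meetDepth hG le_rfl le_rfl rfl
      simp only [SimpleGraph.Walk.length_nil]; omega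
    | @cons u u' v h p ih =>
      obtain ⟨a1, a2, a3⟩ := meetDepth_spec hG q u' v
      rw [SimpleGraph.Walk.length_cons]
      rcases stepToward_of_adj hG q h with h' | h'
      · have hu : u ≠ q := by
          rintro rfl
          rw [stepToward_self] at h'
          exact h.ne h'
        have hd := dist_stepToward hG hu
        rw [h'] at hd
        have h1 : meetDepth G q u' v ≤ meetDepth G q u v := by
          refine le_meetDepth hG (by omega) a2 ?_
          rw [← a3, ← ancAt_stepToward hG (v := u) (by omega), h']
        omega
      · have hu : u' ≠ q := by
          rintro rfl
          rw [stepToward_self] at h'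
          exact h.ne h'.symm
        have hd := dist_stepToward hG hu
        rw [h'] at hd
        have h1 : meetDepth G q u' v - 1 ≤ meetDepth G q u v := by
          refine le_meetDepth hG (by omega) (by omega) ?_
          rw [← ancAt_eq_of_le_meetDepth hG (u := u') (v := v) (Nat.sub_le _ _), ← h',
            ancAt_stepToward hG (by omega)]
        omega

/-- By the distance formula, a node is on the path from the root exactly when its meeting depth with
`v` is its own depth. -/
theorem isAncestor_iff (hG : G.IsTree) (r a v : V) :
    IsAncestor G r a v ↔ G.dist r a ≤ G.dist r v ∧ ancAt G r v (G.dist r a) = a := by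
  have hd := dist_add_meetDepth hG r a v
  obtain ⟨a1, a2, a3⟩ := meetDepth_spec hG r a v
  unfold IsAncestor OnPath
  constructor
  · intro h
    have e : meetDepth G r a v = G.dist r a := by omega
    refine ⟨by omega, ?_⟩
    rw [e, ancAt_self] at a3
    exact a3.symm
  · rintro ⟨h1, h2⟩
    have : G.dist r a ≤ meetDepth G r a v := le_meetDepth hG le_rfl h1 (by rw [ancAt_self, h2])
    omega

theorem dist_ancAt (hG : G.IsTree) {r v : V} {d : ℕ} (h : d ≤ G.dist r v) :
    G.dist r (ancAt G r v d) = d := (rootedTree_of_isTree hG r).dep_anc h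

theorem isAncestor_ancAt (hG : G.IsTree) {r v : V} {d : ℕ} (h : d ≤ G.dist r v) :
    IsAncestor G r (ancAt G r v d) v := by
  rw [isAncestor_iff hG, dist_ancAt hG h]
  exact ⟨h, rfl⟩

theorem isLCA_ancAt (hG : G.IsTree) (r u v : V) :
    IsLCA G r u v (ancAt G r u (meetDepth G r u v)) := by
  obtain ⟨a1, a2, a3⟩ := meetDepth_spec hG r u v
  have hu := isAncestor_ancAt hG a1
  have hv : IsAncestor G r (ancAt G r u (meetDepth G r u v)) v := by
    rw [a3]; exact isAncestor_ancAt hG a2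
  refine ⟨hu, hv, fun b hbu hbv => ?_⟩
  have h1 := (isAncestor_iff hG _ _ _).1 hbu
  have h2 := (isAncestor_iff hG _ _ _).1 hbv
  have := le_meetDepth hG h1.1 h2.1 (h1.2.trans h2.2.symm)
  have hd := dist_ancAt hG a1
  unfold IsAncestor OnPath at hbu hbv hu hv
  constructor <;> omega

end Graph

end KServer

/-! ### Subtrees and Euler tours -/

namespace KServer

variable {V : Type*} {G : SimpleGraph V}

/-- `v` lies in the subtree of `x` when the tree is rooted at `q`. -/
def InSubtree (G : SimpleGraph V) (q x v : V) : Prop :=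
  G.dist q x ≤ G.dist q v ∧ ancAt G q v (G.dist q x) = x

theorem inSubtree_self (G : SimpleGraph V) (q x : V) : InSubtree G q x x :=
  ⟨le_rfl, ancAt_self G q x⟩

/-- The edge between `x` and its parent is the only one that joins the subtree of `x` to the rest of
the tree. -/
theorem enter_subtree (hG : G.IsTree) {q x u v : V}
    (h : stepToward G u q = v ∨ stepToward G v q = u) (hu : ¬ InSubtree G q x u)
    (hv : InSubtree G q x v) : v = x ∧ stepToward G x q = u := by
  have T := rootedTree_of_isTree hG q
  have key : ∀ a b : V, stepToward G a q = b → InSubtree G q x b → InSubtree G q x a := by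
    rintro a b rfl hb
    by_cases ha : a = q
    · subst ha; rwa [stepToward_self] at hb
    · have := dist_stepToward hG ha
      refine ⟨by have := hb.1; omega, ?_⟩
      rw [← ancAt_stepToward hG (by have := hb.1; omega), hb.2]
  rcases h with h | h
  · exact absurd (key _ _ h hv) hu
  · by_cases hvx : G.dist q v = G.dist q x
    · have : v = x := by rw [← hv.2, ← hvx, ancAt_self]
      subst this
      exact ⟨rfl, h⟩
    · have h1 := hv.1
      have hvq : v ≠ q := by rintro rfl; exact hvx (by rw [SimpleGraph.dist_self] at h1 ⊢; omega)
      have := dist_stepToward hG hvq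
      subst h
      exact absurd ⟨by omega, by rw [ancAt_stepToward hG (by omega), hv.2]⟩ hu

theorem exists_step_of_not {P : ℕ → Prop} {a b : ℕ} (hab : a ≤ b) (ha : ¬ P a) (hb : P b) :
    ∃ t, a ≤ t ∧ t < b ∧ ¬ P t ∧ P (t + 1) := by
  induction b, hab using Nat.le_induction with
  | base => exact absurd hb ha
  | succ b hab ih =>
    by_cases h : P b
    · obtain ⟨t, h1, h2, h3⟩ := ih h
      exact ⟨t, h1, by omega, h3⟩
    · exact ⟨b, hab, by omega, h, hb⟩

/-- `E` is a depth first walk through the tree rooted at `r`: it visits all nodes at the times below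
`N`, starts and ends in the root, and enters every node only once from its parent. -/
structure EulerTour (G : SimpleGraph V) (r : V) (N : ℕ) (E : ℕ → V) : Prop where
  pos : 0 < N
  zero : E 0 = r
  last : E (N - 1) = r
  step : ∀ t, stepToward G (E t) r = E (t + 1) ∨
    (stepToward G (E (t + 1)) r = E t ∧ ∀ s ≤ t, E s ≠ E (t + 1))
  surj : ∀ v, ∃ t < N, E t = v

namespace EulerTour

variable {r : V} {N : ℕ} {E : ℕ → V}

theorem step' (h : EulerTour G r N E) (t : ℕ) :
    stepToward G (E t) r = E (t + 1) ∨ stepToward G (E (t + 1)) r = E t :=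
  (h.step t).imp_right And.left

theorem dist_step (hG : G.IsTree) (h : EulerTour G r N E) (t : ℕ) :
    G.dist r (E t) ≤ G.dist r (E (t + 1)) + 1 ∧ G.dist r (E (t + 1)) ≤ G.dist r (E t) + 1 :=
  (rootedTree_of_isTree hG r).dep_step (h.step' t)

theorem dist_le_add (hG : G.IsTree) (h : EulerTour G r N E) (s m : ℕ) :
    G.dist r (E s) ≤ G.dist r (E (s + m)) + m ∧ G.dist r (E (s + m)) ≤ G.dist r (E s) + m := by
  induction m with
  | zero => simp
  | succ m ih =>
    have := h.dist_step hG (s + m)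
    rw [show s + (m + 1) = s + m + 1 from rfl]
    omega

/-- As long as the walk stays at depth at least `d`, the ancestor at depth `d` does not change. -/
theorem ancAt_eq (hG : G.IsTree) (h : EulerTour G r N E) {s e d : ℕ} (hse : s ≤ e)
    (hd : ∀ t, s ≤ t → t ≤ e → d ≤ G.dist r (E t)) : ancAt G r (E s) d = ancAt G r (E e) d := by
  induction e, hse using Nat.le_induction with
  | base => rfl
  | succ e hse ih =>
    rw [ih fun t h1 h2 => hd t h1 (by omega)]
    exact (rootedTree_of_isTree hG r).anc_step (h.step' e) (hd e hse (by omega))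
      (hd (e + 1) (by omega) le_rfl)

/-- A step down reaches a new node, so it cannot be repeated. After a step up out of a subtree, the
walk can return only by a step down to the root of that subtree, which has been visited already. -/
theorem edge_unique (hG : G.IsTree) (h : EulerTour G r N E) {t t' : ℕ} (h1 : E t = E t')
    (h2 : E (t + 1) = E (t' + 1)) (hne : E t ≠ E (t + 1)) : t = t' := by
  by_contra htt
  wlog hlt : t < t' generalizing t t'
  · exact this h1.symm h2.symm (by rwa [← h1, ← h2]) (Ne.symm htt) (by omega)
  rcases h.step t' with hs | ⟨_, hs⟩
  · have hout : ¬ InSubtree G r (E t) (E (t + 1)) := by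
      intro hin
      rw [← h1, ← h2] at hs
      have hr : E t ≠ r := by
        intro hr; rw [hr, stepToward_self] at hs; exact hne (hr.trans hs)
      have := dist_stepToward hG hr
      rw [hs] at this
      have := hin.1
      omega
    obtain ⟨s, hs1, hs2, hs3, hs4⟩ := exists_step_of_not
      (P := fun s => InSubtree G r (E t) (E s)) (show t + 1 ≤ t' by omega) hout
      (h1 ▸ inSubtree_self G r _)
    rcases h.step s with hst | ⟨hst, hfresh⟩
    · have := enter_subtree hG (Or.inl hst) hs3 hs4
      have e1 : stepToward G (E (s + 1)) r = E s := by rw [this.1]; exact this.2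
      have e2 : E s = r ∨ E s ≠ r := em _
      rcases e2 with e2 | e2
      · rw [e2, stepToward_self] at hst
        exact hs3 (by simpa only [e2, hst] using hs4)
      · have d1 := dist_stepToward hG e2
        rw [hst] at d1
        by_cases e3 : E (s + 1) = r
        · rw [e3, stepToward_self] at e1; exact e2 e1.symm
        · have d2 := dist_stepToward hG e3
          rw [e1] at d2; omega
    · have := enter_subtree hG (Or.inr hst) hs3 hs4
      exact hfresh t (by omega) this.1.symm
  · exact hs (t + 1) (by omega) h2

/-- The walk read cyclically from the time `s` on enters every subtree of the tree rooted at `E s`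
only once. -/
theorem inSubtree_of_between (hG : G.IsTree) (h : EulerTour G r N E) {s : ℕ} (hs : s < N)
    {x : V} {a b c : ℕ} (hab : a ≤ b) (hbc : b ≤ c) (hc : c < N)
    (ha : InSubtree G (E s) x (E ((s + a) % N))) (hc' : InSubtree G (E s) x (E ((s + c) % N))) :
    InSubtree G (E s) x (E ((s + b) % N)) := by
  by_contra hb
  -- The reading starts at the root `E s` of the tree considered here. Only the whole tree contains
  -- it, and in that case `b` would be inside too.
  have h0 : ¬ InSubtree G (E s) x (E ((s + 0) % N)) := by
    rw [Nat.add_zero, Nat.mod_eq_of_lt hs]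
    rintro ⟨h1, h2⟩
    rw [SimpleGraph.dist_self, Nat.le_zero] at h1
    apply hb
    refine ⟨by omega, ?_⟩
    have T := rootedTree_of_isTree hG (E s)
    rw [h1] at h2 ⊢
    rw [← h2, ancAt, ancAt, T.anc_zero, T.anc_zero]
  -- The cyclic step from time `N - 1` to time `0` stays in `r`, so it crosses no edge.
  have hstep : ∀ e, E ((s + e) % N) = E ((s + (e + 1)) % N) ∨
      ((s + e) % N + 1 = (s + (e + 1)) % N ∧
        (stepToward G (E ((s + e) % N)) r = E ((s + (e + 1)) % N) ∨
          stepToward G (E ((s + (e + 1)) % N)) r = E ((s + e) % N))) := by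
    intro e
    have hlt := Nat.mod_lt (s + e) h.pos
    have hm : (s + (e + 1)) % N = ((s + e) % N + 1) % N := by
      rw [← Nat.add_assoc, Nat.mod_add_mod]
    by_cases hl : (s + e) % N + 1 = N
    · left
      rw [hm, hl, Nat.mod_self, h.zero, ← h.last]
      congr 1; omega
    · right
      have := Nat.mod_eq_of_lt (show (s + e) % N + 1 < N by omega)
      rw [this] at hm
      exact ⟨hm.symm, hm ▸ h.step' _⟩
  have enter : ∀ e, ¬ InSubtree G (E s) x (E ((s + e) % N)) →
      InSubtree G (E s) x (E ((s + (e + 1)) % N)) →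
      (s + e) % N + 1 = (s + (e + 1)) % N ∧ E ((s + (e + 1)) % N) = x ∧
        E ((s + e) % N) = stepToward G x (E s) ∧ E ((s + e) % N) ≠ E ((s + (e + 1)) % N) := by
    intro e h1 h2
    have hne : E ((s + e) % N) ≠ E ((s + (e + 1)) % N) := fun he => h1 (he ▸ h2)
    rcases hstep e with h3 | ⟨h3, h4⟩
    · exact absurd h3 hne
    · have := enter_subtree hG ((stepToward_reroot hG (E s) h4).resolve_left hne) h1 h2
      exact ⟨h3, this.1, this.2.symm, hne⟩
  obtain ⟨e, he1, he2, he3, he4⟩ := exists_step_of_not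
    (P := fun e => InSubtree G (E s) x (E ((s + e) % N))) (Nat.zero_le a) h0 ha
  obtain ⟨f, hf1, hf2, hf3, hf4⟩ := exists_step_of_not
    (P := fun e => InSubtree G (E s) x (E ((s + e) % N))) hbc hb hc'
  obtain ⟨e1, e2, e3, e4⟩ := enter e he3 he4
  obtain ⟨f1, f2, f3, f4⟩ := enter f hf3 hf4
  -- Both entries into the subtree use the directed edge from the parent of `x` to `x`, so they are
  -- one and the same step. But `e < a ≤ b ≤ f`.
  have := h.edge_unique hG (e3.trans f3.symm) (by rw [e1, f1, e2, f2]) (by rwa [e1])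
  have h5 : (s + e) % N = (s + f) % N := this
  have h6 : (s + e) ≡ (s + f) [MOD N] := h5
  have h7 : e ≡ f [MOD N] := Nat.ModEq.add_left_cancel' s h6
  have h8 : e % N = f % N := h7
  rw [Nat.mod_eq_of_lt (by omega), Nat.mod_eq_of_lt (by omega)] at h8
  omega

/-- The subtree of the lowest common ancestor of the outer visits contains both of them, hence also
the middle one. -/
theorem meetDepth_le_of_between (hG : G.IsTree) (h : EulerTour G r N E) {s : ℕ} (hs : s < N)
    {a b c : ℕ} (hab : a ≤ b) (hbc : b ≤ c) (hc : c < N) :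
    meetDepth G (E s) (E ((s + a) % N)) (E ((s + c) % N)) ≤
      min (meetDepth G (E s) (E ((s + a) % N)) (E ((s + b) % N)))
        (meetDepth G (E s) (E ((s + b) % N)) (E ((s + c) % N))) := by
  obtain ⟨h1, h2, h3⟩ := meetDepth_spec hG (E s) (E ((s + a) % N)) (E ((s + c) % N))
  set d := meetDepth G (E s) (E ((s + a) % N)) (E ((s + c) % N))
  have hd := dist_ancAt hG h1
  have hb := h.inSubtree_of_between hG hs hab hbc hc
    (x := ancAt G (E s) (E ((s + a) % N)) d) ⟨by rw [hd]; exact h1, by rw [hd]⟩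
    ⟨by rw [hd]; exact h2, by rw [hd, h3]⟩
  rw [InSubtree, hd] at hb
  exact le_min (le_meetDepth hG h1 hb.1 hb.2.symm) (le_meetDepth hG hb.1 h2 (hb.2.trans h3))

theorem meetDepth_le_dist (hG : G.IsTree) (h : EulerTour G r N E) {a b c : ℕ} (hab : a ≤ b)
    (hbc : b ≤ c) (hc : c < N) : meetDepth G r (E a) (E c) ≤ G.dist r (E b) := by
  have := h.meetDepth_le_of_between hG h.pos hab hbc hc
  rw [h.zero, Nat.zero_add, Nat.zero_add, Nat.zero_add, Nat.mod_eq_of_lt hc,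
    Nat.mod_eq_of_lt (by omega), Nat.mod_eq_of_lt (by omega)] at this
  have h2 := (meetDepth_spec hG r (E a) (E b)).2.1
  omega

/-- The depth of the lowest common ancestor is the least depth between two visits. -/
theorem meetDepth_eq (hG : G.IsTree) (h : EulerTour G r N E) {a c m : ℕ} (hac : a ≤ c)
    (hc : c < N) (hm : ∀ t, a ≤ t → t ≤ c → m ≤ G.dist r (E t))
    (hex : ∃ t, a ≤ t ∧ t ≤ c ∧ G.dist r (E t) ≤ m) : meetDepth G r (E a) (E c) = m := by
  obtain ⟨t, h1, h2, h3⟩ := hex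
  refine le_antisymm ((h.meetDepth_le_dist hG h1 h2 hc).trans h3) ?_
  exact le_meetDepth hG (hm a le_rfl hac) (hm c hac le_rfl) (h.ancAt_eq hG hac hm)

end EulerTour

end KServer

/-! ### Closed form of the Chrobak–Larmore rule -/

namespace KServer

variable {V : Type*} {G : SimpleGraph V}

/-- With the tree rooted at `q`, being on the path to the request means being an ancestor. -/
theorem onPath_iff_inSubtree (hG : G.IsTree) (u q x : V) :
    OnPath G u q x ↔ InSubtree G q x u := by
  rw [InSubtree, ← isAncestor_iff hG, IsAncestor, OnPath, OnPath, G.dist_comm (u := u) (v := x),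
    G.dist_comm (u := x) (v := q), G.dist_comm (u := u) (v := q), Nat.add_comm]

theorem InSubtree.trans (hG : G.IsTree) {q x y z : V} (h : InSubtree G q x y)
    (h' : InSubtree G q y z) : InSubtree G q x z :=
  ⟨h.1.trans h'.1, by rw [← ancAt_ancAt hG h.1 h'.1, h'.2, h.2]⟩

/-- The node that is reached from `v` after `t` steps towards `q`. -/
noncomputable def walkToward (G : SimpleGraph V) (q v : V) (t : ℕ) : V :=
  (fun v => stepToward G v q)^[t] v

theorem dist_walkToward (hG : G.IsTree) (q v : V) (t : ℕ) :
    G.dist q (walkToward G q v t) = G.dist q v - t :=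
  (rootedTree_of_isTree hG q).dep_iterate t v

theorem walkToward_eq_ancAt {q v : V} {t : ℕ} (h : t ≤ G.dist q v) :
    walkToward G q v t = ancAt G q v (G.dist q v - t) := by
  rw [ancAt, anc, walkToward]
  congr 1; omega

/-- Once `u` has climbed to the lowest common ancestor or above, its node is on the chain of `v`,
and it is ahead of `v` if it is not deeper. -/
theorem inSubtree_walkToward (hG : G.IsTree) {q u v : V} {s t : ℕ} (hs : s ≤ G.dist q u)
    (ht : t ≤ G.dist q v) (hle : G.dist q u - s ≤ G.dist q v - t)
    (hm : G.dist q u - s ≤ meetDepth G q u v) :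
    InSubtree G q (walkToward G q u s) (walkToward G q v t) := by
  refine ⟨by rwa [dist_walkToward hG, dist_walkToward hG], ?_⟩
  rw [dist_walkToward hG, walkToward_eq_ancAt ht, walkToward_eq_ancAt hs,
    ancAt_ancAt hG hle (Nat.sub_le _ _), ancAt_eq_of_le_meetDepth hG hm]

/-- The converse: a node that `u` reaches on the chain of `v` is a common ancestor of both. -/
theorem le_meetDepth_of_inSubtree (hG : G.IsTree) {q u v : V} {s t : ℕ} (hs : s ≤ G.dist q u)
    (ht : t ≤ G.dist q v) (h : InSubtree G q (walkToward G q u s) (walkToward G q v t)) :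
    G.dist q u - s ≤ meetDepth G q u v := by
  obtain ⟨h1, h2⟩ := h
  rw [dist_walkToward hG] at h1 h2
  rw [dist_walkToward hG] at h1
  rw [walkToward_eq_ancAt ht, walkToward_eq_ancAt hs, ancAt_ancAt hG h1 (Nat.sub_le _ _)] at h2
  exact le_meetDepth hG (Nat.sub_le _ _) (h1.trans (Nat.sub_le _ _)) h2.symm

variable {k : ℕ}

/-- Servers with smaller rank have priority: the closer one, and among servers at the same distance
the one of smaller index. -/
noncomputable def rank (G : SimpleGraph V) (q : V) (c : Fin k → V) (i : Fin k) : ℕ :=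
  G.dist q (c i) * k + i

theorem rank_lt_iff (q : V) (c : Fin k → V) (i j : Fin k) :
    rank G q c j < rank G q c i ↔
      G.dist q (c j) < G.dist q (c i) ∨ (G.dist q (c j) = G.dist q (c i) ∧ j < i) := by
  unfold rank
  rw [Fin.lt_def]
  have hi := i.2
  have hj := j.2
  rcases lt_trichotomy (G.dist q (c j)) (G.dist q (c i)) with h | h | h
  · have : (G.dist q (c j) + 1) * k ≤ G.dist q (c i) * k := Nat.mul_le_mul_right _ h
    rw [Nat.add_mul] at this
    simp only [h, true_or, iff_true]; omega
  · rw [h]; simp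
  · have : (G.dist q (c i) + 1) * k ≤ G.dist q (c j) * k := Nat.mul_le_mul_right _ h
    rw [Nat.add_mul] at this
    constructor
    · intro; omega
    · rintro (h' | h') <;> omega

theorem rank_injective (q : V) (c : Fin k → V) : Function.Injective (rank G q c) := by
  intro i j h
  have h1 := rank_lt_iff (G := G) q c i j
  have h2 := rank_lt_iff (G := G) q c j i
  rw [h] at h1 h2
  simp only [lt_irrefl, false_iff, not_or, not_and, not_lt] at h1 h2
  have := le_antisymm h1.1 h2.1
  exact le_antisymm (h1.2 this.symm) (h2.2 this)

theorem dist_le_of_rank_le {q : V} {c : Fin k → V} {i j : Fin k}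
    (h : rank G q c j ≤ rank G q c i) : G.dist q (c j) ≤ G.dist q (c i) := by
  rcases h.lt_or_eq with h | h
  · rcases (rank_lt_iff q c i j).1 h with h | h
    · exact h.le
    · exact h.1.le
  · rw [rank_injective q c h]

/-- The moves of the Chrobak–Larmore rule in closed form: `T i`, the number of steps of server `i`,
is the least time at which a server of smaller rank reaches the path of `i`, or the time `m` at which
the first server reaches the request. -/
theorem chrobakLarmore_of_steps (hG : G.IsTree) (q : V) (c : Fin k → V) (m : ℕ) (T : Fin k → ℕ)
    (hm : ∀ i, m ≤ G.dist q (c i)) (hex : ∃ i, G.dist q (c i) = m) (hT : ∀ i, T i ≤ m)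
    (hTle : ∀ i j, rank G q c j < rank G q c i →
      T i ≤ G.dist q (c j) - meetDepth G q (c j) (c i))
    (hTex : ∀ i, T i = m ∨ ∃ j, rank G q c j < rank G q c i ∧
      G.dist q (c j) - meetDepth G q (c j) (c i) ≤ T i) :
    ChrobakLarmore G q c (fun i => walkToward G q (c i) (T i)) := by
  classical
  -- Although `j` may have stopped before time `s`, some server of no larger rank has not, and it is
  -- on the chain of the node that `j` would have reached. The server of least rank on this chain
  -- works: had it stopped before, its blocker would be a server of smaller rank ahead of it.
  have front : ∀ s ≤ m, ∀ j, ∃ l, rank G q c l ≤ rank G q c j ∧ s ≤ T l ∧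
      InSubtree G q (walkToward G q (c l) s) (walkToward G q (c j) s) := by
    intro s hs j
    obtain ⟨l, hl, hmin⟩ := Finset.exists_min_image
      (Finset.univ.filter fun l =>
        InSubtree G q (walkToward G q (c l) s) (walkToward G q (c j) s)) (rank G q c)
      ⟨j, by simp [inSubtree_self]⟩
    simp only [Finset.mem_filter, Finset.mem_univ, true_and] at hl hmin
    refine ⟨l, hmin j (inSubtree_self _ _ _), ?_, hl⟩
    by_contra hlt
    rcases hTex l with h | ⟨l', h1, h2⟩
    · omega
    · have h3 := dist_le_of_rank_le h1.le
      have a1 := hm l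
      have a2 := hm l'
      have := hmin l' ((inSubtree_walkToward hG (by omega) (by omega) (by omega)
        (by omega)).trans hG hl)
      omega
  have conf : ∀ t ≤ m, (phase G q)^[t] c = fun i => walkToward G q (c i) (min t (T i)) := by
    intro t
    induction t with
    | zero => intro _; funext i; simp [walkToward]
    | succ t ih =>
      intro ht
      rw [Function.iterate_succ_apply', ih (by omega)]
      funext i
      have hact : Active G q (fun i => walkToward G q (c i) (min t (T i))) i ↔ t < T i := by
        unfold Active
        simp only [onPath_iff_inSubtree hG]
        have hi := hm i
        have hTi := hT i
        constructor
        · intro hA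
          by_contra hlt
          rcases hTex i with h | ⟨j, h1, h2⟩
          · omega
          -- The blocker `j` of `i` may itself stand still, so `l` takes its place. It is on the
          -- path of `i`, and being active forces it into the same node with a larger index. As `i`
          -- has stopped no later than `l`, this contradicts the smaller rank of `l`.
          · obtain ⟨l, hl1, hl2, hl3⟩ := front t (by omega) j
            have hd := dist_le_of_rank_le h1.le
            have hj := hm j
            have hl := hm l
            have hsub : InSubtree G q (walkToward G q (c l) (min t (T l)))
                (walkToward G q (c i) (min t (T i))) := by
              rw [min_eq_left hl2, min_eq_right (by omega)]
              exact hl3.trans hG (inSubtree_walkToward hG (by omega) (by omega) (by omega)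
                (by omega))
            have hli : rank G q c l < rank G q c i := by omega
            obtain ⟨e1, e2⟩ := hA l (by rintro rfl; omega) hsub
            have e3 := congrArg (G.dist q) e1
            rw [dist_walkToward hG, dist_walkToward hG] at e3
            rcases (rank_lt_iff q c i l).1 hli with h | h
            · omega
            · exact absurd h.2 (by omega)
        -- A server on the path of `i` has reached the common ancestor by a time before `T i`, so
        -- its rank is not smaller. A server of larger rank cannot be closer to `q` now, so it is in
        -- the same node and has the larger index.
        · intro hlt j hji hsub
          have hj := hm j
          have h1 := le_meetDepth_of_inSubtree hG (by omega) (by omega) hsub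
          rcases lt_or_gt_of_ne (fun h => hji (rank_injective q c h)) with h | h
          · have := hTle i j h
            omega
          · have hd := hsub.1
            rw [dist_walkToward hG, dist_walkToward hG] at hd
            have hh := hsub.2
            rw [dist_walkToward hG] at hh
            rcases (rank_lt_iff q c j i).1 h with h | h
            · omega
            · refine ⟨?_, h.2⟩
              rw [← hh, show G.dist q (c j) - min t (T j) =
                G.dist q (walkToward G q (c i) (min t (T i))) by
                  rw [dist_walkToward hG]; omega, ancAt_self]
      unfold phase
      by_cases h : t < T i
      · rw [if_pos (hact.2 h), min_eq_left h]
        dsimp only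
        rw [min_eq_left h.le, walkToward, walkToward,
          Function.iterate_succ_apply']
      · rw [if_neg (mt hact.1 h)]
        dsimp only
        congr 1; omega
  refine ⟨m, ?_, ?_, ?_⟩
  · rw [conf m le_rfl]
    funext i
    rw [min_eq_right (hT i)]
  · obtain ⟨i₀, hi₀⟩ := hex
    -- The server of least rank is blocked by nobody and has the least distance `m`, so it arrives
    -- at time `m`.
    obtain ⟨i, _, hi⟩ := Finset.exists_min_image Finset.univ (rank G q c) ⟨i₀, by simp⟩
    refine ⟨i, ?_⟩
    have h1 := dist_le_of_rank_le (hi i₀ (by simp))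
    have h2 := hm i
    have h3 : T i = m := by
      rcases hTex i with h | ⟨j, h, _⟩
      · exact h
      · have := hi j (by simp); omega
    exact (rootedTree_of_isTree hG q).eq_root (by
      have := dist_walkToward hG q (c i) (T i)
      dsimp only at this ⊢; omega)
  · intro m' hm' i hi
    rw [conf m' hm'.le] at hi
    have h1 := dist_walkToward hG q (c i) (min m' (T i))
    dsimp only at hi
    rw [hi, SimpleGraph.dist_self] at h1
    have := hm i
    omega

/-- A step of `t` towards `q`, in terms of the ancestors in the tree rooted at `r`. -/
theorem walkToward_eq (hG : G.IsTree) (r q v : V) {t : ℕ} (ht : t ≤ G.dist q v) :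
    walkToward G q v t =
      if t + meetDepth G r v q ≤ G.dist r v then ancAt G r v (G.dist r v - t)
      else ancAt G r q (2 * meetDepth G r v q + t - G.dist r v) := by
  obtain ⟨a1, a2, a3⟩ := meetDepth_spec hG r v q
  have hd := dist_add_meetDepth hG r v q
  rw [G.dist_comm (u := v)] at hd
  set x := if t + meetDepth G r v q ≤ G.dist r v then ancAt G r v (G.dist r v - t)
      else ancAt G r q (2 * meetDepth G r v q + t - G.dist r v) with hx
  -- By the triangle inequality these two bounds force `x` onto the path, exactly `t` steps from
  -- `v`.
  suffices h : G.dist v x ≤ t ∧ G.dist x q ≤ G.dist q v - t by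
    have htri := hG.connected.dist_triangle (u := v) (v := x) (w := q)
    rw [G.dist_comm (u := v) (v := q)] at htri
    have hon : OnPath G v q x := by
      rw [OnPath, G.dist_comm (u := v) (v := q)]; omega
    have := ((onPath_iff_inSubtree hG _ _ _).1 hon).2
    rw [G.dist_comm (u := q) (v := x)] at this
    rw [← this, walkToward_eq_ancAt ht]
    congr 1; omega
  have up : ∀ u d e, d ≤ e → e ≤ G.dist r u → G.dist (ancAt G r u d) (ancAt G r u e) = e - d := by
    intro u d e hde he
    have := isAncestor_ancAt hG (r := r) (v := ancAt G r u e) (d := d)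
      (by rwa [dist_ancAt hG he])
    rw [ancAt_ancAt hG hde he] at this
    unfold IsAncestor OnPath at this
    rw [dist_ancAt hG he, dist_ancAt hG (hde.trans he)] at this
    omega
  have top1 := up v (meetDepth G r v q) (G.dist r v) a1 le_rfl
  have top2 := up q (meetDepth G r v q) (G.dist r q) a2 le_rfl
  rw [ancAt_self] at top1 top2
  split at hx
  · have h1 := up v (G.dist r v - t) (G.dist r v) (by omega) le_rfl
    have h2 := up v (meetDepth G r v q) (G.dist r v - t) (by omega) (by omega)
    rw [ancAt_self] at h1
    have h3 := hG.connected.dist_triangle (u := x) (v := ancAt G r v (meetDepth G r v q)) (w := q)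
    rw [← hx, G.dist_comm] at h1 h2
    rw [a3] at h2 h3
    omega
  · have h1 := up q (2 * meetDepth G r v q + t - G.dist r v) (G.dist r q) (by omega) le_rfl
    have h2 := up q (meetDepth G r v q) (2 * meetDepth G r v q + t - G.dist r v) (by omega)
      (by omega)
    rw [ancAt_self] at h1
    have h3 := hG.connected.dist_triangle (u := v) (v := ancAt G r v (meetDepth G r v q)) (w := x)
    rw [← hx] at h1 h2
    rw [G.dist_comm (u := v) (v := ancAt G r v _)] at h3
    rw [a3] at h3 top1
    omega

end KServer

/-! ### Sizes of the tables, and level ancestors at short distance -/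

namespace KServer

open WordRAM

/-- The sizes of the tables: blocks of `B` visits, `nb` blocks, `N` visits. -/
structure Layout (n w B nb N : ℕ) : Prop where
  one_le : 1 ≤ n
  word : 1000 * (n + 1) ≤ 2 ^ w
  B_eq : B = Nat.log 2 n + 1
  nb_eq : nb = 2 * n / B + 1
  N_eq : N = nb * B

namespace Layout

variable {n w B nb N : ℕ}

theorem B_pos (h : Layout n w B nb N) : 0 < B := by rw [h.B_eq]; omega

/-- The block length is chosen for this: the sets of visits of a block index a table of linear size.
-/
theorem two_pow_le (h : Layout n w B nb N) : 2 ^ B ≤ 2 * n := by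
  rw [h.B_eq, pow_succ]
  have := Nat.pow_log_le_self 2 (show n ≠ 0 by have := h.one_le; omega)
  omega

theorem B_le (h : Layout n w B nb N) : B ≤ n := by
  have h1 := h.two_pow_le
  rw [h.B_eq] at *
  have := Nat.lt_two_pow_self (n := Nat.log 2 n)
  rw [pow_succ] at h1
  omega

theorem B_lt (h : Layout n w B nb N) : B < w := by
  refine (Nat.pow_lt_pow_iff_right (a := 2) (by norm_num)).1 ?_
  have := h.two_pow_le
  have := h.word
  omega

theorem lt_N (h : Layout n w B nb N) : 2 * n < N := by
  rw [h.N_eq, h.nb_eq, Nat.add_mul, Nat.mul_comm (2 * n / B)]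
  have := Nat.div_add_mod (2 * n) B
  have := Nat.mod_lt (2 * n) h.B_pos
  omega

theorem N_le (h : Layout n w B nb N) : N ≤ 3 * n := by
  have := h.B_le
  rw [h.N_eq, h.nb_eq, Nat.add_mul, Nat.one_mul]
  have := Nat.div_mul_le_self (2 * n) B
  omega

theorem nb_pos (h : Layout n w B nb N) : 0 < nb := by rw [h.nb_eq]; exact Nat.succ_pos _

theorem nb_le (h : Layout n w B nb N) : nb ≤ 2 * n + 1 := by
  rw [h.nb_eq]
  exact Nat.add_le_add_right (Nat.div_le_self (2 * n) B) 1

theorem log_nb_le (h : Layout n w B nb N) : Nat.log 2 nb ≤ B := by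
  have h0 := h.one_le
  have h1 : nb < 2 ^ (B + 1) := by
    have := h.nb_le
    have h2 := Nat.lt_pow_succ_log_self (b := 2) (by norm_num) n
    rw [h.B_eq, pow_succ, pow_succ]
    rw [Nat.succ_eq_add_one, pow_succ] at h2
    omega
  have := Nat.log_lt_of_lt_pow (by have := h.nb_pos; omega) h1
  omega

/-- As `log nb ≤ B`, logarithmically many levels over the blocks have at most `2 * B * nb = 2 * N`
cells. -/
theorem levels_le (h : Layout n w B nb N) : (Nat.log 2 nb + 1) * nb ≤ 6 * n := by
  have h1 := h.log_nb_le
  have h2 : (Nat.log 2 nb + 1) * nb ≤ (B + B) * nb :=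
    Nat.mul_le_mul_right _ (by have := h.B_pos; omega)
  have h3 := h.N_le
  rw [h.N_eq] at h3
  rw [Nat.add_mul B, Nat.mul_comm B] at h2
  omega

end Layout

/-- Cell `e` of row `b` in a table of `m` rows of width `W`. -/
theorem index_lt {b e m W : ℕ} (hb : b < m) (he : e < W) : b * W + e < m * W := by
  have : (b + 1) * W ≤ m * W := Nat.mul_le_mul_right _ hb
  rw [Nat.add_mul] at this
  omega

/-- The tree with a tour of it, and the sizes of the tables. -/
structure Setup {n : ℕ} (G : SimpleGraph (Fin n)) (r : Fin n) (w B nb N : ℕ) (E : ℕ → Fin n)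
    (pos : Fin n → ℕ) : Prop extends Layout n w B nb N where
  tree : G.IsTree
  tour : EulerTour G r N E
  pos_lt : ∀ v, pos v < N
  E_pos : ∀ v, E (pos v) = v

/-- The part of the memory that holds the tree, its tour, and a table of logarithms. -/
structure Base {n : ℕ} (G : SimpleGraph (Fin n)) (r : Fin n) (B nb N : ℕ) (E : ℕ → Fin n)
    (pos : Fin n → ℕ) (σ : State) : Prop where
  n_eq : σ.var 0 = n
  r_eq : σ.var 1 = r
  B_eq : σ.var 7 = B
  N_eq : σ.var 8 = N
  nb_eq : σ.var 9 = nb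
  par_eq : ∀ v : Fin n, σ.arr 0 v = stepToward G v r
  dep_eq : ∀ v : Fin n, σ.arr 4 v = G.dist r v
  E_eq : ∀ t < N, σ.arr 5 t = E t
  lg_eq : ∀ x ≤ 2 * n + 1, σ.arr 6 x = Nat.log 2 x
  pos_eq : ∀ v : Fin n, σ.arr 7 v = pos v

/-- The program does not write to the tables in `Base`. -/
def keepsBase (s : Stmt) : Bool :=
  s.keepsVar 0 && s.keepsVar 1 && s.keepsVar 7 && s.keepsVar 8 && s.keepsVar 9 &&
    s.keepsArr 0 && s.keepsArr 4 && s.keepsArr 5 && s.keepsArr 6 && s.keepsArr 7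

variable {n : ℕ} {G : SimpleGraph (Fin n)} {r : Fin n} {w B nb N : ℕ} {E : ℕ → Fin n}
  {pos : Fin n → ℕ} {σ : State}

theorem Base.frame {s : Stmt} {σ' : State} (h : Base G r B nb N E pos σ) (hf : Frame s σ σ')
    (hk : keepsBase s = true) : Base G r B nb N E pos σ' := by
  simp only [keepsBase, Bool.and_eq_true] at hk
  obtain ⟨⟨⟨⟨⟨⟨⟨⟨⟨k0, k1⟩, k7⟩, k8⟩, k9⟩, a0⟩, a4⟩, a5⟩, a6⟩, a7⟩ := hk
  constructor
  · rw [hf.var _ k0, h.n_eq]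
  · rw [hf.var _ k1, h.r_eq]
  · rw [hf.var _ k7, h.B_eq]
  · rw [hf.var _ k8, h.N_eq]
  · rw [hf.var _ k9, h.nb_eq]
  · rw [hf.arr _ a0]; exact h.par_eq
  · rw [hf.arr _ a4]; exact h.dep_eq
  · rw [hf.arr _ a5]; exact h.E_eq
  · rw [hf.arr _ a6]; exact h.lg_eq
  · rw [hf.arr _ a7]; exact h.pos_eq

/-- The row of block `b` has, for every depth relative to the depth at the start of the block, the
set of the visits of this depth in the block. -/
def OccTable (G : SimpleGraph (Fin n)) (r : Fin n) (B nb : ℕ) (E : ℕ → Fin n) (f : ℕ → ℕ) : Prop :=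
  ∀ b < nb, ∀ e < 3 * B, f (b * (3 * B) + e) < 2 ^ B ∧ ∀ o < B,
    ((f (b * (3 * B) + e)).testBit o ↔
      G.dist r (E (b * B + o)) + 2 * B = G.dist r (E (b * B)) + e)

/-- The row of block `b` has the `2 B` nearest ancestors of the node at the start of the block. -/
def NearTable (G : SimpleGraph (Fin n)) (r : Fin n) (B nb : ℕ) (E : ℕ → Fin n) (f : ℕ → ℕ) : Prop :=
  ∀ b < nb, ∀ s < 2 * B, f (b * (2 * B) + s) = ancAt G r (E (b * B)) (G.dist r (E (b * B)) - s)

/-- Ancestors at distance at most `B`: register `25` receives the ancestor of the node in register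
`23` at the depth in register `24`. -/
def shortLA : Stmt :=
  26 ≔ .get 7 (.var 23) ;;
  27 ≔ .var 26 / .var 7 ;;
  28 ≔ .get 4 (.get 5 (.var 27 * .var 7)) ;;
  29 ≔ .get 8 (.var 27 * (♯3 * .var 7) + (.var 24 + ♯2 * .var 7 - .var 28)) %
    (♯1).shl (.var 26 % .var 7 + ♯1) ;;
  .ite (.var 29) (25 ≔ .get 5 (.var 27 * .var 7 + .get 6 (.var 29)))
    (25 ≔ .get 11 (.var 27 * (♯2 * .var 7) + (.var 28 - .var 24)))

namespace Setup

theorem n_pos (S : Setup G r w B nb N E pos) : 1 ≤ n := S.one_le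

theorem div_lt (S : Setup G r w B nb N E pos) {t : ℕ} (ht : t < N) : t / B < nb := by
  rw [Nat.div_lt_iff_lt_mul S.B_pos, ← S.N_eq]; exact ht

theorem dist_lt (S : Setup G r w B nb N E pos) (v : Fin n) : G.dist r v < n := by
  obtain ⟨p, hp, hl⟩ := S.tree.connected.exists_path_of_dist r v
  rw [← hl]
  simpa using hp.length_lt

/-- All depths from the start `s` of a block on are above `d`, or the last visit of depth `d` before
`t` is the visit with the largest number in the block that has depth `d`. -/
theorem ancAt_eq_of_last (S : Setup G r w B nb N E pos) {s t d : ℕ} (hst : s ≤ t)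
    (hs : G.dist r (E s) = d) (hd : d ≤ G.dist r (E t))
    (hlast : ∀ t', s < t' → t' ≤ t → G.dist r (E t') ≠ d) : ancAt G r (E t) d = E s := by
  rw [← S.tour.ancAt_eq S.tree hst, ← hs, ancAt_self]
  intro t' h1 h2
  by_contra hlt
  obtain ⟨e, he1, he2, he3, he4⟩ := exists_step_of_not (P := fun e => d ≤ G.dist r (E e)) h2 hlt hd
  have := S.tour.dist_step S.tree e
  exact hlast (e + 1) (by omega) (by omega) (by omega)

/-- Depths change by at most one per step, so the walk cannot get past depth `d` without a visit of
depth `d`. -/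
theorem ancAt_eq_of_none (S : Setup G r w B nb N E pos) {s t d : ℕ} (hst : s ≤ t)
    (hd : d ≤ G.dist r (E t)) (hnone : ∀ t', s ≤ t' → t' ≤ t → G.dist r (E t') ≠ d) :
    d < G.dist r (E s) ∧ ancAt G r (E s) d = ancAt G r (E t) d := by
  have key : ∀ t', s ≤ t' → t' ≤ t → d ≤ G.dist r (E t') := by
    intro t' h1 h2
    by_contra hlt
    obtain ⟨e, he1, he2, he3, he4⟩ :=
      exists_step_of_not (P := fun e => d ≤ G.dist r (E e)) h2 hlt hd
    have := S.tour.dist_step S.tree e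
    exact hnone (e + 1) (by omega) (by omega) (by omega)
  exact ⟨lt_of_le_of_ne (key s le_rfl hst) (hnone s le_rfl hst).symm,
    S.tour.ancAt_eq S.tree hst key⟩

end Setup

theorem log_testBit {m : ℕ} (hm : m ≠ 0) :
    m.testBit (Nat.log 2 m) = true ∧ ∀ i, Nat.log 2 m < i → m.testBit i = false := by
  rw [← Nat.log2_eq_log_two]
  refine ⟨Nat.testBit_log2 hm, fun i hi => ?_⟩
  exact Nat.testBit_lt_two_pow ((Nat.log2_lt hm).1 hi)

/-- The last visit of depth `d` up to `pos u` is a visit of the wanted ancestor. If it is in the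
block of `pos u`, it is the leading bit of the occurrences of depth `d`, taken modulo `2 ^ (o + 1)`
to drop the visits after `pos u`. Otherwise the block stays deeper than `d` up to `pos u`, so the
start of the block has the same ancestor, less than `2 * B` above it. -/
theorem shortLA_run (S : Setup G r w B nb N E pos) (hσ : σ.WF w) (hb : Base G r B nb N E pos σ)
    (ho : OccTable G r B nb E (σ.arr 8)) (hn : NearTable G r B nb E (σ.arr 11)) {u : Fin n} {d : ℕ}
    (hu : σ.var 23 = u) (hd : σ.var 24 = d) (h1 : d ≤ G.dist r u) (h2 : G.dist r u ≤ d + B) :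
    Run w shortLA σ shortLA.time (fun σ' => σ'.var 25 = ancAt G r u d) := by
  have hw := S.word
  have hBw := S.B_lt
  have hN := S.N_le
  have hBn := S.B_le
  have hB := S.B_pos
  have hbl := S.div_lt (S.pos_lt u)
  have hom := Nat.mod_lt (pos u) hB
  have hdm := Nat.div_add_mod' (pos u) B
  have hEp := S.E_pos u
  have hup := S.pos_lt u
  have h2B := S.two_pow_le
  set b := pos u / B with hbdef
  set o := pos u % B with hodef
  have hbB : b * B < N := by omega
  have hstep := S.tour.dist_le_add S.tree (b * B) o
  rw [hdm, hEp] at hstep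
  set D := G.dist r (E (b * B)) with hD
  have hDn : D < n := S.dist_lt _
  -- The depths of `u` and of the start of the block differ by less than `B`, and `u` is at most `B`
  -- below depth `d`. So the shifted index stays inside the row, and its subtraction is not cut off.
  have he : d + 2 * B - D < 3 * B := by omega
  have hcell := ho b hbl _ he
  set m := σ.arr 8 (b * (3 * B) + (d + 2 * B - D)) with hm
  have hocc : ∀ t', b * B ≤ t' → t' ≤ pos u → G.dist r (E t') = d →
      (m % 2 ^ (o + 1)).testBit (t' - b * B) = true := by
    intro t' h1 h2 h3
    rw [Nat.testBit_mod_two_pow, (hcell.2 (t' - b * B) (by omega)).2]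
    · simp; omega
    · rw [Nat.add_sub_cancel' h1]; omega
  have hpow : 2 ^ (o + 1) ≤ 2 ^ B := Nat.pow_le_pow_right (by norm_num) hom
  have hmm : m % 2 ^ (o + 1) < 2 ^ (o + 1) := Nat.mod_lt _ (by positivity)
  have i3 := index_lt hbl he
  have i2 : b * (2 * B) ≤ 2 * N := by rw [Nat.mul_left_comm]; omega
  have e3 : nb * (3 * B) = 3 * N := by rw [Nat.mul_left_comm, S.N_eq]
  apply Run.of_wp hσ
  refine Stmt.wp_assign_seq (pos u) (by simp) (by simp [hu, hb.pos_eq]) ?_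
  refine Stmt.wp_assign_seq b (by simp) (by simp [hb.B_eq, hbdef]) ?_
  refine Stmt.wp_assign_seq D (by simp [hb.B_eq]; omega)
    (by simp [hb.B_eq, hb.E_eq _ hbB, hb.dep_eq]; rfl) ?_
  refine Stmt.wp_assign_seq (m % 2 ^ (o + 1)) (by simp [hb.B_eq, hd, ← hodef]; omega)
    (by simp [hb.B_eq, hd, hm, ← hodef]) ?_
  refine (Stmt.wp_ite _ _ _ _ _ _).2 ⟨by simp, fun hne => ?_, fun hz => ?_⟩
  · simp at hne
    obtain ⟨t1, t2⟩ := log_testBit hne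
    set x := m % 2 ^ (o + 1) with hx
    have hlo := Nat.log_lt_of_lt_pow hne hmm
    have hlg : Nat.log 2 x < B := by omega
    rw [hx, Nat.testBit_mod_two_pow] at t1
    simp only [Bool.and_eq_true, decide_eq_true_eq] at t1
    have hd' := (hcell.2 _ hlg).1 t1.2
    have hlt : b * B + Nat.log 2 x < N := by omega
    refine Stmt.wp_assign_of (E (b * B + Nat.log 2 x)) ?_ ?_ ?_
    · simp [hb.B_eq, hb.lg_eq x (by omega)]; omega
    · simp [hb.B_eq, hb.lg_eq x (by omega), hb.E_eq _ hlt]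
    · simp only [State.setVar_var, if_true]
      congr 1
      have := S.ancAt_eq_of_last (s := b * B + Nat.log 2 x) (t := pos u) (d := d) (by omega)
        (by omega) (by rw [hEp]; exact h1) ?_
      · rw [hEp] at this; exact this.symm
      · intro t' h3 h4 h5
        have h6 := hocc t' (by omega) h4 h5
        rw [t2 _ (by omega)] at h6
        exact absurd h6 (by simp)
  · simp at hz
    have := S.ancAt_eq_of_none (s := b * B) (t := pos u) (d := d) (by omega)
      (by rw [hEp]; exact h1) ?_
    · have hs : D - d < 2 * B := by omega
      have hidx := index_lt hbl hs
      have e2 : nb * (2 * B) = 2 * N := by rw [Nat.mul_left_comm, S.N_eq]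
      refine Stmt.wp_assign_of (ancAt G r u d : Fin n) (by simp [hb.B_eq, hd]; omega) ?_ (by simp)
      simp [hb.B_eq, hd, hn b hbl _ hs]
      rw [← hD, Nat.sub_sub_self (by omega), this.2, hEp]
    · intro t' h3 h4 h5
      have h6 := hocc t' (by omega) h4 h5
      rw [hz] at h6
      simp at h6

end KServer

/-! ### Constant-time lowest common ancestors and level ancestors -/

namespace WordRAM

/-- The bound is literally `Stmt.time`, so the running time of a composite constant-time program can
be computed from its text. -/
theorem Run.seq_time {w : ℕ} {s₁ s₂ : Stmt} {σ : State} {P Q : State → Prop}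
    (hσ : σ.WF w) (h₁ : Run w s₁ σ s₁.time P)
    (h₂ : ∀ σ', σ'.WF w → Frame s₁ σ σ' → P σ' → Run w s₂ σ' s₂.time Q) :
    Run w (s₁ ;; s₂) σ (s₁ ;; s₂).time Q := Run.seq hσ h₁ h₂

theorem Run.ite_time {w : ℕ} {e : Expr} {s₁ s₂ : Stmt} {σ : State} {Q : State → Prop}
    (hσ : σ.WF w) (hs : e.Safe w σ) (h₁ : e.val σ ≠ 0 → Run w s₁ σ s₁.time Q)
    (h₂ : e.val σ = 0 → Run w s₂ σ s₂.time Q) :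
    Run w (.ite e s₁ s₂) σ (Stmt.ite e s₁ s₂).time Q := Run.ite hσ hs h₁ h₂

theorem Run.assign_time {w x : ℕ} {e : Expr} {σ : State} {Q : State → Prop} (v : ℕ)
    (hσ : σ.WF w) (hs : e.Safe w σ) (hv : e.val σ = v) (h : Q (σ.setVar x v)) :
    Run w (x ≔ e) σ (x ≔ e).time Q := Run.of_wp hσ (Stmt.wp_assign_of v hs hv h)

theorem Run.assign_seq_time {w x : ℕ} {e : Expr} {s : Stmt} {σ : State} {Q : State → Prop} (v : ℕ)
    (hσ : σ.WF w) (hs : e.Safe w σ) (hv : e.val σ = v)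
    (h : (σ.setVar x v).WF w → Run w s (σ.setVar x v) s.time Q) :
    Run w (x ≔ e ;; s) σ (x ≔ e ;; s).time Q :=
  Run.seq hσ (P := fun σ' => σ' = σ.setVar x v) (Run.of_wp hσ (Stmt.wp_assign_of v hs hv rfl))
    (by rintro σ' hσ' _ rfl; exact h hσ')

end WordRAM

namespace KServer

open WordRAM

variable {n : ℕ} {G : SimpleGraph (Fin n)} {r : Fin n} {w B nb N : ℕ} {E : ℕ → Fin n}
  {pos : Fin n → ℕ} {σ : State}

/-- `m` is the least depth of a visit in `[a, c)`. -/
def IsMinDepth (G : SimpleGraph (Fin n)) (r : Fin n) (E : ℕ → Fin n) (a c m : ℕ) : Prop :=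
  (∀ t, a ≤ t → t < c → m ≤ G.dist r (E t)) ∧ ∃ t, a ≤ t ∧ t < c ∧ G.dist r (E t) ≤ m

/-- The intervals may overlap. With truncated subtraction, `m - (m - m')` is the minimum, in the
form in which the programs compute it. -/
theorem IsMinDepth.union {a b b' c m m' : ℕ} (h : IsMinDepth G r E a b m)
    (h' : IsMinDepth G r E b' c m') (hab : a ≤ b') (hbb : b' ≤ b) (hbc : b ≤ c) :
    IsMinDepth G r E a c (m - (m - m')) := by
  refine ⟨fun t h1 h2 => ?_, ?_⟩
  · by_cases ht : t < b
    · have := h.1 t h1 ht; omega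
    · have := h'.1 t (by omega) h2; omega
  · obtain ⟨t, h1, h2, h3⟩ := h.2
    obtain ⟨t', h1', h2', h3'⟩ := h'.2
    by_cases hm : m ≤ m'
    · exact ⟨t, h1, by omega, by omega⟩
    · exact ⟨t', by omega, h2', by omega⟩

/-- The word `m` encodes the visits in the block of `i` up to `i` from which on the depth stays above
the depth of the visit; later visits have lower bits. -/
def MaskVal (D : ℕ → ℕ) (B i m : ℕ) : Prop :=
  m < 2 ^ B ∧ 2 ^ (B - 1 - i % B) ∣ m ∧ ∀ l, l / B = i / B → l ≤ i →
    m % 2 ^ (B - l % B) ≠ 0 ∧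
    l ≤ l / B * B + (B - 1 - Nat.log 2 (m % 2 ^ (B - l % B))) ∧
    l / B * B + (B - 1 - Nat.log 2 (m % 2 ^ (B - l % B))) ≤ i ∧
    ∀ t, l ≤ t → t ≤ i → D (l / B * B + (B - 1 - Nat.log 2 (m % 2 ^ (B - l % B)))) ≤ D t

/-- The masks of all visits. -/
def MaskTable (G : SimpleGraph (Fin n)) (r : Fin n) (B N : ℕ) (E : ℕ → Fin n) (f : ℕ → ℕ) : Prop :=
  ∀ i < N, MaskVal (fun t => G.dist r (E t)) B i (f i)

/-- Least depths of the visits in `2 ^ j` consecutive blocks. -/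
def SparseTable (G : SimpleGraph (Fin n)) (r : Fin n) (B nb : ℕ) (E : ℕ → Fin n) (f : ℕ → ℕ) :
    Prop :=
  ∀ j ≤ Nat.log 2 nb, ∀ b, b + 2 ^ j ≤ nb →
    IsMinDepth G r E (b * B) ((b + 2 ^ j) * B) (f (j * nb + b))

/-- Ancestors at distances that are multiples of `B`: on level `j`, those of the start of block `b`
with `2 ^ j ∣ b` have the `4 * 2 ^ j` cells from `4 * b` on. -/
def FarTable (G : SimpleGraph (Fin n)) (r : Fin n) (B nb : ℕ) (E : ℕ → Fin n) (f : ℕ → ℕ) : Prop :=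
  ∀ j ≤ Nat.log 2 nb, ∀ z < 4 * nb, f (j * (4 * nb) + z) =
    ancAt G r (E (z / 4 / 2 ^ j * 2 ^ j * B))
      (G.dist r (E (z / 4 / 2 ^ j * 2 ^ j * B)) - B * (z - 4 * (z / 4 / 2 ^ j * 2 ^ j)))

/-- Register `22` receives the least depth between the visits in registers `20` and `21` of the same
block. -/
def inMin : Stmt :=
  22 ≔ .get 6 (.get 9 (.var 21) % (♯1).shl (.var 7 - .var 20 % .var 7)) ;;
  22 ≔ .get 4 (.get 5 (.var 20 / .var 7 * .var 7 + (.var 7 - ♯1 - .var 22)))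

/-- Earlier visits have higher bits. Reducing modulo `2 ^ (B - l % B)` erases the visits before `l`,
and the leading bit of the rest marks a visit of least depth. -/
theorem inMin_run (S : Setup G r w B nb N E pos) (hσ : σ.WF w) (hb : Base G r B nb N E pos σ)
    (hm : MaskTable G r B N E (σ.arr 9)) {l i : ℕ} (hl : σ.var 20 = l) (hi : σ.var 21 = i)
    (hli : l ≤ i) (hiN : i < N) (hblk : l / B = i / B) :
    Run w inMin σ inMin.time (fun σ' => IsMinDepth G r E l (i + 1) (σ'.var 22)) := by
  have hw := S.word
  have hBw := S.B_lt
  have hN := S.N_le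
  have h2B := S.two_pow_le
  have hpw : 2 ^ (B - l % B) ≤ 2 ^ B := Nat.pow_le_pow_right (by norm_num) (Nat.sub_le _ _)
  obtain ⟨m1, m2, m3⟩ := hm i hiN
  obtain ⟨a0, a1, a2, a3⟩ := m3 l hblk hli
  set m := σ.arr 9 i with hmdef
  set x := m % 2 ^ (B - l % B) with hx
  have hxm : x ≤ m := Nat.mod_le _ _
  set p := l / B * B + (B - 1 - Nat.log 2 x) with hp
  apply Run.of_wp hσ
  refine Stmt.wp_assign_seq (Nat.log 2 x) (by simp [hb.B_eq, hl]; omega) ?_ ?_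
  · simp [hb.B_eq, hl, hi]
    rw [← hmdef, ← hx, hb.lg_eq x (by omega)]
  · refine Stmt.wp_assign_of (G.dist r (E p)) ?_ ?_ ?_
    · simp [hb.B_eq, hl]; omega
    · simp [hb.B_eq, hl]
      rw [← hp, hb.E_eq p (by omega), hb.dep_eq]
    · simp only [State.setVar_var, if_true]
      exact ⟨fun t h1 h2 => a3 t h1 (by omega), p, a1, by omega, le_rfl⟩

/-- A frame depends only on the register written, so `x ≔ ♯0` can stand for any assignment to `x`.
-/
theorem _root_.WordRAM.Frame.setVar (σ : State) (x v : ℕ) :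
    Frame (x ≔ ♯0) σ (σ.setVar x v) := by
  refine ⟨fun y hy => ?_, fun _ _ => rfl⟩
  have : y ≠ x := by rintro rfl; simp [Stmt.keepsVar] at hy
  simp [this]

theorem Base.setVar (h : Base G r B nb N E pos σ) (x v : ℕ)
    (hk : keepsBase (x ≔ ♯0) = true) : Base G r B nb N E pos (σ.setVar x v) :=
  h.frame (Frame.setVar σ x v) hk

/-- Register `22` receives the least depth between two visits of the same block. -/
def inMinAt (l i : Expr) : Stmt := 20 ≔ l ;; 21 ≔ i ;; inMin

theorem inMinAt_run (S : Setup G r w B nb N E pos) (hσ : σ.WF w) (hb : Base G r B nb N E pos σ)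
    (hm : MaskTable G r B N E (σ.arr 9)) {el ei : Expr} (l i : ℕ) (hls : el.Safe w σ)
    (hl : el.val σ = l) (his : ei.Safe w (σ.setVar 20 l)) (hi : ei.val (σ.setVar 20 l) = i)
    (hli : l ≤ i) (hiN : i < N) (hblk : l / B = i / B) :
    Run w (inMinAt el ei) σ (inMinAt el ei).time
      (fun σ' => IsMinDepth G r E l (i + 1) (σ'.var 22)) := by
  refine Run.assign_seq_time l hσ hls hl fun hσ1 => ?_
  refine Run.assign_seq_time i hσ1 his hi fun hσ2 => ?_
  exact inMin_run S hσ2 ((hb.setVar 20 l rfl).setVar 21 i rfl) hm (by simp) (by simp) hli hiN hblk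

/-- Register `34` receives the depth of the lowest common ancestor of the nodes in registers `4` and
`5`. -/
def lcaDepth : Stmt :=
  35 ≔ .get 7 (.var 4) - (.get 7 (.var 4) - .get 7 (.var 5)) ;;
  36 ≔ .get 7 (.var 4) + .get 7 (.var 5) - .var 35 ;;
  38 ≔ .var 35 / .var 7 ;;
  39 ≔ .var 36 / .var 7 ;;
  .ite ((Expr.var 38).eq (.var 39))
    (inMinAt (.var 35) (.var 36) ;; 34 ≔ .var 22)
    (inMinAt (.var 35) (.var 38 * .var 7 + (.var 7 - ♯1)) ;; 34 ≔ .var 22 ;;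
      .ite ((Expr.var 38 + ♯1).lt (.var 39))
        (40 ≔ .get 6 (.var 39 - .var 38 - ♯1) ;;
          41 ≔ .get 10 (.var 40 * .var 9 + (.var 38 + ♯1)) ;;
          34 ≔ .var 34 - (.var 34 - .var 41) ;;
          41 ≔ .get 10 (.var 40 * .var 9 + (.var 39 - (♯1).shl (.var 40))) ;;
          34 ≔ .var 34 - (.var 34 - .var 41))
        Stmt.skip ;;
      inMinAt (.var 39 * .var 7) (.var 36) ;;
      34 ≔ .var 34 - (.var 34 - .var 22))

theorem meetDepth_comm (hG : G.IsTree) (q u v : Fin n) : meetDepth G q u v = meetDepth G q v u :=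
  (rootedTree_of_isTree hG q).meet_comm u v

/-- The wanted depth is the least depth between a visit of `u` and a visit of `v`. Unless both are
in one block, the range consists of the end of a block, a possibly empty run of whole blocks, and
the beginning of a block. -/
theorem lcaDepth_run (S : Setup G r w B nb N E pos) (hσ : σ.WF w) (hb : Base G r B nb N E pos σ)
    (hm : MaskTable G r B N E (σ.arr 9)) (hs : SparseTable G r B nb E (σ.arr 10)) {u v : Fin n}
    (hu : σ.var 4 = u) (hv : σ.var 5 = v) :
    Run w lcaDepth σ lcaDepth.time (fun σ' => σ'.var 34 = meetDepth G r u v) := by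
  have hw := S.word
  have hBw := S.B_lt
  have hN := S.N_le
  have hB := S.B_pos
  have hlv := S.levels_le
  have hnb := S.nb_le
  -- The smaller of the two visit times; `c` is the larger one.
  set a := pos u - (pos u - pos v) with ha
  set c := pos u + pos v - a with hc
  have hpu := S.pos_lt u
  have hpv := S.pos_lt v
  have hac : a ≤ c := by omega
  have hcN : c < N := by omega
  have hgoal : ∀ m, IsMinDepth G r E a (c + 1) m → m = meetDepth G r u v := by
    intro m hmin
    have h := S.tour.meetDepth_eq S.tree hac hcN (m := m) (fun t h1 h2 => hmin.1 t h1 (by omega))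
      (by obtain ⟨t, h1, h2, h3⟩ := hmin.2; exact ⟨t, h1, by omega, h3⟩)
    have e : (a = pos u ∧ c = pos v) ∨ (a = pos v ∧ c = pos u) := by omega
    rcases e with ⟨e1, e2⟩ | ⟨e1, e2⟩ <;> rw [e1, e2, S.E_pos, S.E_pos] at h
    · exact h.symm
    · rw [meetDepth_comm S.tree, h]
  have hb1 := S.div_lt (show a < N by omega)
  have hb2 := S.div_lt hcN
  have hd1 := Nat.div_add_mod' a B
  have hd2 := Nat.div_add_mod' c B
  have hm1 := Nat.mod_lt a hB
  have hm2 := Nat.mod_lt c hB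
  have hbb : a / B ≤ c / B := Nat.div_le_div_right hac
  refine Run.assign_seq_time a hσ (by simp) (by simp [hu, hv, hb.pos_eq, ← ha]) fun hσ1 => ?_
  refine Run.assign_seq_time c hσ1 (by simp [hu, hv, hb.pos_eq]; omega)
    (by simp [hu, hv, hb.pos_eq, ← hc]) fun hσ2 => ?_
  refine Run.assign_seq_time (a / B) hσ2 (by simp) (by simp [hb.B_eq]) fun hσ3 => ?_
  refine Run.assign_seq_time (c / B) hσ3 (by simp) (by simp [hb.B_eq]) fun hσ4 => ?_
  have hbτ := (((hb.setVar 35 a rfl).setVar 36 c rfl).setVar 38 (a / B) rfl).setVar 39 (c / B) rfl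
  generalize hτ : (((σ.setVar 35 a).setVar 36 c).setVar 38 (a / B)).setVar 39 (c / B)
    = τ at hσ4 hbτ ⊢
  have hmτ : MaskTable G r B N E (τ.arr 9) := by subst hτ; exact hm
  have hsτ : SparseTable G r B nb E (τ.arr 10) := by subst hτ; exact hs
  have v35 : τ.var 35 = a := by subst hτ; simp
  have v36 : τ.var 36 = c := by subst hτ; simp
  have v38 : τ.var 38 = a / B := by subst hτ; simp
  have v39 : τ.var 39 = c / B := by subst hτ; simp
  clear hτ hσ1 hσ2 hσ3
  refine Run.ite_time hσ4 (by simp) (fun heq => ?_) (fun hne => ?_)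
  · have heq : a / B = c / B := by simpa [v38, v39] using heq
    refine Run.seq_time hσ4 (inMinAt_run S hσ4 hbτ hmτ a c (by simp) (by simp [v35]) (by simp)
      (by simp [v36]) hac hcN heq) fun σ' hσ' hf h => ?_
    exact Run.assign_time _ hσ' (by simp) rfl (by simpa using hgoal _ h)
  · have hne : a / B ≠ c / B := by simpa [v38, v39] using hne
    have hlt : a / B < c / B := by omega
    have hmul : (a / B + 1) * B ≤ c / B * B := Nat.mul_le_mul_right _ hlt
    rw [Nat.add_mul, Nat.one_mul] at hmul
    have e1 : (a / B * B + (B - 1)) / B = a / B := by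
      rw [Nat.mul_comm, Nat.mul_add_div hB, Nat.div_eq_of_lt (show B - 1 < B by omega)]; rfl
    refine Run.seq_time hσ4 (inMinAt_run S hσ4 hbτ hmτ a (a / B * B + (B - 1)) (by simp)
      (by simp [v35]) (by simp [v38, hbτ.B_eq]; omega) (by simp [v38, hbτ.B_eq]) (by omega)
      (by omega) e1.symm) fun σ' hσ' hf h => ?_
    have hb' := hbτ.frame hf rfl
    refine Run.assign_seq_time _ hσ' (by simp) rfl fun hσ1 => ?_
    have hb1 := hb'.setVar 34 (σ'.var 22) rfl
    rw [show a / B * B + (B - 1) + 1 = a / B * B + B by omega] at h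
    have x38 := (hf.var 38 rfl).trans v38
    have x39 := (hf.var 39 rfl).trans v39
    have x36 := (hf.var 36 rfl).trans v36
    have x9 : MaskTable G r B N E (σ'.arr 9) := by rw [hf.arr 9 rfl]; exact hmτ
    have x10 : SparseTable G r B nb E (σ'.arr 10) := by rw [hf.arr 10 rfl]; exact hsτ
    refine Run.seq_time (P := fun σ' => IsMinDepth G r E a (c / B * B) (σ'.var 34)) hσ1 ?_ ?_
    · refine Run.ite_time hσ1 (by simp [x38]; omega) (fun h1 => ?_) (fun h1 => ?_)
      · simp [x38, x39] at h1
        set len := c / B - a / B - 1 with hlen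
        have hj : Nat.log 2 len ≤ Nat.log 2 nb := Nat.log_mono_right (by omega)
        have hj1 := Nat.pow_log_le_self 2 (show len ≠ 0 by omega)
        have hj2 := Nat.lt_pow_succ_log_self (b := 2) (by norm_num) len
        rw [Nat.succ_eq_add_one, pow_succ] at hj2
        have hjw : Nat.log 2 len < w := (Nat.log_lt_of_lt_pow (by omega)
          (show len < 2 ^ w by omega))
        -- Two overlapping runs of `2 ^ log len` blocks, one from the left end and one from the
        -- right, cover the `len` inner blocks.
        have s1 := x10 _ hj (a / B + 1) (by omega)
        have s2 := x10 _ hj (c / B - 2 ^ Nat.log 2 len) (by omega)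
        have i0 := index_lt (show Nat.log 2 len < Nat.log 2 nb + 1 by omega)
          (show a / B + 1 < nb by omega)
        have i1 := index_lt (show Nat.log 2 len < Nat.log 2 nb + 1 by omega)
          (show c / B - 2 ^ Nat.log 2 len < nb by omega)
        rw [Nat.sub_add_cancel (by omega)] at s2
        have c1 : (c / B - 2 ^ Nat.log 2 len) * B ≤ (a / B + 1 + 2 ^ Nat.log 2 len) * B :=
          Nat.mul_le_mul_right _ (by omega)
        have c2 : a / B * B + B ≤ (c / B - 2 ^ Nat.log 2 len) * B := by
          rw [← Nat.succ_mul]; exact Nat.mul_le_mul_right _ (by rw [Nat.succ_eq_add_one]; omega)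
        have c3 : (a / B + 1 + 2 ^ Nat.log 2 len) * B ≤ c / B * B :=
          Nat.mul_le_mul_right _ (by omega)
        have c4 : (a / B + 1) * B ≤ (a / B + 1 + 2 ^ Nat.log 2 len) * B :=
          Nat.mul_le_mul_right _ (by omega)
        have u1 := h.union s1 (by rw [Nat.add_mul]; omega) (by rw [Nat.add_mul]; omega)
          (by rw [← Nat.succ_mul]; exact c4)
        have u2 := u1.union s2 (by omega) c1 c3
        apply Run.of_wp hσ1
        refine Stmt.wp_assign_seq (Nat.log 2 len) (by simp; omega) ?_ ?_
        · simp [x38, x39, ← hlen]; exact hb'.lg_eq len (by omega)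
        refine Stmt.wp_assign_seq _ (by simp [x38, hb'.nb_eq]; omega) rfl ?_
        refine Stmt.wp_assign_seq _ (by simp) rfl ?_
        refine Stmt.wp_assign_seq _ (by simp [x39, hb'.nb_eq]; omega) rfl ?_
        refine Stmt.wp_assign_of _ (by simp) rfl ?_
        simpa [x38, x39, hb'.nb_eq] using u2
      · simp [x38, x39] at h1
        refine ⟨_, _, .skip _, le_rfl, ?_⟩
        rw [show c / B * B = a / B * B + B by
          rw [show c / B = a / B + 1 by omega, Nat.add_mul, Nat.one_mul]]
        simpa using h
    · intro σ2 hσ2 hf2 h2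
      have hb2 := hb1.frame hf2 rfl
      refine Run.seq_time hσ2 (inMinAt_run S hσ2 hb2
        (by rw [hf2.arr 9 rfl]; exact x9) (c / B * B) c ?_ ?_ (by simp) ?_ (by omega) hcN
        (Nat.mul_div_cancel _ hB)) fun σ3 hσ3 hf3 h3 => ?_
      · simp [hf2.var 39 rfl, x39, hb2.B_eq]; omega
      · simp [hf2.var 39 rfl, x39, hb2.B_eq]
      · simp [hf2.var 36 rfl, x36]
      · refine Run.assign_time _ hσ3 (by simp) rfl ?_
        simp only [State.setVar_var, if_true]
        refine hgoal _ ?_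
        simp only [Expr.val_sub, Expr.val_var]
        rw [hf3.var 34 rfl]
        exact h2.union h3 (by omega) le_rfl (by omega)

/-- Register `6` receives the ancestor of the node in register `4` at the depth in register `5`. -/
def levelAncestorCode : Stmt :=
  .ite ((Expr.get 4 (.var 4)).lt (.var 5 + .var 7)) (23 ≔ .var 4)
    (30 ≔ .get 7 (.var 4) / .var 7 ;;
      31 ≔ .get 6 ((.get 4 (.get 5 (.var 30 * .var 7)) - .var 5) / .var 7) ;;
      32 ≔ ((Expr.var 30).shr (.var 31)).shl (.var 31) ;;
      33 ≔ (.get 4 (.get 5 (.var 32 * .var 7)) - .var 5) / .var 7 ;;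
      23 ≔ .get 12 (.var 31 * (♯4 * .var 9) + (♯4 * .var 32 + .var 33))) ;;
  24 ≔ .var 5 ;;
  shortLA ;;
  6 ≔ .var 25

/-- A node more than `B` steps below the target may be replaced by the start `b` of its block, and
this by the start of an earlier block `b'`, as long as the walk in between stays at depth at least
`d`. The farther the target, the coarser the rounding that is allowed, so long ladders are stored
only at well aligned blocks. A jump by `y * B` from there leaves a distance below `B`. -/
theorem levelAncestorCode_run (S : Setup G r w B nb N E pos) (hσ : σ.WF w)
    (hb : Base G r B nb N E pos σ) (ho : OccTable G r B nb E (σ.arr 8))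
    (hn : NearTable G r B nb E (σ.arr 11)) (hfar : FarTable G r B nb E (σ.arr 12))
    {v : Fin n} {d : ℕ} (hv : σ.var 4 = v) (hd : σ.var 5 = d) (hdv : d ≤ G.dist r v) :
    Run w levelAncestorCode σ levelAncestorCode.time
      (fun σ' => σ'.var 6 = ancAt G r v d) := by
  have hw := S.word
  have hBw := S.B_lt
  have hBn := S.B_le
  have hN := S.N_le
  have hB := S.B_pos
  have hlv := S.levels_le
  have hnb := S.nb_le
  have hdn := S.dist_lt (r := r) v
  refine Run.seq_time (P := fun σ' => ∃ u : Fin n, σ'.var 23 = u ∧ d ≤ G.dist r u ∧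
    G.dist r u ≤ d + B ∧ ancAt G r u d = ancAt G r v d) hσ ?_ ?_
  · refine Run.ite_time hσ (by simp [hd, hb.B_eq]; omega) (fun h => ?_) (fun h => ?_)
    · simp [hv, hd, hb.dep_eq, hb.B_eq] at h
      exact Run.assign_time v hσ (by simp) (by simp [hv]) ⟨v, by simp, hdv, by omega, rfl⟩
    · simp [hv, hd, hb.dep_eq, hb.B_eq] at h
      have hpv := S.pos_lt v
      have hdm := Nat.div_add_mod' (pos v) B
      have hm := Nat.mod_lt (pos v) hB
      have hbl := S.div_lt hpv
      set b := pos v / B with hbdef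
      -- Fewer than `B` steps separate the start of the block from the visit of `v`, which is at
      -- least `B` below depth `d`.
      have hin : ∀ t, b * B ≤ t → t ≤ pos v → d < G.dist r (E t) := by
        intro t h1 h2
        have := (S.tour.dist_le_add S.tree t (pos v - t)).2
        rw [Nat.add_sub_cancel' h2, S.E_pos] at this
        omega
      set D := G.dist r (E (b * B)) with hD
      have hdD : d < D := hin _ le_rfl (by omega)
      have hanc : ancAt G r (E (b * B)) d = ancAt G r v d := by
        have := S.tour.ancAt_eq S.tree (s := b * B) (e := pos v) (d := d) (by omega)
          (fun t h1 h2 => (hin t h1 h2).le)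
        rwa [S.E_pos] at this
      -- The tour starts in the root, which bounds the depth by the time. Hence `x ≤ b`, and `j` is
      -- a level of the table.
      have hDle : D ≤ b * B := by
        have := (S.tour.dist_le_add S.tree 0 (b * B)).2
        rw [S.tour.zero, SimpleGraph.dist_self] at this
        simpa using this
      have hDn : D < n := S.dist_lt _
      set x := (D - d) / B with hx
      have hxB := Nat.div_mul_le_self (D - d) B
      have hxB' := Nat.lt_div_mul_add (a := D - d) hB
      rw [← hx] at hxB hxB'
      have hxle : x ≤ b := by
        rw [hx]; exact (Nat.div_le_div_right (show D - d ≤ b * B by omega)).trans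
          (Nat.mul_div_cancel _ hB).le
      set j := Nat.log 2 x with hj
      have hjn : j ≤ Nat.log 2 nb := Nat.log_mono_right (by omega)
      have hxj := Nat.lt_pow_succ_log_self (b := 2) (by norm_num) x
      rw [Nat.succ_eq_add_one, pow_succ, ← hj] at hxj
      have hjw : j < w := by
        have := S.log_nb_le
        omega
      have h2j : 0 < 2 ^ j := by positivity
      have hdm' := Nat.div_add_mod' b (2 ^ j)
      have hm' := Nat.mod_lt b h2j
      have hjx : 2 ^ j ≤ x ∨ j = 0 := by
        by_cases h0 : x = 0
        · right; rw [hj, h0]; simp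
        · exact Or.inl (Nat.pow_log_le_self 2 h0)
      set b' := b / 2 ^ j * 2 ^ j with hb'
      have hbb : b' * B + (b - b') * B = b * B := by
        rw [← Nat.add_mul, Nat.add_sub_cancel' (by omega)]
      -- Rounding down loses fewer than `2 ^ j ≤ x` blocks, so the walk from block `b'` to block `b`
      -- is too short to get above depth `d`. For `x = 0` the level is `0` and nothing is lost.
      have hgap : (b - b') * B ≤ D - d := by
        rcases hjx with h1 | h1
        · exact (Nat.mul_le_mul_right B (show b - b' ≤ x by omega)).trans hxB
        · have : b - b' = 0 := by rw [h1, pow_zero] at hm' hdm'; omega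
          rw [this]; omega
      have hgap2 : (b - b' + 1) * B ≤ 2 ^ j * B := Nat.mul_le_mul_right B (by omega)
      have hxB2 : (x + 1) * B ≤ 2 ^ j * 2 * B := Nat.mul_le_mul_right B (by omega)
      rw [Nat.add_mul, Nat.one_mul] at hgap2 hxB2
      rw [Nat.mul_right_comm] at hxB2
      set D' := G.dist r (E (b' * B)) with hD'
      have hDD := S.tour.dist_le_add S.tree (b' * B) ((b - b') * B)
      rw [hbb, ← hD, ← hD'] at hDD
      have hin2 : ∀ t, b' * B ≤ t → t ≤ b * B → d ≤ G.dist r (E t) := by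
        intro t h1 h2
        have := (S.tour.dist_le_add S.tree t (b * B - t)).2
        rw [Nat.add_sub_cancel' h2, ← hD] at this
        omega
      have hanc2 := S.tour.ancAt_eq S.tree (s := b' * B) (e := b * B) (d := d) (by omega) hin2
      have hdD' : d ≤ D' := hin2 _ le_rfl (by omega)
      -- The tour is back in the root at time `N - 1`, so the depth is at most the remaining time.
      -- This keeps `4 * b' + y` inside the level.
      have hDend : D' ≤ N - 1 - b' * B := by
        have := (S.tour.dist_le_add S.tree (b' * B) (N - 1 - b' * B)).1
        rw [Nat.add_sub_cancel' (by omega), S.tour.last, SimpleGraph.dist_self] at this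
        simpa using this
      set y := (D' - d) / B with hy
      have hyB := Nat.div_mul_le_self (D' - d) B
      have hyB' := Nat.lt_div_mul_add (a := D' - d) hB
      rw [← hy] at hyB hyB'
      -- The distance `D - d` is below `2 * 2 ^ j * B`, and the rounding adds less than `2 ^ j * B`,
      -- so a ladder of `4 * 2 ^ j` cells is long enough.
      have hy4 : y < 4 * 2 ^ j := by
        by_contra hge
        have : 4 * 2 ^ j * B ≤ y * B := Nat.mul_le_mul_right _ (by omega)
        rw [Nat.mul_assoc] at this
        omega
      have hz : 4 * b' + y < 4 * nb := by
        have h1 : y + b' < nb := by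
          by_contra hge
          have : nb * B ≤ (y + b') * B := Nat.mul_le_mul_right _ (by omega)
          rw [← S.N_eq, Nat.add_mul] at this
          omega
        omega
      have hround : (4 * b' + y) / 4 / 2 ^ j * 2 ^ j = b' := by
        have h1 : (4 * b' + y) / 4 / 2 ^ j = b / 2 ^ j := by
          rw [Nat.mul_add_div (by norm_num), hb', Nat.mul_comm (b / 2 ^ j),
            Nat.mul_add_div h2j, Nat.div_eq_of_lt (show y / 4 < 2 ^ j by omega), Nat.add_zero]
        rw [h1]
      have hcell := hfar j hjn (4 * b' + y) hz
      rw [hround, ← hD', Nat.add_sub_cancel_left, Nat.mul_comm B] at hcell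
      have hidx := index_lt (show j < Nat.log 2 nb + 1 by omega) hz
      have hlv4 : (Nat.log 2 nb + 1) * (4 * nb) ≤ 24 * n := by rw [Nat.mul_left_comm]; omega
      have hbN : b * B < N := by omega
      have hbN' : b' * B < N := by omega
      have hancle : d ≤ D' - y * B := by omega
      have hy0 : 0 ≤ (D' - d) / B := Nat.zero_le _
      apply Run.of_wp hσ
      refine Stmt.wp_assign_seq b (by simp) (by simp [hv, hb.pos_eq, hb.B_eq, hbdef]) ?_
      refine Stmt.wp_assign_seq j (by simp [hb.B_eq]; omega) ?_ ?_
      · simp [hb.B_eq, hb.E_eq _ hbN, hb.dep_eq, hd, ← hD, ← hx]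
        exact hb.lg_eq x (by omega)
      refine Stmt.wp_assign_seq b' (by simp [← hb']; omega) (by simp [← hb']) ?_
      refine Stmt.wp_assign_seq y (by simp [hb.B_eq]; omega)
        (by simp [hb.B_eq, hb.E_eq _ hbN', hb.dep_eq, hd, ← hD', ← hy]) ?_
      refine Stmt.wp_assign_of (ancAt G r (E (b' * B)) (D' - y * B) : Fin n)
        (by simp [hb.nb_eq]; omega) (by simp [hb.nb_eq]; exact hcell) ?_
      have hda := dist_ancAt S.tree (r := r) (v := E (b' * B)) (d := D' - y * B) (by omega)
      refine ⟨ancAt G r (E (b' * B)) (D' - y * B), by simp, ?_, ?_, ?_⟩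
      · rw [hda]; exact hancle
      · rw [hda]; omega
      · rw [ancAt_ancAt S.tree hancle (by omega), hanc2, hanc]
  · rintro σ1 hσ1 hf1 ⟨u, h1, h2, h3, h4⟩
    have hb1 := hb.frame hf1 rfl
    refine Run.assign_seq_time d hσ1 (by simp) (by simp [hf1.var 5 rfl, hd]) fun hσ2 => ?_
    refine Run.seq_time hσ2 (shortLA_run S hσ2 (hb1.setVar 24 d rfl) (u := u) (d := d) ?_ ?_
      (by simp [h1]) (by simp) h2 h3) fun σ3 hσ3 hf3 h5 => ?_
    · rw [State.setVar_arr, hf1.arr 8 rfl]; exact ho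
    · rw [State.setVar_arr, hf1.arr 11 rfl]; exact hn
    · exact Run.assign_time _ hσ3 (by simp) rfl (by simp [h5, h4])

/-- Register `6` receives the lowest common ancestor of the nodes in registers `4` and `5`. -/
def lcaCode : Stmt := lcaDepth ;; 5 ≔ .var 34 ;; levelAncestorCode

theorem lcaCode_run (S : Setup G r w B nb N E pos) (hσ : σ.WF w)
    (hb : Base G r B nb N E pos σ) (ho : OccTable G r B nb E (σ.arr 8))
    (hm : MaskTable G r B N E (σ.arr 9)) (hs : SparseTable G r B nb E (σ.arr 10))
    (hn : NearTable G r B nb E (σ.arr 11)) (hfar : FarTable G r B nb E (σ.arr 12))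
    {u v : Fin n} (hu : σ.var 4 = u) (hv : σ.var 5 = v) :
    Run w lcaCode σ lcaCode.time
      (fun σ' => σ'.var 6 = ancAt G r u (meetDepth G r u v)) := by
  refine Run.seq_time hσ (lcaDepth_run S hσ hb hm hs hu hv) fun σ1 hσ1 hf1 h1 => ?_
  refine Run.assign_seq_time _ hσ1 (by simp) (by simpa using h1) fun hσ2 => ?_
  refine levelAncestorCode_run S hσ2 ((hb.frame hf1 rfl).setVar 5 _ rfl) ?_ ?_ ?_ ?_ ?_
    (meetDepth_spec S.tree r u v).1
  · rw [State.setVar_arr, hf1.arr 8 rfl]; exact ho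
  · rw [State.setVar_arr, hf1.arr 11 rfl]; exact hn
  · rw [State.setVar_arr, hf1.arr 12 rfl]; exact hfar
  · simp [hf1.var 4 rfl, hu]
  · simp

end KServer

/-! ### Filling the tables of masks, occurrences and near ancestors -/

namespace KServer

open WordRAM

variable {n : ℕ} {G : SimpleGraph (Fin n)} {r : Fin n} {w B nb N : ℕ} {E : ℕ → Fin n}
  {pos : Fin n → ℕ} {σ : State}

theorem exists_last {P : ℕ → Prop} {s t : ℕ} (hst : s ≤ t) (hs : P s) :
    ∃ e, s ≤ e ∧ e ≤ t ∧ P e ∧ ∀ t', e < t' → t' ≤ t → ¬ P t' := by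
  induction t, hst using Nat.le_induction with
  | base => exact ⟨s, le_rfl, le_rfl, hs, fun t' h1 h2 => by omega⟩
  | succ t hst ih =>
    by_cases h : P (t + 1)
    · exact ⟨t + 1, by omega, le_rfl, h, fun t' h1 h2 => by omega⟩
    · obtain ⟨e, h1, h2, h3, h4⟩ := ih
      refine ⟨e, h1, by omega, h3, fun t' h5 h6 => ?_⟩
      rcases Nat.lt_or_ge t t' with h7 | h7
      · rwa [show t' = t + 1 by omega]
      · exact h4 t' h5 h7

/-- Take the last earlier time at smaller depth. Steps change the depth by at most one, so that
visit is one level above `E t`, and it is the parent because the walk stays deeper afterwards. -/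
theorem Setup.parent_visit (S : Setup G r w B nb N E pos) {t : ℕ} (ht : E t ≠ r) :
    ∃ e < t, E e = stepToward G (E t) r ∧
      ∀ t', e < t' → t' ≤ t → G.dist r (E t) ≤ G.dist r (E t') := by
  have hd := dist_stepToward S.tree ht
  obtain ⟨e, -, h2, h3, h4⟩ := exists_last (P := fun e => G.dist r (E e) < G.dist r (E t))
    (Nat.zero_le t) (by rw [S.tour.zero, SimpleGraph.dist_self]; omega)
  have het : e ≠ t := by rintro rfl; exact lt_irrefl _ h3
  have h5 := (S.tour.dist_step S.tree e).2
  have h6 := h4 (e + 1) (by omega) (by omega)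
  have hlast := S.ancAt_eq_of_last (s := e) (t := t) (d := G.dist r (E t) - 1) h2 (by omega)
    (by omega) (fun t' h7 h8 h9 => h4 t' h7 h8 (by omega))
  refine ⟨e, by omega, ?_, fun t' h7 h8 => not_lt.1 (h4 t' h7 h8)⟩
  rw [← hlast, ← ancAt_stepToward S.tree (by omega),
    show G.dist r (E t) - 1 = G.dist r (stepToward G (E t) r) by omega, ancAt_self]

/-- If `t` has the least depth of its block so far, it alone answers every query that ends at `t`.
-/
theorem maskVal_new {D : ℕ → ℕ} {t : ℕ} (hB : 0 < B)
    (h : ∀ t', t / B = t' / B → t' ≤ t → D t ≤ D t') : MaskVal D B t (2 ^ (B - 1 - t % B)) := by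
  have hm := Nat.mod_lt t hB
  refine ⟨Nat.pow_lt_pow_right (by norm_num) (by omega), dvd_rfl, fun l hl hlt => ?_⟩
  have hml := Nat.mod_lt l hB
  have h1 := Nat.div_add_mod' l B
  have h2 := Nat.div_add_mod' t B
  rw [← hl] at h2
  have h3 : 2 ^ (B - 1 - t % B) % 2 ^ (B - l % B) = 2 ^ (B - 1 - t % B) :=
    Nat.mod_eq_of_lt (Nat.pow_lt_pow_right (by norm_num) (by omega))
  rw [h3, Nat.log_pow (by norm_num)]
  have h4 : l / B * B + (B - 1 - (B - 1 - t % B)) = t := by omega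
  rw [h4]
  refine ⟨by positivity, hlt, le_rfl, fun t' h5 h6 => h t' ?_ h6⟩
  rw [← hl]
  exact le_antisymm (Nat.div_le_div_right h5) (hl ▸ Nat.div_le_div_right h6)

/-- The added bit lies below all bits of the multiple `x` of `2 ^ p`, so there is no carry and the
leading bit stays. -/
theorem log_two_pow_add {x e p : ℕ} (hep : e < p) (hx : x ≠ 0) (hd : 2 ^ p ∣ x) :
    Nat.log 2 (2 ^ e + x) = Nat.log 2 x := by
  have h1 := Nat.pow_log_le_self 2 hx
  have h2 := Nat.lt_pow_succ_log_self (b := 2) (by norm_num) x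
  have h3 : 2 ^ e < 2 ^ p := Nat.pow_lt_pow_right (by norm_num) hep
  have h4 : 2 ^ p ≤ x := Nat.le_of_dvd (by omega) hd
  have h5 : p ≤ Nat.log 2 x := by
    rw [← Nat.log_pow (b := 2) (by norm_num) p]; exact Nat.log_mono_right h4
  have h0 : 0 < 2 ^ e := by positivity
  refine Nat.log_eq_of_pow_le_of_lt_pow (by omega) ?_
  have h6 : 2 ^ p ∣ 2 ^ (Nat.log 2 x + 1) := pow_dvd_pow 2 (by omega)
  have h7 := Nat.le_of_dvd (Nat.sub_pos_of_lt h2) (Nat.dvd_sub h6 hd)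
  rw [Nat.succ_eq_add_one] at h7
  omega

/-- Here `p` plays the last earlier visit of smaller depth. A query starting at or before `p` keeps
the answer it had when ending at `p`, since everything later is deeper. A query starting after `p`
sees no bit of `m`, and its answer is `t`. -/
theorem maskVal_push {D : ℕ → ℕ} {p t m : ℕ} (hB : 0 < B) (hpt : p < t) (hblk : p / B = t / B)
    (hp : MaskVal D B p m) (h1 : ∀ t', p < t' → t' ≤ t → D t ≤ D t')
    (h2 : ∀ t', p < t' → t' ≤ t → D p < D t') : MaskVal D B t (2 ^ (B - 1 - t % B) + m) := by
  have hm := Nat.mod_lt t hB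
  have hmp := Nat.mod_lt p hB
  have e1 := Nat.div_add_mod' p B
  have e2 := Nat.div_add_mod' t B
  rw [← hblk] at e2
  obtain ⟨p1, p2, p3⟩ := hp
  have hlt : B - 1 - t % B < B - 1 - p % B := by omega
  have hpow : 2 ^ (B - 1 - t % B) < 2 ^ (B - 1 - p % B) := Nat.pow_lt_pow_right (by norm_num) hlt
  have hdv : ∀ K x, B - 1 - p % B ≤ K → 2 ^ (B - 1 - p % B) ∣ x → x < 2 ^ K →
      2 ^ (B - 1 - t % B) + x < 2 ^ K := by
    intro K x hK hx hxK
    have := Nat.le_of_dvd (Nat.sub_pos_of_lt hxK) (Nat.dvd_sub (pow_dvd_pow 2 hK) hx)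
    omega
  refine ⟨hdv B m (by omega) p2 p1, dvd_add dvd_rfl ((pow_dvd_pow 2 hlt.le).trans p2),
    fun l hl hlt' => ?_⟩
  have hml := Nat.mod_lt l hB
  have e3 := Nat.div_add_mod' l B
  rw [hl, ← hblk] at e3
  by_cases hlp : l ≤ p
  · obtain ⟨a0, a1, a2, a3⟩ := p3 l (hl.trans hblk.symm) hlp
    set K := B - l % B with hK
    have hdm : 2 ^ (B - 1 - p % B) ∣ m % 2 ^ K :=
      (Nat.dvd_mod_iff (pow_dvd_pow 2 (by omega))).2 p2
    have hmod : (2 ^ (B - 1 - t % B) + m) % 2 ^ K = 2 ^ (B - 1 - t % B) + m % 2 ^ K := by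
      rw [← Nat.add_mod_mod]
      exact Nat.mod_eq_of_lt (hdv K _ (by omega) hdm (Nat.mod_lt _ (by positivity)))
    rw [hmod, log_two_pow_add hlt a0 hdm]
    refine ⟨(Nat.add_pos_left (by positivity) _).ne', a1, by omega, fun t' h3 h4 => ?_⟩
    rcases Nat.lt_or_ge p t' with h5 | h5
    · exact (a3 p hlp le_rfl).trans (h2 t' h5 h4).le
    · exact a3 t' h3 h5
  · have hmod : (2 ^ (B - 1 - t % B) + m) % 2 ^ (B - l % B) = 2 ^ (B - 1 - t % B) := by
      have : 2 ^ (B - l % B) ∣ m := (pow_dvd_pow 2 (by omega)).trans p2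
      obtain ⟨c, rfl⟩ := this
      rw [Nat.add_mul_mod_self_left]
      exact Nat.mod_eq_of_lt (Nat.pow_lt_pow_right (by norm_num) (by omega))
    rw [hmod, Nat.log_pow (by norm_num), hl, ← hblk]
    have h4 : p / B * B + (B - 1 - (B - 1 - t % B)) = t := by omega
    rw [h4]
    exact ⟨by positivity, hlt', le_rfl, fun t' h5 h6 => h1 t' (by omega) h6⟩

/-- The masks of all visits, with the help of the last visits in array `13`. -/
def maskBody : Stmt :=
  12 ≔ .get 5 (.var 11) ;;
  13 ≔ .get 13 (.get 0 (.var 12)) ;;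
  14 ≔ (♯1).shl (.var 7 - ♯1 - .var 11 % .var 7) ;;
  .ite ((Expr.var 12).eq (.var 1)) .skip
    (.ite ((Expr.var 13).lt (.var 11 / .var 7 * .var 7)) .skip
      (14 ≔ .var 14 + .get 9 (.var 13))) ;;
  .store 9 (.var 11) (.var 14) ;;
  .store 13 (.var 12) (.var 11)

/-- The mask of a visit extends the mask of the last visit of the parent, if that is in the same
block; this replaces the usual stack of a range minimum structure. -/
theorem maskLoop_run (S : Setup G r w B nb N E pos) (hσ : σ.WF w) (hb : Base G r B nb N E pos σ) :
    Run w (.for 11 8 maskBody) σ (2 + (N + 1) * (maskBody.time + 8))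
      (fun σ' => MaskTable G r B N E (σ'.arr 9)) := by
  have hB := S.B_pos
  have hN := S.N_le
  have hw := S.word
  have h2B := S.two_pow_le
  have hBw := S.B_lt
  refine (Run.for (N := N) (fun t σ' => ∀ s < t, MaskVal (fun t => G.dist r (E t)) B s (σ'.arr 9 s) ∧
    s ≤ σ'.arr 13 (E s) ∧ σ'.arr 13 (E s) < t ∧ E (σ'.arr 13 (E s)) = E s) _ hσ rfl rfl rfl hb.N_eq
    (by simp) ?_).mono hσ le_rfl (fun σ' _ _ h i hi => (h.1 i hi).1)
  intro t ht σ1 hσ1 hf hvar hJ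
  have hb1 := hb.frame hf rfl
  have hmod := Nat.mod_lt t hB
  have hdm := Nat.div_add_mod' t B
  have hpw : 2 ^ (B - 1 - t % B) < 2 ^ B := Nat.pow_lt_pow_right (by norm_num) (by omega)
  have fin : ∀ m, MaskVal (fun t => G.dist r (E t)) B t m → ∀ τ : State,
      τ.arr = σ1.arr → τ.var 14 = m → τ.var 11 = t → τ.var 12 = E t →
      (Stmt.store 9 (.var 11) (.var 14) ;; Stmt.store 13 (.var 12) (.var 11)).wp w (fun σ'' =>
        ∀ s < t + 1, MaskVal (fun t => G.dist r (E t)) B s ((σ''.setVar 11 (t + 1)).arr 9 s) ∧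
          s ≤ (σ''.setVar 11 (t + 1)).arr 13 (E s) ∧
          (σ''.setVar 11 (t + 1)).arr 13 (E s) < t + 1 ∧
          E ((σ''.setVar 11 (t + 1)).arr 13 (E s)) = E s) τ := by
    intro m hm τ ha h14 h11 h12
    refine Stmt.wp_store_seq t m (by simp) (by simp [h11]) (by simp) (by simp [h14]) ?_
    refine Stmt.wp_store_of (E t : Fin n) t (by simp) (by simp [h12]) (by simp) (by simp [h11]) ?_
    intro s hs
    simp [ha]
    by_cases hst : s = t
    · subst hst
      simp [hm]
    · obtain ⟨j1, j2, j3, j4⟩ := hJ s (by omega)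
      simp only [hst, if_false]
      refine ⟨j1, ?_⟩
      by_cases he : E s = E t
      · simp [he]; omega
      · have he' : (E s : ℕ) ≠ E t := fun h => he (Fin.ext h)
        simp only [he', if_false]
        exact ⟨j2, by omega, j4⟩
  apply Run.of_wp hσ1
  refine Stmt.wp_assign_seq (E t : Fin n) (by simp) (by simp [hvar, hb1.E_eq t ht]) ?_
  refine Stmt.wp_assign_seq _ (by simp) rfl ?_
  refine Stmt.wp_assign_seq (2 ^ (B - 1 - t % B)) (by simp [hb1.B_eq, hvar]; omega)
    (by simp [hb1.B_eq, hvar]) ?_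
  rw [Stmt.wp_seq]
  refine (Stmt.wp_ite _ _ _ _ _ _).2 ⟨by simp, fun h => ?_, fun h => ?_⟩
  · simp [hb1.r_eq] at h
    have h : E t = r := Fin.ext h
    refine fin _ (maskVal_new hB fun t' _ _ => ?_) _ rfl (by simp) (by simp [hvar]) (by simp)
    simp [h]
  · simp [hb1.r_eq] at h
    have h : E t ≠ r := fun h' => h (by rw [h'])
    obtain ⟨e, e1, e2, e3⟩ := S.parent_visit h
    obtain ⟨j1, j2, j3, j4⟩ := hJ e e1
    have hdp := dist_stepToward S.tree h
    -- After `e` the walk stays deeper than the parent of `E t`, so the stored last visit of the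
    -- parent is `e` itself.
    have hpe : σ1.arr 13 (E e) = e := by
      by_contra hne
      have := e3 _ (by omega) j3.le
      rw [j4, e2] at this
      omega
    rw [hpe] at j2 j3 j4
    have hval : (Expr.get 13 (.get 0 (.var 12))).val (σ1.setVar 12 (E t : Fin n)) = e := by
      simp [hb1.par_eq, ← e2, hpe]
    rw [hval]
    refine (Stmt.wp_ite _ _ _ _ _ _).2 ⟨by simp [hb1.B_eq, hvar]; omega, fun h' => ?_, fun h' => ?_⟩
    · simp [hb1.B_eq, hvar] at h'
      refine fin _ (maskVal_new hB fun t' h1 h2 => e3 t' ?_ h2) _ rfl (by simp) (by simp [hvar])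
        (by simp)
      have := Nat.div_mul_le_self t' B
      rw [← h1] at this
      omega
    · simp [hb1.B_eq, hvar] at h'
      have hblk : e / B = t / B := by
        refine le_antisymm (Nat.div_le_div_right e1.le) ((Nat.le_div_iff_mul_le hB).2 h')
      have hj := j1.1
      have := maskVal_push hB e1 hblk j1 e3 (fun t' h1 h2 => by
        have := e3 t' h1 h2
        rw [e2]; omega)
      refine Stmt.wp_assign_of (2 ^ (B - 1 - t % B) + σ1.arr 9 e) (by simp; omega) (by simp) ?_
      exact fin _ this _ rfl (by simp) (by simp [hvar]) (by simp)

/-- Mark the visit in register `11` in the table of the depths in its block. -/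
def occBody : Stmt :=
  12 ≔ .var 11 / .var 7 ;;
  13 ≔ .var 12 * (♯3 * .var 7) +
    (.get 4 (.get 5 (.var 11)) + ♯2 * .var 7 - .get 4 (.get 5 (.var 12 * .var 7))) ;;
  .store 8 (.var 13) ((Expr.get 8 (.var 13)).lor ((♯1).shl (.var 11 % .var 7)))

theorem index_inj {b b' e e' W : ℕ} (he : e < W) (he' : e' < W) (h : b * W + e = b' * W + e') :
    b = b' ∧ e = e' := by
  have hW : 0 < W := by omega
  have h1 := congrArg (· / W) h
  simp only [Nat.mul_comm _ W, Nat.mul_add_div hW, Nat.div_eq_of_lt he,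
    Nat.div_eq_of_lt he', Nat.add_zero] at h1
  subst h1
  exact ⟨rfl, by omega⟩

theorem occLoop_run (S : Setup G r w B nb N E pos) (hσ : σ.WF w) (hb : Base G r B nb N E pos σ)
    (h0 : ∀ i, σ.arr 8 i = 0) :
    Run w (.for 11 8 occBody) σ (2 + (N + 1) * (occBody.time + 8))
      (fun σ' => OccTable G r B nb E (σ'.arr 8)) := by
  have hB := S.B_pos
  have hN := S.N_le
  have hw := S.word
  have h2B := S.two_pow_le
  have hBw := S.B_lt
  have hBn := S.B_le
  refine (Run.for (N := N) (fun t σ' => ∀ b < nb, ∀ e < 3 * B, σ'.arr 8 (b * (3 * B) + e) < 2 ^ B ∧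
    ∀ o < B, ((σ'.arr 8 (b * (3 * B) + e)).testBit o ↔ b * B + o < t ∧
      G.dist r (E (b * B + o)) + 2 * B = G.dist r (E (b * B)) + e)) _ hσ rfl rfl rfl hb.N_eq
    (fun b hb e he => by simp [h0]) ?_).mono hσ le_rfl ?_
  · intro t ht σ1 hσ1 hf hvar hJ
    have hb1 := hb.frame hf rfl
    have hmod := Nat.mod_lt t hB
    have hdm := Nat.div_add_mod' t B
    have hbl := S.div_lt ht
    set b := t / B with hbdef
    set o := t % B with hodef
    have hd := S.tour.dist_le_add S.tree (b * B) o
    rw [hdm] at hd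
    set e := G.dist r (E t) + 2 * B - G.dist r (E (b * B)) with he
    have heB : e < 3 * B := by omega
    have hidx := index_lt hbl heB
    have e3 : nb * (3 * B) = 3 * N := by rw [Nat.mul_left_comm, S.N_eq]
    have hpw : 2 ^ o < 2 ^ B := Nat.pow_lt_pow_right (by norm_num) hmod
    have hDn := S.dist_lt (r := r) (E t)
    obtain ⟨c1, c2⟩ := hJ b hbl e heB
    apply Run.of_wp hσ1
    refine Stmt.wp_assign_seq b (by simp) (by simp [hb1.B_eq, hvar, hbdef]) ?_
    refine Stmt.wp_assign_seq (b * (3 * B) + e) ?_ ?_ ?_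
    · simp [hb1.B_eq, hvar, hb1.E_eq t ht, hb1.E_eq (b * B) (by omega), hb1.dep_eq, ← he]; omega
    · simp [hb1.B_eq, hvar, hb1.E_eq t ht, hb1.E_eq (b * B) (by omega), hb1.dep_eq, ← he]
    refine Stmt.wp_store_of (b * (3 * B) + e) (σ1.arr 8 (b * (3 * B) + e) ||| 2 ^ o)
      (by simp) (by simp) (by simp [hb1.B_eq, hvar, ← hodef]; omega)
      (by simp [hb1.B_eq, hvar, ← hodef]) ?_
    intro b' hb' e' he'
    simp only [State.setVar_arr, State.setArr_arr, true_and]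
    by_cases h : b' * (3 * B) + e' = b * (3 * B) + e
    · obtain ⟨rfl, rfl⟩ := index_inj he' heB h
      rw [if_pos rfl]
      refine ⟨Nat.or_lt_two_pow c1 hpw, fun o' ho' => ?_⟩
      rw [Nat.testBit_or, Bool.or_eq_true, c2 o' ho', Nat.testBit_two_pow, decide_eq_true_eq]
      constructor
      · rintro (⟨h1, h2⟩ | rfl)
        · exact ⟨by omega, h2⟩
        · rw [hdm]; exact ⟨by omega, by omega⟩
      · rintro ⟨h1, h2⟩
        by_cases h3 : o = o'
        · exact Or.inr h3
        · exact Or.inl ⟨by omega, h2⟩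
    · rw [if_neg h]
      obtain ⟨d1, d2⟩ := hJ b' hb' e' he'
      refine ⟨d1, fun o' ho' => (d2 o' ho').trans ?_⟩
      refine and_congr_left fun h2 => ?_
      have : b' * B + o' ≠ t := by
        intro h3
        obtain ⟨rfl, rfl⟩ := index_inj ho' hmod (h3.trans hdm.symm)
        rw [hdm] at h2
        exact h (by omega)
      omega
  · rintro σ' - - ⟨h, -⟩ b hb e he
    obtain ⟨d1, d2⟩ := h b hb e he
    refine ⟨d1, fun o ho => (d2 o ho).trans ?_⟩
    have := index_lt hb ho
    rw [← S.N_eq] at this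
    simp [this]

/-- The next cell of the table of near ancestors. -/
def nearBody : Stmt :=
  .ite ((Expr.var 11 % (♯2 * .var 7)).eq ♯0)
    (.store 11 (.var 11) (.get 5 (.var 11 / (♯2 * .var 7) * .var 7)))
    (.store 11 (.var 11) (.get 0 (.get 11 (.var 11 - ♯1))))

/-- A row begins with the start of its block, and each further cell is the parent of the one before.
Above the root, the truncated depth agrees with the root being its own parent. -/
theorem nearLoop_run (S : Setup G r w B nb N E pos) (hσ : σ.WF w) (hb : Base G r B nb N E pos σ)
    (h10 : σ.var 10 = nb * (2 * B)) :
    Run w (.for 11 10 nearBody) σ (2 + (nb * (2 * B) + 1) * (nearBody.time + 8))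
      (fun σ' => NearTable G r B nb E (σ'.arr 11)) := by
  have hB := S.B_pos
  have hN := S.N_le
  have hw := S.word
  have hBn := S.B_le
  have hBw := S.B_lt
  have e2 : nb * (2 * B) = 2 * N := by rw [Nat.mul_left_comm, S.N_eq]
  refine (Run.for (N := nb * (2 * B)) (fun z σ' => ∀ i < z, σ'.arr 11 i =
    ancAt G r (E (i / (2 * B) * B)) (G.dist r (E (i / (2 * B) * B)) - i % (2 * B))) _ hσ rfl rfl rfl
    h10 (by simp) ?_).mono hσ le_rfl ?_
  · intro z hz σ1 hσ1 hf hvar hJ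
    have hb1 := hb.frame hf rfl
    have hdm := Nat.div_add_mod' z (2 * B)
    have hm := Nat.mod_lt z (show 0 < 2 * B by omega)
    have hlt : z / (2 * B) * B < N := by
      have : z / (2 * B) * (2 * B) = 2 * (z / (2 * B) * B) := Nat.mul_left_comm _ _ _
      omega
    apply Run.of_wp hσ1
    refine (Stmt.wp_ite _ _ _ _ _ _).2 ⟨by simp [hb1.B_eq]; omega, fun h => ?_, fun h => ?_⟩
    · simp [hb1.B_eq, hvar] at h
      refine Stmt.wp_store_of z (E (z / (2 * B) * B) : Fin n) (by simp) (by simp [hvar])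
        (by simp [hb1.B_eq, hvar]; omega) (by simp [hb1.B_eq, hvar, hb1.E_eq _ hlt]) ?_
      intro i hi
      by_cases hiz : i = z
      · subst hiz
        simp [h, ancAt_self]
      · simp [hiz, hJ i (by omega)]
    · simp [hb1.B_eq, hvar] at h
      have hz1 : (z - 1) / (2 * B) = z / (2 * B) ∧ (z - 1) % (2 * B) = z % (2 * B) - 1 := by
        refine index_inj (W := 2 * B) (Nat.mod_lt _ (by omega)) (by omega) ?_
        rw [Nat.div_add_mod']
        omega
      refine Stmt.wp_store_of z
        (ancAt G r (E (z / (2 * B) * B)) (G.dist r (E (z / (2 * B) * B)) - z % (2 * B)) : Fin n)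
        (by simp) (by simp [hvar]) (by simp; omega) ?_ ?_
      · simp only [Expr.val_get, Expr.val_sub, Expr.val_var, Expr.val_const, hvar]
        rw [hJ (z - 1) (by omega), hb1.par_eq, hz1.1, hz1.2]
        congr 1
        set v := E (z / (2 * B) * B)
        by_cases hv : G.dist r v ≤ z % (2 * B) - 1
        · have h1 : G.dist r v - (z % (2 * B) - 1) = 0 := by omega
          have h2 : G.dist r v - z % (2 * B) = 0 := by omega
          have T := rootedTree_of_isTree S.tree r
          rw [h1, h2, ancAt, T.anc_zero, stepToward_self]
        · have h3 := dist_ancAt S.tree (r := r) (v := v) (d := G.dist r v - (z % (2 * B) - 1))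
            (by omega)
          have h4 : ancAt G r v (G.dist r v - (z % (2 * B) - 1)) ≠ r := by
            intro h5; rw [h5, SimpleGraph.dist_self] at h3; omega
          have h5 := dist_stepToward S.tree h4
          rw [← ancAt_self G r (stepToward G _ r), ancAt_stepToward S.tree (by omega),
            ancAt_ancAt S.tree (by omega) (by omega)]
          congr 1; omega
      · intro i hi
        by_cases hiz : i = z
        · subst hiz; simp
        · simp [hiz, hJ i (by omega)]
  · rintro σ' - - ⟨h, -⟩ b hb s hs
    rw [h _ (index_lt hb hs)]
    have h1 : (b * (2 * B) + s) / (2 * B) = b := by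
      rw [Nat.mul_comm, Nat.mul_add_div (by omega), Nat.div_eq_of_lt hs, Nat.add_zero]
    have h2 : (b * (2 * B) + s) % (2 * B) = s := by
      rw [Nat.mul_comm, Nat.mul_add_mod, Nat.mod_eq_of_lt hs]
    rw [h1, h2]

end KServer

/-! ### Filling the sparse table and the table of far ancestors -/

namespace KServer

open WordRAM

variable {n : ℕ} {G : SimpleGraph (Fin n)} {r : Fin n} {w B nb N : ℕ} {E : ℕ → Fin n}
  {pos : Fin n → ℕ} {σ : State}

/-- The next cell of the table of least depths. -/
def sparseBody : Stmt :=
  .ite ((Expr.var 11).lt (.var 9))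
    (inMinAt (.var 11 * .var 7) (.var 11 * .var 7 + (.var 7 - ♯1)) ;;
      .store 10 (.var 11) (.var 22))
    (12 ≔ .var 11 / .var 9 - ♯1 ;;
      13 ≔ .get 10 (.var 11 - .var 9) ;;
      14 ≔ .get 10 (.var 11 - .var 9 + (♯1).shl (.var 12)) ;;
      .store 10 (.var 11) (.var 13 - (.var 13 - .var 14)))

/-- Cell `j * nb + b` combines two cells of level `j - 1`. Cells whose run of blocks would end
beyond the last block are filled as well, but the invariant claims nothing about them. -/
theorem sparseLoop_run (S : Setup G r w B nb N E pos) (hσ : σ.WF w) (hb : Base G r B nb N E pos σ)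
    (hm : MaskTable G r B N E (σ.arr 9)) (h10 : σ.var 10 = (Nat.log 2 nb + 1) * nb) :
    Run w (.for 11 10 sparseBody) σ
      (2 + ((Nat.log 2 nb + 1) * nb + 1) * (sparseBody.time + 8))
      (fun σ' => SparseTable G r B nb E (σ'.arr 10)) := by
  have hB := S.B_pos
  have hN := S.N_le
  have hw := S.word
  have hlv := S.levels_le
  have hnb := S.nb_pos
  have hnb' := S.nb_le
  have hlog := S.log_nb_le
  have hBw := S.B_lt
  have hpl := Nat.pow_log_le_self 2 hnb.ne'
  refine (Run.for (N := (Nat.log 2 nb + 1) * nb) (fun z σ' => ∀ i < z, i % nb + 2 ^ (i / nb) ≤ nb →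
    IsMinDepth G r E (i % nb * B) ((i % nb + 2 ^ (i / nb)) * B) (σ'.arr 10 i)) _ hσ rfl rfl rfl
    h10 (by simp) ?_).mono hσ le_rfl ?_
  · intro z hz σ1 hσ1 hf hvar hJ
    have hb1 := hb.frame hf rfl
    have hm1 : MaskTable G r B N E (σ1.arr 9) := by rw [hf.arr 9 rfl]; exact hm
    have hdm := Nat.div_add_mod' z nb
    have hmod := Nat.mod_lt z hnb
    have hj : z / nb ≤ Nat.log 2 nb := by
      have := (Nat.div_lt_iff_lt_mul hnb).2 hz
      omega
    refine Run.ite_time hσ1 (by simp) (fun h => ?_) (fun h => ?_)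
    · simp [hb1.nb_eq, hvar] at h
      have hzN := index_lt h (show B - 1 < B by omega)
      rw [← S.N_eq] at hzN
      refine Run.seq_time hσ1 (inMinAt_run S hσ1 hb1 hm1 (z * B) (z * B + (B - 1))
        (by simp [hvar, hb1.B_eq]; omega) (by simp [hvar, hb1.B_eq])
        (by simp [hvar, hb1.B_eq]; omega) (by simp [hvar, hb1.B_eq]) (by omega) hzN ?_)
        fun σ2 hσ2 hf2 h2 => ?_
      · rw [Nat.mul_div_cancel _ hB, Nat.mul_comm, Nat.mul_add_div hB,
          Nat.div_eq_of_lt (show B - 1 < B by omega), Nat.add_zero]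
      · have hv2 := (hf2.var 11 rfl).trans hvar
        apply Run.of_wp hσ2
        refine Stmt.wp_store_of z (σ2.var 22) (by simp) (by simp [hv2]) (by simp) (by simp) ?_
        intro i hi hle
        by_cases hiz : i = z
        · subst hiz
          simp only [State.setVar_arr, State.setArr_arr, and_self, if_true]
          rw [Nat.mod_eq_of_lt h, Nat.div_eq_of_lt h, pow_zero, Nat.add_mul, Nat.one_mul]
          rwa [show i * B + (B - 1) + 1 = i * B + B by omega] at h2
        · simpa [hiz, hf2.arr 10 rfl] using hJ i (by omega) hle
    · simp [hb1.nb_eq, hvar] at h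
      have hj1 : 1 ≤ z / nb := (Nat.one_le_div_iff hnb).2 h
      have hp : 2 ^ (z / nb) = 2 ^ (z / nb - 1) + 2 ^ (z / nb - 1) := by
        rw [← Nat.two_mul, ← pow_succ', Nat.sub_add_cancel hj1]
      have hpl2 : 2 ^ (z / nb) ≤ 2 ^ Nat.log 2 nb := Nat.pow_le_pow_right (by norm_num) hj
      have hpos : 0 < 2 ^ (z / nb - 1) := by positivity
      apply Run.of_wp hσ1
      refine Stmt.wp_assign_seq (z / nb - 1) (by simp; omega) (by simp [hb1.nb_eq, hvar]) ?_
      refine Stmt.wp_assign_seq (σ1.arr 10 (z - nb)) (by simp) (by simp [hb1.nb_eq, hvar]) ?_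
      refine Stmt.wp_assign_seq (σ1.arr 10 (z - nb + 2 ^ (z / nb - 1)))
        (by simp [hb1.nb_eq, hvar]; omega) (by simp [hb1.nb_eq, hvar]) ?_
      refine Stmt.wp_store_of z _ (by simp) (by simp [hvar]) (by simp) rfl ?_
      intro i hi hle
      by_cases hiz : i = z
      · subst hiz
        -- The cell for block `b` one level lower, found `nb` cells back and shifted by the
        -- difference of the blocks.
        have key : ∀ b < nb, ∀ x, x = i - nb + b - i % nb → i % nb ≤ b →
            x / nb = i / nb - 1 ∧ x % nb = b := by
          intro b hb x hx hle
          refine index_inj (W := nb) (Nat.mod_lt _ hnb) hb ?_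
          have hle' : nb ≤ i / nb * nb := Nat.le_mul_of_pos_left nb hj1
          rw [Nat.div_add_mod', Nat.sub_mul, Nat.one_mul]
          omega
        obtain ⟨a1, a2⟩ := key (i % nb) hmod (i - nb) (by omega) le_rfl
        obtain ⟨b1, b2⟩ := key (i % nb + 2 ^ (i / nb - 1)) (by omega)
          (i - nb + 2 ^ (i / nb - 1)) (by omega) (by omega)
        have A := hJ (i - nb) (by omega) (by rw [a1, a2]; omega)
        have C := hJ (i - nb + 2 ^ (i / nb - 1)) (by omega) (by rw [b1, b2]; omega)
        rw [a1, a2] at A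
        rw [b1, b2, Nat.add_assoc (i % nb), ← hp] at C
        have := A.union C (Nat.mul_le_mul_right _ (by omega)) le_rfl
          (Nat.mul_le_mul_right _ (by omega))
        simpa using this
      · simpa [hiz] using hJ i (by omega) hle
  · rintro σ' - - ⟨h, -⟩ j hj b hb
    have hb' : b < nb := by have : 0 < 2 ^ j := by positivity
                            omega
    have := h _ (index_lt (show j < Nat.log 2 nb + 1 by omega) hb')
    have h1 : (j * nb + b) / nb = j := by
      rw [Nat.mul_comm, Nat.mul_add_div hnb, Nat.div_eq_of_lt hb', Nat.add_zero]
    have h2 : (j * nb + b) % nb = b := by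
      rw [Nat.mul_comm, Nat.mul_add_mod, Nat.mod_eq_of_lt hb']
    rw [h1, h2] at this
    exact this hb

/-- The next cell of the table of far ancestors. -/
def farBody : Stmt :=
  12 ≔ .var 11 / (♯4 * .var 9) ;;
  13 ≔ .var 11 % (♯4 * .var 9) ;;
  14 ≔ ((Expr.var 13 / ♯4).shr (.var 12)).shl (.var 12) ;;
  .ite (.var 13 - ♯4 * .var 14)
    (23 ≔ .get 12 (.var 11 - ♯1) ;;
      24 ≔ .get 4 (.var 23) - .var 7 ;;
      shortLA ;;
      .store 12 (.var 11) (.var 25))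
    (.store 12 (.var 11) (.get 5 (.var 14 * .var 7)))

/-- Each cell of a ladder is reached from the one before by a jump of length `B`, which `shortLA`
can already do. At the root the truncated subtraction stops the ladder. -/
theorem farLoop_run (S : Setup G r w B nb N E pos) (hσ : σ.WF w) (hb : Base G r B nb N E pos σ)
    (ho : OccTable G r B nb E (σ.arr 8)) (hn : NearTable G r B nb E (σ.arr 11))
    (h10 : σ.var 10 = (Nat.log 2 nb + 1) * (4 * nb)) :
    Run w (.for 11 10 farBody) σ
      (2 + ((Nat.log 2 nb + 1) * (4 * nb) + 1) * (farBody.time + 8))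
      (fun σ' => FarTable G r B nb E (σ'.arr 12)) := by
  have hB := S.B_pos
  have hN := S.N_le
  have hw := S.word
  have hlv := S.levels_le
  have hnb := S.nb_pos
  have hnb' := S.nb_le
  have hlog := S.log_nb_le
  have hBw := S.B_lt
  have hlv4 : (Nat.log 2 nb + 1) * (4 * nb) ≤ 24 * n := by rw [Nat.mul_left_comm]; omega
  set R := fun (z j : ℕ) => z / 4 / 2 ^ j * 2 ^ j with hR
  refine (Run.for (N := (Nat.log 2 nb + 1) * (4 * nb)) (fun z σ' => ∀ i < z,
    σ'.arr 12 i = ancAt G r (E (R (i % (4 * nb)) (i / (4 * nb)) * B))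
      (G.dist r (E (R (i % (4 * nb)) (i / (4 * nb)) * B)) -
        B * (i % (4 * nb) - 4 * R (i % (4 * nb)) (i / (4 * nb))))) _ hσ rfl rfl rfl
    h10 (by simp) ?_).mono hσ le_rfl ?_
  · intro x hx σ1 hσ1 hf hvar hJ
    have hb1 := hb.frame hf rfl
    have ho1 : OccTable G r B nb E (σ1.arr 8) := by rw [hf.arr 8 rfl]; exact ho
    have hn1 : NearTable G r B nb E (σ1.arr 11) := by rw [hf.arr 11 rfl]; exact hn
    have hdm := Nat.div_add_mod' x (4 * nb)
    have hmod := Nat.mod_lt x (show 0 < 4 * nb by omega)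
    have hj : x / (4 * nb) ≤ Nat.log 2 nb := by
      have := (Nat.div_lt_iff_lt_mul (show 0 < 4 * nb by omega)).2 hx
      omega
    have hJx := hJ (x - 1)
    set j := x / (4 * nb) with hjdef
    set z := x % (4 * nb) with hzdef
    have h2j : 0 < 2 ^ j := by positivity
    have hRz : R z j ≤ z / 4 := Nat.div_mul_le_self _ _
    have hRN := index_lt (show R z j < nb by omega) hB
    rw [← S.N_eq, Nat.add_zero] at hRN
    have hjw : j < w := by omega
    refine Run.assign_seq_time j hσ1 (by simp [hb1.nb_eq]; omega)
      (by simp [hvar, hb1.nb_eq, ← hjdef]) fun hσ2 => ?_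
    refine Run.assign_seq_time z hσ2 (by simp [hb1.nb_eq]; omega)
      (by simp [hvar, hb1.nb_eq, ← hzdef]) fun hσ3 => ?_
    refine Run.assign_seq_time (R z j) hσ3 ?_ (by simp [hR]) fun hσ4 => ?_
    · have : R z j < 2 ^ w := by omega
      simp only [hR] at this
      simp [this]; omega
    have hbτ := ((hb1.setVar 12 j rfl).setVar 13 z rfl).setVar 14 (R z j) rfl
    generalize hτ : (((σ1.setVar 12 j).setVar 13 z).setVar 14 (R z j)) = τ at hσ4 hbτ ⊢
    have harr : τ.arr = σ1.arr := by subst hτ; rfl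
    have v11 : τ.var 11 = x := by subst hτ; simp [hvar]
    have v13 : τ.var 13 = z := by subst hτ; simp
    have v14 : τ.var 14 = R z j := by subst hτ; simp
    have hstep : ∀ (τ' : State) (v : ℕ), τ'.arr 12 = σ1.arr 12 →
        v = ancAt G r (E (R z j * B)) (G.dist r (E (R z j * B)) - B * (z - 4 * R z j)) →
        ∀ i < x + 1, (τ'.setArr 12 x v).arr 12 i =
          ancAt G r (E (R (i % (4 * nb)) (i / (4 * nb)) * B))
      (G.dist r (E (R (i % (4 * nb)) (i / (4 * nb)) * B)) -
        B * (i % (4 * nb) - 4 * R (i % (4 * nb)) (i / (4 * nb)))) := by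
      intro τ' v ha hv i hi
      by_cases hix : i = x
      · subst hix
        simp only [State.setArr_arr, and_self, if_true]
        exact hv
      · simp only [State.setArr_arr, hix, and_false, if_false, ha]
        exact hJ i (by omega)
    clear hτ
    refine Run.ite_time hσ4 (by simp [v14]; omega) (fun h => ?_) (fun h => ?_)
    · simp [v13, v14] at h
      have hx1 : (x - 1) / (4 * nb) = j ∧ (x - 1) % (4 * nb) = z - 1 := by
        refine index_inj (W := 4 * nb) (Nat.mod_lt _ (by omega)) (by omega) ?_
        rw [Nat.div_add_mod']
        omega
      -- A cell that is not the first of its ladder has its predecessor in the same ladder.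
      have hR1 : R (z - 1) j = R z j := by
        refine le_antisymm (Nat.mul_le_mul_right _ (Nat.div_le_div_right (by omega))) ?_
        refine Nat.mul_le_mul_right _ ((Nat.le_div_iff_mul_le h2j).2 ?_)
        show R z j ≤ _
        omega
      have hu := hJx (by omega)
      rw [hx1.1, hx1.2, hR1] at hu
      set b := R z j with hbdef
      set D := G.dist r (E (b * B)) with hD
      set u := ancAt G r (E (b * B)) (D - B * (z - 1 - 4 * b)) with hudef
      have hdu := dist_ancAt S.tree (r := r) (v := E (b * B)) (d := D - B * (z - 1 - 4 * b))
        (by omega)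
      rw [← hudef] at hdu
      have hBz : B * (z - 4 * b) = B * (z - 1 - 4 * b) + B := by
        rw [← Nat.mul_succ]; congr 1; omega
      refine Run.assign_seq_time u hσ4 (by simp; omega) (by simp [v11, harr, hu]) fun hσ5 => ?_
      refine Run.assign_seq_time (D - B * (z - 4 * b)) hσ5 (by simp) ?_ fun hσ6 => ?_
      · simp [hbτ.dep_eq, hdu, hbτ.B_eq, hBz]; omega
      have hb6 := (hbτ.setVar 23 u rfl).setVar 24 (D - B * (z - 4 * b)) rfl
      refine Run.seq_time hσ6 (shortLA_run S hσ6 hb6 (u := u) (d := D - B * (z - 4 * b))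
        (by simpa [harr] using ho1) (by simpa [harr] using hn1) (by simp) (by simp)
        (by omega) (by omega)) fun σ7 hσ7 hf7 h7 => ?_
      apply Run.of_wp hσ7
      refine Stmt.wp_store_of x _ (by simp) (by simp [hf7.var 11 rfl, v11]) (by simp) rfl ?_
      refine hstep _ _ (by rw [hf7.arr 12 rfl]; exact congrFun harr 12) ?_
      simp only [Expr.val_var, h7]
      rw [hudef, ancAt_ancAt S.tree (by omega) (by omega)]
    · simp [v13, v14] at h
      apply Run.of_wp hσ4
      refine Stmt.wp_store_of x (E (R z j * B) : Fin n) (by simp) (by simp [v11])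
        (by simp [v14, hbτ.B_eq]; omega) (by simp [v14, hbτ.B_eq, hbτ.E_eq _ hRN]) ?_
      refine hstep _ _ (congrFun harr 12) ?_
      rw [show z - 4 * R z j = 0 by omega, Nat.mul_zero, Nat.sub_zero, ancAt_self]
  · rintro σ' - - ⟨h, -⟩ j hj z hz
    have := h _ (index_lt (show j < Nat.log 2 nb + 1 by omega) hz)
    have h1 : (j * (4 * nb) + z) / (4 * nb) = j := by
      rw [Nat.mul_comm, Nat.mul_add_div (by omega), Nat.div_eq_of_lt hz, Nat.add_zero]
    have h2 : (j * (4 * nb) + z) % (4 * nb) = z := by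
      rw [Nat.mul_comm, Nat.mul_add_mod, Nat.mod_eq_of_lt hz]
    rw [h1, h2] at this
    exact this

end KServer

/-! ### Existence of the Euler tour -/

namespace KServer

open WordRAM

theorem InSubtree.of_parent {V : Type*} {G : SimpleGraph V} (hG : G.IsTree) {r u v c : V}
    (h : InSubtree G r u v) (hc : stepToward G c r = v) : InSubtree G r u c := by
  by_contra hn
  by_cases hcr : c = r
  · subst hcr; rw [stepToward_self] at hc; exact hn (hc ▸ h)
  · have := dist_stepToward hG hcr
    subst hc
    refine hn ⟨by have := h.1; omega, ?_⟩
    rw [← ancAt_stepToward hG (by have := h.1; omega), h.2]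

theorem InSubtree.parent {V : Type*} {G : SimpleGraph V} (hG : G.IsTree) {r u v : V}
    (h : InSubtree G r u v) (hne : u ≠ v) : InSubtree G r u (stepToward G v r) := by
  by_contra hn
  exact hne (enter_subtree hG (Or.inr rfl) hn h).1.symm

theorem InSubtree.eq_root {V : Type*} {G : SimpleGraph V} (hG : G.IsTree) {r u : V}
    (h : InSubtree G r u r) : u = r := by
  have := h.1
  rw [SimpleGraph.dist_self] at this
  exact ((hG.connected.dist_eq_zero_iff).1 (by omega)).symm

variable {n : ℕ} {G : SimpleGraph (Fin n)} {r : Fin n} {w B nb N : ℕ} {E : ℕ → Fin n}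
  {pos : Fin n → ℕ} {σ : State}

open Classical in
/-- The successor of the largest child of `u` below `m`, or zero if there is none. -/
noncomputable def topChild (G : SimpleGraph (Fin n)) (r u : Fin n) : ℕ → ℕ
  | 0 => 0
  | m + 1 => if ∃ c : Fin n, (c : ℕ) = m ∧ c ≠ r ∧ stepToward G c r = u then m + 1
    else topChild G r u m

theorem topChild_le (u : Fin n) (m : ℕ) : topChild G r u m ≤ m := by
  induction m with
  | zero => exact le_rfl
  | succ m ih => rw [topChild]; split <;> omega

theorem lt_topChild {u c : Fin n} (hc : c ≠ r) (hu : stepToward G c r = u) {m : ℕ} (hm : c < m) :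
    c < topChild G r u m := by
  induction m with
  | zero => omega
  | succ m ih =>
    rw [topChild]
    split
    · omega
    · next h =>
      refine ih ?_
      have : (c : ℕ) ≠ m := fun hcm => h ⟨c, hcm, hc, hu⟩
      omega

theorem topChild_spec (u : Fin n) (m : ℕ) (h : topChild G r u m ≠ 0) :
    ∃ c : Fin n, topChild G r u m = c + 1 ∧ c ≠ r ∧ stepToward G c r = u := by
  induction m with
  | zero => exact absurd rfl h
  | succ m ih =>
    rw [topChild] at h ⊢
    split
    · next h' => obtain ⟨c, h1, h2⟩ := h'; exact ⟨c, by omega, h2⟩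
    · next h' => rw [if_neg h'] at h; exact ih h

open Classical in
/-- The walk through the tree: the bounds for the unvisited children, and the current node. -/
noncomputable def tourState (G : SimpleGraph (Fin n)) (r : Fin n) :
    ℕ → (Fin n → ℕ) × Fin n
  | 0 => (fun u => topChild G r u n, r)
  | t + 1 =>
    if h : (tourState G r t).1 (tourState G r t).2 ≠ 0 ∧
        (tourState G r t).1 (tourState G r t).2 - 1 < n then
      (Function.update (tourState G r t).1 (tourState G r t).2
        (topChild G r (tourState G r t).2 ((tourState G r t).1 (tourState G r t).2 - 1)),
        ⟨(tourState G r t).1 (tourState G r t).2 - 1, h.2⟩)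
    else ((tourState G r t).1, stepToward G (tourState G r t).2 r)

/-- The invariant of the walk through the tree after `t` steps. -/
structure TourInv (G : SimpleGraph (Fin n)) (r : Fin n) (E : ℕ → Fin n) (t : ℕ) (p : Fin n → ℕ) :
    Prop where
  child : ∀ u, p u ≠ 0 → ∃ c : Fin n, p u = c + 1 ∧ c ≠ r ∧ stepToward G c r = u
  visited : ∀ c, c ≠ r → ((∃ s ≤ t, E s = c) ↔ p (stepToward G c r) ≤ c)
  parent : ∀ s ≤ t, ∃ s' ≤ t, E s' = stepToward G (E s) r
  finished : ∀ s ≤ t, ¬ InSubtree G r (E s) (E t) → p (E s) = 0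
  count : t + G.dist r (E t) + 2 ≤ 2 * ((Finset.range (t + 1)).image E).card ∨
    (E t = r ∧ p r = 0)

theorem tourState_succ_of_eq_zero {t : ℕ} (h : (tourState G r t).1 (tourState G r t).2 = 0) :
    tourState G r (t + 1) = ((tourState G r t).1, stepToward G (tourState G r t).2 r) := by
  rw [tourState, dif_neg (by simp [h])]

theorem tourState_succ_of_eq_succ {t : ℕ} {c : Fin n}
    (h : (tourState G r t).1 (tourState G r t).2 = c + 1) :
    tourState G r (t + 1) = (Function.update (tourState G r t).1 (tourState G r t).2
      (topChild G r (tourState G r t).2 c), c) := by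
  rw [tourState, dif_pos (by simp [h])]
  simp [h]

theorem image_range_succ (E : ℕ → Fin n) (t : ℕ) :
    (Finset.range (t + 1)).image E = insert (E t) ((Finset.range t).image E) := by
  rw [Finset.range_add_one, Finset.image_insert]

/-- Going up exchanges one unit of depth for one unit of time, which leaves `count` unchanged; at
the root with no child left, the walk is finished and stays there. The subtree just left has no
unvisited children. -/
theorem TourInv.up (hG : G.IsTree) {t : ℕ} {p : Fin n → ℕ} (h : TourInv G r E t p)
    (h0 : p (E t) = 0) (hE : E (t + 1) = stepToward G (E t) r) : TourInv G r E (t + 1) p := by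
  obtain ⟨s₁, hs₁, hEs⟩ := h.parent t le_rfl
  have hold : ∀ s ≤ t + 1, ∃ s' ≤ t, E s' = E s := by
    intro s hs
    rcases Nat.lt_or_ge t s with h1 | h1
    · rw [show s = t + 1 by omega, hE]; exact ⟨s₁, hs₁, hEs⟩
    · exact ⟨s, h1, rfl⟩
  refine ⟨h.child, fun c hc => ?_, fun s hs => ?_, fun s hs hn => ?_, ?_⟩
  · rw [← h.visited c hc]
    constructor
    · rintro ⟨s, hs, rfl⟩; exact hold s hs
    · rintro ⟨s, hs, hs'⟩; exact ⟨s, by omega, hs'⟩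
  · obtain ⟨s', hs', e⟩ := hold s hs
    obtain ⟨s₂, hs₂, e₂⟩ := h.parent s' hs'
    exact ⟨s₂, by omega, by rw [e₂, e]⟩
  · obtain ⟨s', hs', e⟩ := hold s hs
    rw [← e] at hn ⊢
    by_cases hst : E s' = E t
    · rw [hst, h0]
    · refine h.finished s' hs' fun hsub => hn ?_
      rw [hE]
      exact hsub.parent hG hst
  · by_cases hr : E t = r
    · right
      rw [hE, hr, stepToward_self]
      exact ⟨rfl, hr ▸ h0⟩
    · left
      have := dist_stepToward hG hr
      rw [← hE] at this
      have hmem : E (t + 1) ∈ (Finset.range (t + 1)).image E := by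
        rw [hE, ← hEs]
        exact Finset.mem_image_of_mem _ (Finset.mem_range.2 (by omega))
      rw [image_range_succ, Finset.insert_eq_of_mem hmem]
      rcases h.count with h1 | h1
      · omega
      · exact absurd h1.1 hr

theorem TourInv.fresh {t : ℕ} {p : Fin n → ℕ} (h : TourInv G r E t p) {c : Fin n} (hc : c ≠ r)
    (hp : p (stepToward G c r) = c + 1) : ∀ s ≤ t, E s ≠ c := by
  intro s hs e
  have := (h.visited c hc).1 ⟨s, hs, e⟩
  omega

/-- Going down raises both time and depth by one, paid for by the new node on the right of `count`.
Passing to the next smaller child keeps the unvisited children of `E t` exactly those below the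
bound. -/
theorem TourInv.down (hG : G.IsTree) {t : ℕ} {p : Fin n → ℕ} (h : TourInv G r E t p) {c : Fin n}
    (hp : p (E t) = c + 1) (hE : E (t + 1) = c) :
    TourInv G r E (t + 1) (Function.update p (E t) (topChild G r (E t) c)) := by
  obtain ⟨c', hc', hcr, hcp⟩ := h.child (E t) (by omega)
  obtain rfl : c = c' := Fin.ext (by omega)
  have hfresh := h.fresh hcr (by rw [hcp, hp])
  have hcE : E t ≠ c := hfresh t le_rfl
  have hnew : ∀ x, (∃ s ≤ t + 1, E s = x) ↔ x = c ∨ ∃ s ≤ t, E s = x := by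
    intro x
    constructor
    · rintro ⟨s, hs, rfl⟩
      rcases Nat.lt_or_ge t s with h1 | h1
      · left; rw [show s = t + 1 by omega, hE]
      · exact Or.inr ⟨s, h1, rfl⟩
    · rintro (rfl | ⟨s, hs, e⟩)
      · exact ⟨t + 1, le_rfl, hE⟩
      · exact ⟨s, by omega, e⟩
  refine ⟨fun u hu => ?_, fun x hx => ?_, fun s hs => ?_, fun s hs hn => ?_, ?_⟩
  · by_cases huE : u = E t
    · subst huE
      rw [Function.update_self] at hu ⊢
      exact topChild_spec _ _ hu
    · rw [Function.update_of_ne huE] at hu ⊢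
      exact h.child u hu
  · rw [hnew, h.visited x hx]
    by_cases hxE : stepToward G x r = E t
    · rw [hxE, Function.update_self, hp]
      constructor
      · rintro (rfl | h1)
        · exact topChild_le _ _
        · exact (topChild_le _ _).trans (by omega)
      · intro h1
        by_contra hn
        have hxc : (x : ℕ) ≠ c := fun e => hn (Or.inl (Fin.ext e))
        have := lt_topChild hx hxE (m := c) (by omega)
        omega
    · rw [Function.update_of_ne hxE]
      refine ⟨?_, Or.inr⟩
      rintro (rfl | h1)
      · exact absurd hcp hxE
      · exact h1
  · rcases Nat.lt_or_ge t s with h1 | h1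
    · rw [show s = t + 1 by omega, hE, hcp]; exact ⟨t, by omega, rfl⟩
    · obtain ⟨s₂, hs₂, e₂⟩ := h.parent s h1
      exact ⟨s₂, by omega, e₂⟩
  · rcases Nat.lt_or_ge t s with h1 | h1
    · rw [show s = t + 1 by omega] at hn
      exact absurd (inSubtree_self G r _) hn
    · have hn' : ¬ InSubtree G r (E s) (E t) := fun hsub =>
        hn (by rw [hE]; exact hsub.of_parent hG hcp)
      have hne : E s ≠ E t := fun e => hn' (by rw [e]; exact inSubtree_self G r _)
      rw [Function.update_of_ne hne]
      exact h.finished s h1 hn'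
  · left
    have hd := dist_stepToward hG hcr
    rw [hcp] at hd
    have hmem : E (t + 1) ∉ (Finset.range (t + 1)).image E := by
      rw [hE, Finset.mem_image]
      rintro ⟨s, hs, e⟩
      exact hfresh s (by rw [Finset.mem_range] at hs; omega) e
    rw [image_range_succ, Finset.card_insert_of_notMem hmem, hE]
    rcases h.count with h1 | ⟨h1, h2⟩
    · omega
    · rw [h1, h2] at hp; omega

theorem tourInv (hG : G.IsTree) (r : Fin n) (t : ℕ) :
    TourInv G r (fun s => (tourState G r s).2) t (tourState G r t).1 := by
  induction t with
  | zero =>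
    refine ⟨fun u hu => topChild_spec _ _ hu, fun c hc => ?_, fun s hs => ?_, fun s hs hn => ?_, ?_⟩
    · constructor
      · rintro ⟨s, hs, e⟩
        rw [Nat.le_zero.1 hs] at e
        exact absurd e.symm hc
      · intro h
        have := lt_topChild (G := G) (u := stepToward G c r) hc rfl c.2
        exact absurd h (by rw [tourState]; dsimp only; omega)
    · rw [Nat.le_zero.1 hs]
      exact ⟨0, le_rfl, (stepToward_self r).symm⟩
    · rw [Nat.le_zero.1 hs] at hn
      exact absurd (inSubtree_self G r _) hn
    · left
      simp [tourState]
  | succ t ih =>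
    by_cases h : (tourState G r t).1 (tourState G r t).2 = 0
    · have e := tourState_succ_of_eq_zero h
      rw [e]
      exact ih.up hG h (by rw [e])
    · obtain ⟨c, h1, h2, h3⟩ := ih.child _ h
      have e := tourState_succ_of_eq_succ h1
      rw [e]
      exact ih.down hG h1 (by rw [e])

/-- At most `n` nodes are visited, so by time `N - 1 ≥ 2 * n` the inequality in `count` fails and
the walk is finished in the root. Then no visited node has an unvisited child, and induction on the
depth shows that all nodes are visited. -/
theorem eulerTour (hG : G.IsTree) (r : Fin n) (hN : 2 * n < N) :
    EulerTour G r N (fun s => (tourState G r s).2) := by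
  have h := tourInv hG r (N - 1)
  have hcard := Finset.card_le_univ ((Finset.range (N - 1 + 1)).image fun s => (tourState G r s).2)
  rw [Fintype.card_fin] at hcard
  obtain ⟨hlast, hr⟩ := h.count.resolve_left (by omega)
  have hzero : ∀ s ≤ N - 1, (tourState G r (N - 1)).1 (tourState G r s).2 = 0 := by
    intro s hs
    by_cases hsub : InSubtree G r (tourState G r s).2 (tourState G r (N - 1)).2
    · rw [hlast] at hsub
      rw [hsub.eq_root hG, hr]
    · exact h.finished s hs hsub
  refine ⟨by omega, rfl, hlast, fun t => ?_, ?_⟩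
  · by_cases ht : (tourState G r t).1 (tourState G r t).2 = 0
    · left; rw [tourState_succ_of_eq_zero ht]
    · right
      have ih := tourInv hG r t
      obtain ⟨c, h1, h2, h3⟩ := ih.child _ ht
      rw [tourState_succ_of_eq_succ h1]
      exact ⟨h3, ih.fresh h2 (by rw [h3, h1])⟩
  · have : ∀ d, ∀ v, G.dist r v = d → ∃ t < N, (tourState G r t).2 = v := by
      intro d
      induction d with
      | zero =>
        intro v hv
        exact ⟨0, by omega, (hG.connected.dist_eq_zero_iff).1 hv⟩
      | succ d ih =>
        intro v hv
        have hvr : v ≠ r := by rintro rfl; simp at hv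
        have := dist_stepToward hG hvr
        obtain ⟨t, ht, e⟩ := ih (stepToward G v r) (by omega)
        have := hzero t (by omega)
        obtain ⟨s, hs, e'⟩ := (h.visited v hvr).2 (by rw [← e, this]; exact Nat.zero_le _)
        exact ⟨s, by omega, e'⟩
    exact fun v => this _ v rfl

end KServer

/-! ### The preprocessing program -/

namespace KServer

open WordRAM

variable {n : ℕ} {G : SimpleGraph (Fin n)} {r : Fin n} {w B nb N : ℕ} {E : ℕ → Fin n}
  {pos : Fin n → ℕ} {σ : State}

/-- The next entry of the table of logarithms. -/
def logBody : Stmt :=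
  .ite ((Expr.var 11).lt ♯2) (.store 6 (.var 11) ♯0)
    (.store 6 (.var 11) (.get 6 (.var 11 / ♯2) + ♯1))

theorem logLoop_run (hσ : σ.WF w) (hw : 1 < w) {M : ℕ} (hM : 2 ≤ M) (h10 : σ.var 10 = M) :
    Run w (.for 11 10 logBody) σ (2 + (M + 1) * (logBody.time + 8))
      (fun σ' => ∀ x < M, σ'.arr 6 x = Nat.log 2 x) := by
  have hMw : M < 2 ^ w := h10 ▸ hσ.var 10
  refine (Run.for (N := M) (fun z σ' => ∀ x < z, σ'.arr 6 x = Nat.log 2 x) _ hσ rfl rfl rfl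
    h10 (by simp) ?_).mono hσ le_rfl (fun σ' _ _ h => h.1)
  intro z hz σ1 hσ1 hf hvar hJ
  apply Run.of_wp hσ1
  refine (Stmt.wp_ite _ _ _ _ _ _).2 ⟨by simp; omega, fun h => ?_, fun h => ?_⟩
  · simp [hvar] at h
    refine Stmt.wp_store_of z 0 (by simp) (by simp [hvar]) (by simp) (by simp) ?_
    intro x hx
    by_cases hxz : x = z
    · subst hxz
      simp [Nat.log_of_lt (show x < 2 by omega)]
    · simp [hxz, hJ x (by omega)]
  · simp [hvar] at h
    have hlog : Nat.log 2 z = Nat.log 2 (z / 2) + 1 := Nat.log_of_one_lt_of_le (by norm_num) h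
    have hlt : Nat.log 2 z < z := Nat.log_lt_self 2 (by omega)
    have hrd := hJ (z / 2) (by omega)
    refine Stmt.wp_store_of z (Nat.log 2 z) (by simp) (by simp [hvar])
      (by simp [hvar, hrd]; omega)
      (by simp only [Expr.val_add, Expr.val_get, Expr.val_div, Expr.val_var, Expr.val_const, hvar,
        hrd, hlog]) ?_
    intro x hx
    by_cases hxz : x = z
    · subst hxz; simp
    · simp [hxz, hJ x (by omega)]

/-- Insert the node in register `11` into the list of the children of its parent. -/
def childBody : Stmt :=
  .ite ((Expr.var 11).eq (.var 1)) .skip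
    (.store 3 (.var 11) (.get 2 (.get 0 (.var 11))) ;;
      .store 2 (.get 0 (.var 11)) (.var 11 + ♯1))

/-- The nodes are inserted in increasing order at the front, so array `2` holds the successor of the
largest child so far and array `3` that of the next smaller sibling; zero ends a list. -/
theorem childLoop_run (hσ : σ.WF w) (hw : 1 < w) (h0 : σ.var 0 = n) (h1 : σ.var 1 = r)
    (hp : ∀ v : Fin n, σ.arr 0 v = stepToward G v r) (h2 : ∀ i, σ.arr 2 i = 0) :
    Run w (.for 11 0 childBody) σ (2 + (n + 1) * (childBody.time + 8))
      (fun σ' => (∀ u : Fin n, σ'.arr 2 u = topChild G r u n) ∧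
        ∀ c : Fin n, c ≠ r → σ'.arr 3 c = topChild G r (stepToward G c r) c) := by
  have hnw : n < 2 ^ w := h0 ▸ hσ.var 0
  refine (Run.for (N := n) (fun z σ' => (∀ u : Fin n, σ'.arr 2 u = topChild G r u z) ∧
    ∀ c : Fin n, c < z → c ≠ r → σ'.arr 3 c = topChild G r (stepToward G c r) c) _ hσ rfl rfl rfl
    h0 (by simp [h2, topChild]) ?_).mono hσ le_rfl
    (fun σ' _ _ h => ⟨h.1.1, fun c => h.1.2 c c.2⟩)
  rintro z hz σ1 hσ1 hf hvar ⟨J1, J2⟩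
  have hr1 := (hf.var 1 rfl).trans h1
  have hp1 : ∀ v : Fin n, σ1.arr 0 v = stepToward G v r := by rw [hf.arr 0 rfl]; exact hp
  have hpz := hp1 ⟨z, hz⟩
  simp only at hpz
  apply Run.of_wp hσ1
  refine (Stmt.wp_ite _ _ _ _ _ _).2 ⟨by simp, fun h => ?_, fun h => ?_⟩
  · simp [hvar, hr1] at h
    refine ⟨fun u => ?_, fun c hc hcr => ?_⟩
    · rw [topChild, if_neg]
      · exact J1 u
      · rintro ⟨c, hc, hcr, -⟩
        exact hcr (Fin.ext (hc.trans h))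
    · have : (c : ℕ) ≠ z := fun e => hcr (Fin.ext (e.trans h))
      exact J2 c (by omega) hcr
  · simp [hvar, hr1] at h
    have hzr : (⟨z, hz⟩ : Fin n) ≠ r := fun e => h (congrArg Fin.val e)
    refine Stmt.wp_store_seq z (topChild G r (stepToward G ⟨z, hz⟩ r) z) (by simp)
      (by simp [hvar]) (by simp) (by simp [hvar, hpz, J1]) ?_
    refine Stmt.wp_store_of (stepToward G ⟨z, hz⟩ r : Fin n) (z + 1) (by simp)
      (by simp [hvar, hpz])
      (by simp [hvar]; omega) (by simp [hvar]) ?_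
    refine ⟨fun u => ?_, fun c hc hcr => ?_⟩
    · simp only [State.setVar_arr, State.setArr_arr, true_and]
      rw [topChild]
      by_cases hu : u = stepToward G ⟨z, hz⟩ r
      · rw [if_pos (by rw [hu]), if_pos ⟨⟨z, hz⟩, rfl, hzr, hu.symm⟩]
      · have hu' : (u : ℕ) ≠ stepToward G ⟨z, hz⟩ r := fun e => hu (Fin.ext e)
        rw [if_neg hu', if_neg fun h => absurd h.1 (by decide), if_neg]
        · exact J1 u
        · rintro ⟨c, hc, hcr, e⟩
          exact hu (by rw [← e, show c = ⟨z, hz⟩ from Fin.ext hc])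
    · by_cases hcz : (c : ℕ) = z
      · obtain rfl : c = ⟨z, hz⟩ := Fin.ext hcz
        simp
      · simpa [hcz] using J2 c (by omega) hcr

/-- One step of the walk through the tree; the current node is in register `13`. -/
def tourBody : Stmt :=
  .store 5 (.var 11) (.var 13) ;;
  .store 7 (.var 13) (.var 11) ;;
  14 ≔ .get 2 (.var 13) ;;
  .ite (.var 14)
    (.store 2 (.var 13) (.get 3 (.var 14 - ♯1)) ;;
      .store 4 (.var 14 - ♯1) (.get 4 (.var 13) + ♯1) ;;
      13 ≔ .var 14 - ♯1)
    (13 ≔ .get 0 (.var 13))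

/-- Array `7` is overwritten at every visit; its final entry is some visit of the node, and any
visit serves as `pos`. Depths are written at the first visit, from the depth of the parent. -/
theorem tourLoop_run (hG : G.IsTree) (hσ : σ.WF w) (hw : 1 < w) (h8 : σ.var 8 = N) (h13 : σ.var 13 = r)
    (hn : n < 2 ^ w)
    (hp : ∀ v : Fin n, σ.arr 0 v = stepToward G v r) (h2 : ∀ u : Fin n, σ.arr 2 u = topChild G r u n)
    (h3 : ∀ c : Fin n, c ≠ r → σ.arr 3 c = topChild G r (stepToward G c r) c)
    (h4 : σ.arr 4 r = 0) :
    Run w (.for 11 8 tourBody) σ (2 + (N + 1) * (tourBody.time + 8))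
      (fun σ' => (∀ s < N, σ'.arr 5 s = (tourState G r s).2) ∧
        (∀ s < N, σ'.arr 7 (tourState G r s).2 < N ∧
          (tourState G r (σ'.arr 7 (tourState G r s).2)).2 = (tourState G r s).2) ∧
        ∀ s < N, σ'.arr 4 (tourState G r s).2 = G.dist r (tourState G r s).2) := by
  have hdlt : ∀ v, G.dist r v < n := by
    intro v
    obtain ⟨p, hp, hl⟩ := hG.connected.exists_path_of_dist r v
    rw [← hl]
    simpa using hp.length_lt
  refine (Run.for (N := N) (fun t σ' => (∀ s < t, σ'.arr 5 s = (tourState G r s).2) ∧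
    (∀ s < t, σ'.arr 7 (tourState G r s).2 < t ∧
          (tourState G r (σ'.arr 7 (tourState G r s).2)).2 = (tourState G r s).2) ∧
    (∀ s ≤ t, σ'.arr 4 (tourState G r s).2 = G.dist r (tourState G r s).2) ∧
    (∀ u : Fin n, σ'.arr 2 u = (tourState G r t).1 u) ∧
    σ'.var 13 = (tourState G r t).2) _ hσ rfl rfl rfl
    h8 ?_ ?_).mono hσ le_rfl
    (fun σ' _ _ h => ⟨h.1.1, h.1.2.1, fun s hs => h.1.2.2.1 s hs.le⟩)
  · refine ⟨by simp, by simp, fun s hs => ?_, fun u => h2 u, by simp [h13, tourState]⟩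
    rw [Nat.le_zero.1 hs]
    simp [tourState, h4]
  rintro t ht σ1 hσ1 hf hvar ⟨J5, J7, J4, J2, J13⟩
  have hp1 : ∀ v : Fin n, σ1.arr 0 v = stepToward G v r := by rw [hf.arr 0 rfl]; exact hp
  have h31 : ∀ c : Fin n, c ≠ r → σ1.arr 3 c = topChild G r (stepToward G c r) c := by
    rw [hf.arr 3 rfl]; exact h3
  have inv := tourInv hG r t
  have K5 : ∀ s < t + 1, (σ1.setArr 5 t (tourState G r t).2).arr 5 s = (tourState G r s).2 := by
    intro s hs
    by_cases hst : s = t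
    · simp [hst]
    · simp [hst, J5 s (by omega)]
  have K7 : ∀ s < t + 1, (σ1.setArr 7 (tourState G r t).2 t).arr 7 (tourState G r s).2 < t + 1 ∧
      (tourState G r ((σ1.setArr 7 (tourState G r t).2 t).arr 7 (tourState G r s).2)).2 =
        (tourState G r s).2 := by
    intro s hs
    by_cases hst : (tourState G r s).2 = (tourState G r t).2
    · simp [hst]
    · have hst' : s ≠ t := fun e => hst (by rw [e])
      obtain ⟨a, b⟩ := J7 s (by omega)
      have hv : ((tourState G r s).2 : ℕ) ≠ (tourState G r t).2 := fun e => hst (Fin.ext e)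
      simp only [State.setArr_arr, hv, and_false, if_false]
      exact ⟨by omega, b⟩
  set v := (tourState G r t).2 with hv
  apply Run.of_wp hσ1
  refine Stmt.wp_store_seq t v (by simp) (by simp [hvar]) (by simp) (by simp [J13]) ?_
  refine Stmt.wp_store_seq v t (by simp) (by simp [J13]) (by simp) (by simp [hvar]) ?_
  refine Stmt.wp_assign_seq ((tourState G r t).1 v) (by simp) (by simp [J13, J2]) ?_
  refine (Stmt.wp_ite _ _ _ _ _ _).2 ⟨by simp, fun h => ?_, fun h => ?_⟩
  · simp at h
    obtain ⟨c, c1, c2, c3⟩ := inv.child _ h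
    have e := tourState_succ_of_eq_succ c1
    have hd := dist_stepToward hG c2
    rw [c3] at hd
    have hdc := hdlt c
    have hc3 := h31 c c2
    have j4 := J4 t le_rfl
    rw [c3] at hc3
    rw [← hv] at e j4
    have hvc : (v : ℕ) ≠ c := by
      intro e'
      rw [Fin.ext e'] at hd
      omega
    refine Stmt.wp_store_seq v (topChild G r v c) (by simp) (by simp [J13]) (by simp; omega)
      (by simp [c1, hc3]) ?_
    refine Stmt.wp_store_seq c (G.dist r c) (by simp; omega) (by simp [c1])
      (by simp [J13, j4]; omega) (by simp [J13, j4, hd]) ?_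
    refine Stmt.wp_assign_of c (by simp; omega) (by simp [c1]) ?_
    refine ⟨fun s hs => ?_, fun s hs => ?_, fun s hs => ?_, fun u => ?_, by simp [e]⟩
    · simpa using K5 s hs
    · simpa using K7 s hs
    · rcases Nat.lt_or_ge t s with h1 | h1
      · rw [show s = t + 1 by omega, e]; simp
      · have := J4 s h1
        by_cases hsc : (tourState G r s).2 = c
        · simp [hsc]
        · have : ((tourState G r s).2 : ℕ) ≠ c := fun e => hsc (Fin.ext e)
          simp [this, J4 s h1]
    · rw [e]
      by_cases huv : u = v
      · subst huv; simp
      · have : (u : ℕ) ≠ v := fun e => huv (Fin.ext e)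
        simp [this, Function.update_of_ne huv, J2]
  · simp at h
    have e := tourState_succ_of_eq_zero h
    rw [← hv] at e
    refine Stmt.wp_assign_of (stepToward G v r : Fin n) (by simp) (by simp [J13, hp1]) ?_
    refine ⟨fun s hs => ?_, fun s hs => ?_, fun s hs => ?_, fun u => ?_, by simp [e]⟩
    · simpa using K5 s hs
    · simpa using K7 s hs
    · rcases Nat.lt_or_ge t s with h1 | h1
      -- The node reached by going up was visited before, so its depth is already stored.
      · obtain ⟨s', hs', e'⟩ := inv.parent t le_rfl
        rw [show s = t + 1 by omega, e]
        rw [← hv] at e'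
        simp only [← e']
        simpa using J4 s' hs'
      · simpa using J4 s h1
    · rw [e]
      simpa using J2 u

/-- The memory after the preprocessing. -/
structure Ready (G : SimpleGraph (Fin n)) (r : Fin n) (w B nb N : ℕ) (E : ℕ → Fin n)
    (pos : Fin n → ℕ) (σ : State) : Prop where
  setup : Setup G r w B nb N E pos
  base : Base G r B nb N E pos σ
  occ : OccTable G r B nb E (σ.arr 8)
  mask : MaskTable G r B N E (σ.arr 9)
  sparse : SparseTable G r B nb E (σ.arr 10)
  near : NearTable G r B nb E (σ.arr 11)
  far : FarTable G r B nb E (σ.arr 12)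

/-- The sizes of the tables, the tour, and the table of logarithms. -/
def preprocessBase : Stmt :=
  10 ≔ ♯2 * .var 0 + ♯2 ;;
  .for 11 10 logBody ;;
  7 ≔ .get 6 (.var 0) + ♯1 ;;
  9 ≔ ♯2 * .var 0 / .var 7 + ♯1 ;;
  8 ≔ .var 9 * .var 7 ;;
  13 ≔ .var 1 ;;
  .for 11 0 childBody ;;
  .for 11 8 tourBody

theorem _root_.WordRAM.Run.assign_seq {w x T : ℕ} {e : Expr} {s : Stmt} {σ : State}
    {Q : State → Prop} (v : ℕ) (hσ : σ.WF w) (hs : e.Safe w σ) (hv : e.val σ = v)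
    (h : (σ.setVar x v).WF w → Run w s (σ.setVar x v) T Q) :
    Run w (x ≔ e ;; s) σ (e.cost + 1 + T) Q :=
  Run.seq hσ (P := fun σ' => σ' = σ.setVar x v) (Run.of_wp hσ (Stmt.wp_assign_of v hs hv rfl))
    (by rintro σ' hσ' _ rfl; exact h hσ')

theorem preprocessBase_run (hG : G.IsTree) (r : Fin n) (hw : 1000 * (n + 1) ≤ 2 ^ w)
    (hσ : (treeInput G r).WF w) :
    Run w preprocessBase (treeInput G r) (1000 * n)
      (fun σ' => ∃ B nb N E pos, Setup G r w B nb N E pos ∧ Base G r B nb N E pos σ') := by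
  have hn : 1 ≤ n := by have := r.2; omega
  set σ := treeInput G r with hσdef
  have v0 : σ.var 0 = n := by simp [hσdef, treeInput]
  have v1 : σ.var 1 = r := by simp [hσdef, treeInput]
  have a0 : ∀ v : Fin n, σ.arr 0 v = stepToward G v r := fun v => by simp [hσdef, treeInput]
  have az : ∀ a i, a ≠ 0 → σ.arr a i = 0 := fun a i h => by simp [hσdef, treeInput, h]
  clear_value σ
  have hw1 : 1 < w := by
    by_contra hle
    have := Nat.pow_le_pow_right (n := 2) (by norm_num) (not_lt.1 hle)
    omega
  obtain ⟨B, hB⟩ : ∃ B, B = Nat.log 2 n + 1 := ⟨_, rfl⟩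
  obtain ⟨nb, hnb⟩ : ∃ nb, nb = 2 * n / B + 1 := ⟨_, rfl⟩
  obtain ⟨N, hN⟩ : ∃ N, N = nb * B := ⟨_, rfl⟩
  have L : Layout n w B nb N := ⟨hn, hw, hB, hnb, hN⟩
  have hNle := L.N_le
  have hnble := L.nb_le
  have hBle := L.B_le
  have t1 : logBody.time = 15 := rfl
  have t2 : childBody.time = 16 := rfl
  have t3 : tourBody.time = 32 := rfl
  have hlogn : Nat.log 2 n < n := Nat.log_lt_self 2 (by omega)
  have hBpos := L.B_pos
  refine Run.mono_time (T := (5 + 1) + ((2 + (2 * n + 2 + 1) * (logBody.time + 8)) + ((4 + 1) +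
    ((7 + 1) + ((3 + 1) + ((1 + 1) + ((2 + (n + 1) * (childBody.time + 8)) +
      (2 + (N + 1) * (tourBody.time + 8))))))))) ?_ (by rw [t1, t2, t3]; omega)
  refine Run.assign_seq (2 * n + 2) hσ (by simp [v0]; omega) (by simp [v0]) fun hσ1 => ?_
  refine Run.seq hσ1 (logLoop_run hσ1 hw1 (M := 2 * n + 2) (by omega) (by simp))
    fun σ2 hσ2 hf2 hlg => ?_
  have w0 : σ2.var 0 = n := by rw [hf2.var 0 rfl]; simp [v0]
  have w1 : σ2.var 1 = r := by rw [hf2.var 1 rfl]; simp [v1]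
  refine Run.assign_seq B hσ2 (by simp [w0, hlg n (by omega)]; omega)
    (by simp [w0, hlg n (by omega), hB]) fun hσ3 => ?_
  have hdiv : 2 * n / B ≤ 2 * n := Nat.div_le_self _ _
  refine Run.assign_seq nb hσ3 (by simp [w0]; omega) (by simp [w0, hnb]) fun hσ4 => ?_
  refine Run.assign_seq N hσ4 (by simp [← hN]; omega) (by simp [hN]) fun hσ5 => ?_
  refine Run.assign_seq r hσ5 (by simp) (by simp [w1]) fun hσ6 => ?_
  refine Run.seq hσ6 (childLoop_run (G := G) (r := r) hσ6 hw1 (by simp [w0]) (by simp [w1]) ?_ ?_)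
    fun σ7 hσ7 hf7 hch => ?_
  · intro v; simp [hf2.arr 0 rfl, a0]
  · intro i; simp [hf2.arr 2 rfl, az]
  have hp7 : ∀ v : Fin n, σ7.arr 0 v = stepToward G v r := by
    intro v; simp [hf7.arr 0 rfl, hf2.arr 0 rfl, a0]
  refine Run.mono (tourLoop_run hG hσ7 hw1 (N := N) ?_ ?_ (by omega) hp7 hch.1 hch.2 ?_) hσ7 le_rfl
    fun σ8 hσ8 hf8 h8 => ?_
  · simp [hf7.var 8 rfl]
  · simp [hf7.var 13 rfl]
  · simp [hf7.arr 4 rfl, hf2.arr 4 rfl, az]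
  obtain ⟨b5, b7, b4⟩ := h8
  have tour := eulerTour hG r L.lt_N
  refine ⟨B, nb, N, fun s => (tourState G r s).2, fun v => σ8.arr 7 v,
    ⟨L, hG, tour, fun v => ?_, fun v => ?_⟩, ?_⟩
  · obtain ⟨t, ht, e⟩ := tour.surj v
    have := b7 t ht
    rw [← e]; exact this.1
  · obtain ⟨t, ht, e⟩ := tour.surj v
    have := b7 t ht
    rw [← e]; exact this.2
  · refine ⟨?_, ?_, ?_, ?_, ?_, ?_, ?_, b5, ?_, fun v => rfl⟩
    · simp [hf8.var 0 rfl, hf7.var 0 rfl, w0]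
    · simp [hf8.var 1 rfl, hf7.var 1 rfl, w1]
    · simp [hf8.var 7 rfl, hf7.var 7 rfl]
    · simp [hf8.var 8 rfl, hf7.var 8 rfl]
    · simp [hf8.var 9 rfl, hf7.var 9 rfl]
    · intro v; simp [hf8.arr 0 rfl, hp7]
    · intro v
      obtain ⟨t, ht, e⟩ := tour.surj v
      rw [← e]; exact b4 t ht
    · intro x hx
      simpa [hf8.arr 6 rfl, hf7.arr 6 rfl] using hlg x (by omega)

/-- The tables for lowest common ancestors and level ancestors. -/
def preprocessTables : Stmt :=
  .for 11 8 maskBody ;;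
  .for 11 8 occBody ;;
  10 ≔ .var 9 * (♯2 * .var 7) ;;
  .for 11 10 nearBody ;;
  10 ≔ (.get 6 (.var 9) + ♯1) * .var 9 ;;
  .for 11 10 sparseBody ;;
  10 ≔ (.get 6 (.var 9) + ♯1) * (♯4 * .var 9) ;;
  .for 11 10 farBody

theorem preprocessTables_run (S : Setup G r w B nb N E pos) (hσ : σ.WF w)
    (hb : Base G r B nb N E pos σ) (h8 : ∀ i, σ.arr 8 i = 0) :
    Run w preprocessTables σ (9000 * n) (Ready G r w B nb N E pos) := by
  have hn := S.n_pos
  have hNle := S.N_le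
  have hnble := S.nb_le
  have hBle := S.B_le
  have hlv := S.levels_le
  have hlogB := S.log_nb_le
  have t1 : maskBody.time = 42 := rfl
  have t2 : occBody.time = 34 := rfl
  have t3 : nearBody.time = 25 := rfl
  have t4 : sparseBody.time = 72 := rfl
  have t5 : farBody.time = 102 := rfl
  have hw := S.word
  have hBw := S.B_lt
  have hnbpos := S.nb_pos
  have h1w : 2 < w := by
    by_contra hle
    have := Nat.pow_le_pow_right (n := 2) (by norm_num) (not_lt.1 hle)
    omega
  have e2 : nb * (2 * B) = 2 * N := by rw [Nat.mul_left_comm, S.N_eq]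
  have e4 : (Nat.log 2 nb + 1) * (4 * nb) = 4 * ((Nat.log 2 nb + 1) * nb) := Nat.mul_left_comm _ _ _
  refine Run.mono_time (T := (2 + (N + 1) * (maskBody.time + 8)) +
    ((2 + (N + 1) * (occBody.time + 8)) + ((5 + 1) +
    ((2 + (nb * (2 * B) + 1) * (nearBody.time + 8)) + ((6 + 1) +
    ((2 + ((Nat.log 2 nb + 1) * nb + 1) * (sparseBody.time + 8)) + ((8 + 1) +
    (2 + ((Nat.log 2 nb + 1) * (4 * nb) + 1) * (farBody.time + 8)))))))))
    ?_ (by rw [t1, t2, t3, t4, t5]; omega)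
  refine Run.seq hσ (maskLoop_run S hσ hb) fun σ2 hσ2 hf2 hm2 => ?_
  have hb2 := hb.frame hf2 rfl
  refine Run.seq hσ2 (occLoop_run S hσ2 hb2 ?_) fun σ3 hσ3 hf3 ho3 => ?_
  · intro i; rw [hf2.arr 8 rfl, h8]
  have hb3 := hb2.frame hf3 rfl
  refine Run.assign_seq (nb * (2 * B)) hσ3 (by simp [hb3.nb_eq, hb3.B_eq]; omega)
    (by simp [hb3.nb_eq, hb3.B_eq]) fun hσ4 => ?_
  refine Run.seq hσ4 (nearLoop_run S hσ4 (hb3.setVar 10 _ rfl) (by simp)) fun σ5 hσ5 hf5 hn5 => ?_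
  have hb5 := (hb3.setVar 10 _ rfl).frame hf5 rfl
  have hlg := hb5.lg_eq nb hnble
  refine Run.assign_seq ((Nat.log 2 nb + 1) * nb) hσ5 (by simp [hb5.nb_eq, hlg]; omega)
    (by simp [hb5.nb_eq, hlg]) fun hσ6 => ?_
  have hb6 := hb5.setVar 10 ((Nat.log 2 nb + 1) * nb) rfl
  refine Run.seq hσ6 (sparseLoop_run S hσ6 hb6 ?_ (by simp)) fun σ7 hσ7 hf7 hs7 => ?_
  · simpa [hf5.arr 9 rfl, hf3.arr 9 rfl] using hm2
  have hb7 := hb6.frame hf7 rfl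
  refine Run.assign_seq ((Nat.log 2 nb + 1) * (4 * nb)) hσ7
    (by simp [hb7.nb_eq, hb7.lg_eq nb hnble]; omega)
    (by simp [hb7.nb_eq, hb7.lg_eq nb hnble]) fun hσ8 => ?_
  have hb8 := hb7.setVar 10 ((Nat.log 2 nb + 1) * (4 * nb)) rfl
  have o8 : OccTable G r B nb E (σ7.arr 8) := by
    simpa [hf7.arr 8 rfl, hf5.arr 8 rfl] using ho3
  have n8 : NearTable G r B nb E (σ7.arr 11) := by simpa [hf7.arr 11 rfl] using hn5
  refine Run.mono (farLoop_run S hσ8 hb8 o8 n8 (by simp)) hσ8 le_rfl fun σ9 hσ9 hf9 h9 => ?_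
  refine ⟨S, hb8.frame hf9 rfl, ?_, ?_, ?_, ?_, h9⟩
  · simpa [hf9.arr 8 rfl] using o8
  · simpa [hf9.arr 9 rfl, hf7.arr 9 rfl, hf5.arr 9 rfl, hf3.arr 9 rfl] using hm2
  · simpa [hf9.arr 10 rfl] using hs7
  · simpa [hf9.arr 11 rfl] using n8

/-- The preprocessing of the tree. -/
def preprocessCode : Stmt := preprocessBase ;; preprocessTables

theorem preprocessCode_run (hG : G.IsTree) (r : Fin n) (hw : 1000 * (n + 1) ≤ 2 ^ w)
    (hσ : (treeInput G r).WF w) :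
    Run w preprocessCode (treeInput G r) (10000 * n)
      (fun σ' => ∃ B nb N E pos, Ready G r w B nb N E pos σ') := by
  refine Run.mono_time (Run.seq hσ (preprocessBase_run hG r hw hσ) (T₂ := 9000 * n) ?_) (by omega)
  rintro σ1 hσ1 hf1 ⟨B, nb, N, E, pos, S, hb1⟩
  refine Run.mono (preprocessTables_run S hσ1 hb1 ?_) hσ1 le_rfl
    fun σ' _ _ h => ⟨B, nb, N, E, pos, h⟩
  intro i
  rw [hf1.arr 8 rfl]
  simp [treeInput]

end KServer

/-! ### The stack pass over the sorted servers -/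

namespace KServer

open WordRAM

/-- Ranks `R` in base `k` and meeting depths `M` of a sequence of servers, in the order of a tour. -/
structure PassData (k : ℕ) (R : ℕ → ℕ) (M : ℕ → ℕ → ℕ) : Prop where
  self : ∀ i < k, M i i = R i / k
  le : ∀ j i, j ≤ i → i < k → M j i ≤ R i / k
  step : ∀ j i, j ≤ i → i + 1 < k → M j (i + 1) = min (M j i) (M i (i + 1))
  inj : ∀ i < k, ∀ j < k, R i = R j → i = j

/-- `P` is the least of `d` and the times at which servers of smaller rank to the left block the
server `t`. -/
structure PassOut (k : ℕ) (R : ℕ → ℕ) (M : ℕ → ℕ → ℕ) (d t P : ℕ) : Prop where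
  le : P ≤ d
  block : ∀ j < t, R j < R t → P ≤ R j / k - M j t
  attained : P = d ∨ ∃ j < t, R j < R t ∧ R j / k - M j t ≤ P

/-- The invariant of the pass with the stack `p 1, …, p s` before server `i`. -/
structure PassInv (k : ℕ) (R : ℕ → ℕ) (M : ℕ → ℕ → ℕ) (d i s : ℕ) (p SR SA SP out : ℕ → ℕ) :
    Prop where
  i_le : i ≤ k
  s_le : s ≤ i
  SR_zero : SR 0 = 0
  SA_zero : SA 0 = 0
  SP_zero : SP 0 = d
  p_lt : ∀ e, 1 ≤ e → e ≤ s → p e < i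
  p_mono : ∀ e f, 1 ≤ e → e < f → f ≤ s → p e < p f
  R_mono : ∀ e f, 1 ≤ e → e < f → f ≤ s → R (p e) < R (p f)
  SR_eq : ∀ e, 1 ≤ e → e ≤ s → SR e = R (p e)
  SA_eq : ∀ e, 1 ≤ e → e ≤ s → SA e = M (p e) (i - 1) + 1
  SP_le : ∀ e < s, SP e ≤ d ∧ ∀ f, 1 ≤ f → f ≤ e → SP e ≤ R (p f) / k - M (p f) (i - 1)
  SP_attained : ∀ e < s, SP e = d ∨ ∃ f, 1 ≤ f ∧ f ≤ e ∧ R (p f) / k - M (p f) (i - 1) ≤ SP e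
  cover : i < k → ∀ j < i, R j < R i →
    ∃ e, 1 ≤ e ∧ e ≤ s ∧ R (p e) ≤ R j ∧ M j i ≤ M (p e) i
  out_spec : ∀ t < i, PassOut k R M d t (out t)

variable {k d i s : ℕ} {R : ℕ → ℕ} {M : ℕ → ℕ → ℕ} {p SR SA SP out : ℕ → ℕ}

/-- The value `M j i` is a minimum over the gaps from `j` to `i`, so a later start has fewer
constraints. -/
theorem PassData.mono (D : PassData k R M) {j j' i : ℕ} (h : j ≤ j') (hi : j' ≤ i) (hk : i < k) :
    M j i ≤ M j' i := by
  induction i, hi using Nat.le_induction with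
  | base => rw [D.self j' hk]; exact D.le j j' h hk
  | succ i hi ih =>
    rw [D.step j i (by omega) hk, D.step j' i hi hk]
    exact min_le_min (ih (by omega)) le_rfl

theorem PassInv.init (hk : 0 < k) (h1 : SR 0 = 0) (h2 : SA 0 = 0) (h3 : SP 0 = d) :
    PassInv k R M d 0 0 p SR SA SP out :=
  ⟨by omega, le_rfl, h1, h2, h3, by omega, by omega, by omega, by omega, by omega, by omega,
    by omega, by omega, by omega⟩

/-- Only entries of rank below `R i` are needed to cover the servers that can block `i`. For later
servers, `i` itself is about to take over. The sentinel `SR 0 = 0` never triggers this case. -/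
theorem PassInv.pop_rank (h : PassInv k R M d i s p SR SA SP out) (hs : R i < SR s) :
    1 ≤ s ∧ PassInv k R M d i (s - 1) p SR SA SP out := by
  have hs1 : 1 ≤ s := by
    by_contra h0
    rw [show s = 0 by omega, h.SR_zero] at hs
    omega
  refine ⟨hs1, h.i_le, by have := h.s_le; omega, h.SR_zero, h.SA_zero, h.SP_zero,
    fun e h1 h2 => h.p_lt e h1 (by omega), fun e f h1 h2 h3 => h.p_mono e f h1 h2 (by omega),
    fun e f h1 h2 h3 => h.R_mono e f h1 h2 (by omega), fun e h1 h2 => h.SR_eq e h1 (by omega),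
    fun e h1 h2 => h.SA_eq e h1 (by omega), fun e h1 => h.SP_le e (by omega),
    fun e h1 => h.SP_attained e (by omega), fun hi j hj hR => ?_, h.out_spec⟩
  obtain ⟨e, h1, h2, h3, h4⟩ := h.cover hi j hj hR
  refine ⟨e, h1, ?_, h3, h4⟩
  by_contra hne
  rw [h.SR_eq s hs1 le_rfl] at hs
  rw [show e = s by omega] at h3
  omega

/-- If the gap before `i` is no deeper than the meeting depth of the entry below the top, that entry
meets `i` at least as deep as the top does. It also has smaller rank, so it makes the top
superfluous. The stored depths are shifted by one so that the sentinel `0` never triggers this case.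
-/
theorem PassInv.pop_gap (D : PassData k R M) (h : PassInv k R M d i s p SR SA SP out)
    (hs : M (i - 1) i < SA (s - 1)) : 1 ≤ s ∧ PassInv k R M d i (s - 1) p SR SA SP out := by
  have hs2 : 2 ≤ s := by
    by_contra h0
    rw [show s - 1 = 0 by omega, h.SA_zero] at hs
    omega
  have hsi := h.s_le
  refine ⟨by omega, h.i_le, by omega, h.SR_zero, h.SA_zero, h.SP_zero,
    fun e h1 h2 => h.p_lt e h1 (by omega), fun e f h1 h2 h3 => h.p_mono e f h1 h2 (by omega),
    fun e f h1 h2 h3 => h.R_mono e f h1 h2 (by omega), fun e h1 h2 => h.SR_eq e h1 (by omega),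
    fun e h1 h2 => h.SA_eq e h1 (by omega), fun e h1 => h.SP_le e (by omega),
    fun e h1 => h.SP_attained e (by omega), fun hi j hj hR => ?_, h.out_spec⟩
  obtain ⟨e, h1, h2, h3, h4⟩ := h.cover hi j hj hR
  by_cases he : e = s
  · subst he
    have h5 := h.R_mono (e - 1) e (by omega) (by omega) le_rfl
    have h6 := h.p_lt (e - 1) (by omega) (by omega)
    refine ⟨e - 1, by omega, le_rfl, by omega, ?_⟩
    rw [h.SA_eq _ (by omega) (by omega)] at hs
    have h7 := D.step (p (e - 1)) (i - 1) (by omega) (by omega)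
    rw [Nat.sub_add_cancel (by omega)] at h7
    have h8 := D.mono (show j ≤ i - 1 by omega) (by omega) hi
    rw [h7]
    exact le_min (by omega) h8
  · exact ⟨e, h1, by omega, h3, h4⟩

/-- When no pop applies, the gap before `i` is deeper than the meeting depths of all entries below
the top, so only the top needs refreshing. This is why its `SP` is left unspecified until now. The
refreshed prefix minimum is the answer for `i`. -/
theorem PassInv.push (D : PassData k R M) (h : PassInv k R M d i s p SR SA SP out) (hi : i < k)
    (hr : SR s ≤ R i) (hg : SA (s - 1) ≤ M (i - 1) i) {SR' SA' SP' out' : ℕ → ℕ}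
    (hSR : ∀ e, SR' e = if e = s + 1 then R i else SR e)
    (hSA : ∀ e, SA' e = if e = s + 1 then R i / k + 1 else
      if e = s ∧ 1 ≤ s then min (SA s) (M (i - 1) i + 1) else SA e)
    (hSP : ∀ e, SP' e = if e = s ∧ 1 ≤ s then
      min (SP (s - 1)) (SR s / k - (min (SA s) (M (i - 1) i + 1) - 1)) else SP e)
    (hout : ∀ t, out' t = if t = i then SP' s else out t) :
    PassInv k R M d (i + 1) (s + 1) (Function.update p (s + 1) i) SR' SA' SP' out' := by
  have hsi := h.s_le
  have hp : ∀ e, e ≤ s → Function.update p (s + 1) i e = p e := fun e he =>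
    Function.update_of_ne (by omega) _ _
  have hp' : Function.update p (s + 1) i (s + 1) = i := Function.update_self _ _ _
  have hstep : ∀ e, 1 ≤ e → e ≤ s → M (p e) i = min (M (p e) (i - 1)) (M (i - 1) i) := by
    intro e h1 h2
    have h3 := h.p_lt e h1 h2
    have := D.step (p e) (i - 1) (by omega) (by omega)
    rwa [Nat.sub_add_cancel (by omega)] at this
  have hkeep : ∀ e, 1 ≤ e → e < s → M (p e) i = M (p e) (i - 1) := by
    intro e h1 h2
    have h3 := h.p_lt (s - 1) (by omega) (by omega)
    have h4 : M (p e) (i - 1) ≤ M (p (s - 1)) (i - 1) := by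
      refine D.mono ?_ (by omega) (by omega)
      rcases Nat.lt_or_ge e (s - 1) with h5 | h5
      · exact (h.p_mono e (s - 1) h1 h5 (by omega)).le
      · rw [show e = s - 1 by omega]
    rw [h.SA_eq (s - 1) (by omega) (by omega)] at hg
    rw [hstep e h1 h2.le]
    omega
  have hRlt : ∀ e, 1 ≤ e → e ≤ s → R (p e) < R i := by
    intro e h1 h2
    rw [h.SR_eq s (by omega) le_rfl] at hr
    have h3 := h.p_lt s (by omega) le_rfl
    have h4 : R (p s) ≠ R i := fun e' => by
      have := D.inj _ (by omega) _ hi e'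
      omega
    rcases Nat.lt_or_ge e s with h5 | h5
    · have := h.R_mono e s h1 h5 le_rfl; omega
    · rw [show e = s by omega]; omega
  have hSAs : 1 ≤ s → min (SA s) (M (i - 1) i + 1) = M (p s) i + 1 := by
    intro h1
    rw [h.SA_eq s h1 le_rfl, hstep s h1 le_rfl]; omega
  have SPle : ∀ e ≤ s, SP' e ≤ d ∧ ∀ f, 1 ≤ f → f ≤ e → SP' e ≤ R (p f) / k - M (p f) i := by
    intro e he
    rw [hSP]
    by_cases hes : e = s ∧ 1 ≤ s
    · obtain ⟨rfl, h1⟩ := hes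
      have h2 := h.SP_le (e - 1) (by omega)
      rw [if_pos ⟨rfl, h1⟩, hSAs h1, h.SR_eq e h1 le_rfl]
      refine ⟨by omega, fun f h3 h4 => ?_⟩
      rcases Nat.lt_or_ge f e with h5 | h5
      · have h6 := h2.2 f h3 (by omega)
        rw [hkeep f h3 h5]
        omega
      · rw [show f = e by omega]; omega
    · rw [if_neg hes]
      rcases Nat.lt_or_ge e s with h5 | h5
      · refine ⟨(h.SP_le e h5).1, fun f h3 h4 => ?_⟩
        rw [hkeep f h3 (by omega)]
        exact (h.SP_le e h5).2 f h3 h4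
      · rw [show e = 0 by omega, h.SP_zero]
        exact ⟨le_rfl, fun f h3 h4 => by omega⟩
  have SPat : ∀ e ≤ s, SP' e = d ∨ ∃ f, 1 ≤ f ∧ f ≤ e ∧ R (p f) / k - M (p f) i ≤ SP' e := by
    intro e he
    rw [hSP]
    by_cases hes : e = s ∧ 1 ≤ s
    · obtain ⟨rfl, h1⟩ := hes
      rw [if_pos ⟨rfl, h1⟩, hSAs h1, h.SR_eq e h1 le_rfl]
      by_cases hle : R (p e) / k - M (p e) i ≤ SP (e - 1)
      · exact Or.inr ⟨e, h1, le_rfl, by omega⟩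
      · rcases h.SP_attained (e - 1) (by omega) with h2 | ⟨f, h2, h3, h4⟩
        · left; omega
        · refine Or.inr ⟨f, h2, by omega, ?_⟩
          rw [hkeep f h2 (by omega)]; omega
    · rw [if_neg hes]
      rcases Nat.lt_or_ge e s with h5 | h5
      · rcases h.SP_attained e h5 with h2 | ⟨f, h2, h3, h4⟩
        · exact Or.inl h2
        · refine Or.inr ⟨f, h2, h3, ?_⟩
          rw [hkeep f h2 (by omega)]; exact h4
      · rw [show e = 0 by omega, h.SP_zero]; exact Or.inl rfl
  refine ⟨hi, by omega, ?_, ?_, ?_, ?_, ?_, ?_, ?_, ?_, ?_, ?_, ?_, ?_⟩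
  · rw [hSR, if_neg (by omega), h.SR_zero]
  · rw [hSA, if_neg (by omega), if_neg (by omega), h.SA_zero]
  · rw [hSP, if_neg (by omega), h.SP_zero]
  · intro e h1 h2
    rcases Nat.lt_or_ge s e with h3 | h3
    · rw [show e = s + 1 by omega, hp']; omega
    · rw [hp e h3]; have := h.p_lt e h1 h3; omega
  · intro e f h1 h2 h3
    rw [hp e (by omega)]
    rcases Nat.lt_or_ge s f with h4 | h4
    · rw [show f = s + 1 by omega, hp']; exact h.p_lt e h1 (by omega)
    · rw [hp f h4]; exact h.p_mono e f h1 h2 h4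
  · intro e f h1 h2 h3
    rw [hp e (by omega)]
    rcases Nat.lt_or_ge s f with h4 | h4
    · rw [show f = s + 1 by omega, hp']; exact hRlt e h1 (by omega)
    · rw [hp f h4]; exact h.R_mono e f h1 h2 h4
  · intro e h1 h2
    rcases Nat.lt_or_ge s e with h3 | h3
    · rw [show e = s + 1 by omega, hp', hSR, if_pos rfl]
    · rw [hp e h3, hSR, if_neg (by omega), h.SR_eq e h1 h3]
  · intro e h1 h2
    rw [Nat.add_sub_cancel]
    rcases Nat.lt_or_ge s e with h3 | h3
    · rw [show e = s + 1 by omega, hp', hSA, if_pos rfl, D.self i hi]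
    · rw [hp e h3, hSA, if_neg (by omega)]
      by_cases hes : e = s
      · subst hes; rw [if_pos ⟨rfl, h1⟩, hSAs h1]
      · rw [if_neg (by omega), h.SA_eq e h1 h3, hkeep e h1 (by omega)]
  · intro e h1
    rw [Nat.add_sub_cancel]
    refine ⟨(SPle e (by omega)).1, fun f h2 h3 => ?_⟩
    rw [hp f (by omega)]
    exact (SPle e (by omega)).2 f h2 h3
  · intro e h1
    rw [Nat.add_sub_cancel]
    refine (SPat e (by omega)).imp_right ?_
    rintro ⟨f, h2, h3, h4⟩
    exact ⟨f, h2, h3, by rwa [hp f (by omega)]⟩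
  -- Servers of rank below `R i` are covered by the old entries, all others by `i`, which has no
  -- larger rank and is no earlier in the order.
  · intro hi1 j hj hR
    by_cases hRj : R j < R i
    · have hji : j < i := by
        rcases Nat.lt_or_ge j i with h1 | h1
        · exact h1
        · rw [show j = i by omega] at hRj; omega
      obtain ⟨e, h1, h2, h3, h4⟩ := h.cover hi j hji hRj
      have h5 := h.p_lt e h1 h2
      refine ⟨e, h1, by omega, by rwa [hp e h2], ?_⟩
      rw [hp e h2, D.step j i (by omega) hi1, D.step (p e) i (by omega) hi1]
      exact min_le_min h4 le_rfl
    · exact ⟨s + 1, by omega, le_rfl, by rw [hp']; omega, by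
        rw [hp']; exact D.mono (by omega) (by omega) hi1⟩
  · intro t ht
    rw [hout]
    by_cases hti : t = i
    · subst hti
      rw [if_pos rfl]
      obtain ⟨a1, a2⟩ := SPle s le_rfl
      refine ⟨a1, fun j hj hR => ?_, ?_⟩
      · obtain ⟨e, h1, h2, h3, h4⟩ := h.cover hi j hj hR
        have h5 := a2 e h1 h2
        have h6 : R (p e) / k ≤ R j / k := Nat.div_le_div_right h3
        omega
      · refine (SPat s le_rfl).imp_right ?_
        rintro ⟨f, h2, h3, h4⟩
        exact ⟨p f, h.p_lt f h2 h3, hRlt f h2 h3, h4⟩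
    · rw [if_neg hti]
      exact h.out_spec t (by omega)

/-- One step of the pass over the servers in the order of the tour. Register `53` has the next
server, register `54` the height of the stack in arrays `20`, `21`, `22`. -/
def passBody : Stmt :=
  55 ≔ .get 17 (.var 53) ;;
  56 ≔ .get 18 (.var 53) ;;
  .ite ((Expr.var 55).lt (.get 20 (.var 54))) (54 ≔ .var 54 - ♯1)
    (.ite ((Expr.var 56).lt (.get 21 (.var 54 - ♯1))) (54 ≔ .var 54 - ♯1)
      (.ite (.var 54)
        (57 ≔ .get 21 (.var 54) - (.get 21 (.var 54) - (.var 56 + ♯1)) ;;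
          .store 21 (.var 54) (.var 57) ;;
          58 ≔ .get 20 (.var 54) / .var 2 - (.var 57 - ♯1) ;;
          59 ≔ .get 22 (.var 54 - ♯1) ;;
          .store 22 (.var 54) (.var 59 - (.var 59 - .var 58)))
        Stmt.skip ;;
      .store 19 (.var 53) (.get 22 (.var 54)) ;;
      54 ≔ .var 54 + ♯1 ;;
      .store 20 (.var 54) (.var 55) ;;
      .store 21 (.var 54) (.var 55 / .var 2 + ♯1) ;;
      53 ≔ .var 53 + ♯1))

/-- The pass over the servers; register `52` has the distance of the first server. -/
def passCode : Stmt :=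
  53 ≔ ♯0 ;;
  54 ≔ ♯0 ;;
  .store 20 ♯0 ♯0 ;;
  .store 21 ♯0 ♯0 ;;
  .store 22 ♯0 (.var 52) ;;
  .loop ((Expr.var 53).lt (.var 2)) passBody

/-- A round either pops an entry or advances `i` and pushes one, so `2 * (k - i) + s` drops each
time and the pass takes at most `2 * k` rounds. -/
theorem passCode_run {w : ℕ} {σ : State} (D : PassData k R M) (hσ : σ.WF w) (hw : 1 < w)
    (hk : 0 < k) (hkw : k + 1 < 2 ^ w) (hR : ∀ t < k, R t / k + 1 < 2 ^ w) (h2 : σ.var 2 = k)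
    (h52 : σ.var 52 = d) (h17 : ∀ t < k, σ.arr 17 t = R t)
    (h18 : ∀ t < k, 1 ≤ t → σ.arr 18 t = M (t - 1) t) :
    Run w passCode σ (13 + (2 * k + 1) * (passBody.time + 4))
      (fun σ' => ∀ t < k, PassOut k R M d t (σ'.arr 19 t)) := by
  refine Run.mono_time (T := (1 + 1) + ((1 + 1) + ((1 + 1 + 1) + ((1 + 1 + 1) + ((1 + 1 + 1) +
    (2 * k + 0 + 1) * (passBody.time + 4)))))) ?_ (by rw [Nat.add_zero (2 * k)]; omega)
  refine Run.assign_seq 0 hσ (by simp) (by simp) fun hσ1 => ?_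
  refine Run.assign_seq 0 hσ1 (by simp) (by simp) fun hσ2 => ?_
  refine Run.seq hσ2 (P := fun σ' => σ' = _)
    (Run.of_wp hσ2 (Stmt.wp_store_of 0 0 (by simp) (by simp) (by simp) (by simp) rfl)) ?_
  rintro σ3 hσ3 - rfl
  refine Run.seq hσ3 (P := fun σ' => σ' = _)
    (Run.of_wp hσ3 (Stmt.wp_store_of 0 0 (by simp) (by simp) (by simp) (by simp) rfl)) ?_
  rintro σ4 hσ4 - rfl
  refine Run.seq hσ4 (P := fun σ' => σ' = _)
    (Run.of_wp hσ4 (Stmt.wp_store_of 0 d (by simp) (by simp) (by simp) (by simp [h52]) rfl)) ?_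
  rintro σ5 hσ5 - rfl
  generalize hτ : ((((σ.setVar 53 0).setVar 54 0).setArr 20 0 0).setArr 21 0 0).setArr 22 0 d = τ at hσ5 ⊢
  have v2 : τ.var 2 = k := by subst hτ; simp [h2]
  have v53 : τ.var 53 = 0 := by subst hτ; simp
  have v54 : τ.var 54 = 0 := by subst hτ; simp
  have a17 : τ.arr 17 = σ.arr 17 := by subst hτ; funext i; simp
  have a18 : τ.arr 18 = σ.arr 18 := by subst hτ; funext i; simp
  have hinit : PassInv k R M d 0 0 id (τ.arr 20) (τ.arr 21) (τ.arr 22) (τ.arr 19) :=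
    PassInv.init hk (by subst hτ; simp) (by subst hτ; simp) (by subst hτ; simp)
  clear hτ hσ1 hσ2 hσ3 hσ4
  rw [← a17] at h17
  rw [← a18] at h18
  have hμ : 2 * (k - τ.var 53) + τ.var 54 = 2 * k + 0 := by rw [v53, v54]; rfl
  rw [← hμ]
  refine (Run.loop (fun σ' => ∃ p, PassInv k R M d (σ'.var 53) (σ'.var 54) p (σ'.arr 20) (σ'.arr 21)
    (σ'.arr 22) (σ'.arr 19)) (fun σ' => 2 * (k - σ'.var 53) + σ'.var 54) passBody.time hσ5
    ⟨id, by rwa [v53, v54]⟩ (fun _ _ _ => by simp) ?_).mono hσ5 le_rfl ?_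
  · rintro σ6 hσ6 hf ⟨p, h⟩ hc
    simp [hf.var 2 rfl, v2] at hc
    have b17 := h17 _ hc
    have b18 := h18 _ hc
    rw [← hf.arr 17 rfl] at b17
    rw [← hf.arr 18 rfl] at b18
    have w2 := (hf.var 2 rfl).trans v2
    generalize hi : σ6.var 53 = i at *
    generalize hs : σ6.var 54 = s at *
    have hsi := h.s_le
    have hRi := hR i hc
    apply Run.of_wp hσ6
    refine Stmt.wp_assign_seq (R i) (by simp) (by simp [hi, b17]) ?_
    refine Stmt.wp_assign_seq (σ6.arr 18 i) (by simp) (by simp [hi]) ?_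
    refine (Stmt.wp_ite _ _ _ _ _ _).2 ⟨by simp, fun h1 => ?_, fun h1 => ?_⟩
    · simp [hs] at h1
      obtain ⟨c1, c2⟩ := h.pop_rank h1
      refine Stmt.wp_assign_of (s - 1) (by simp; omega) (by simp [hs]) ⟨⟨p, ?_⟩, ?_⟩
      · simpa [hi] using c2
      · simp [hi]; omega
    simp [hs] at h1
    refine (Stmt.wp_ite _ _ _ _ _ _).2 ⟨by simp; omega, fun h3 => ?_, fun h3 => ?_⟩
    · simp [hs] at h3
      have hs1 : 1 ≤ s := by
        by_contra h0
        rw [show s - 1 = 0 by omega, h.SA_zero] at h3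
        omega
      rw [b18 (by omega)] at h3
      obtain ⟨c1, c2⟩ := h.pop_gap D h3
      refine Stmt.wp_assign_of (s - 1) (by simp; omega) (by simp [hs]) ⟨⟨p, ?_⟩, ?_⟩
      · simpa [hi] using c2
      · simp [hi]; omega
    simp [hs] at h3
    have hg : σ6.arr 21 (s - 1) ≤ M (i - 1) i := by
      by_cases h0 : s = 0
      · rw [show s - 1 = 0 by omega, h.SA_zero]; exact Nat.zero_le _
      · rw [← b18 (by omega)]; exact h3
    have fin : ∀ (τ' : State) (SA' SP' : ℕ → ℕ),
        (∀ e, SA' e = if e = s ∧ 1 ≤ s then min (σ6.arr 21 s) (M (i - 1) i + 1) else σ6.arr 21 e) →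
        (∀ e, SP' e = if e = s ∧ 1 ≤ s then min (σ6.arr 22 (s - 1))
          (σ6.arr 20 s / k - (min (σ6.arr 21 s) (M (i - 1) i + 1) - 1)) else σ6.arr 22 e) →
        τ'.arr 20 = σ6.arr 20 → τ'.arr 21 = SA' → τ'.arr 22 = SP' → τ'.arr 19 = σ6.arr 19 →
        τ'.var 53 = i → τ'.var 54 = s → τ'.var 55 = R i → τ'.var 2 = k →
        (Stmt.store 19 (.var 53) (.get 22 (.var 54)) ;;
          54 ≔ .var 54 + ♯1 ;;
          .store 20 (.var 54) (.var 55) ;;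
          .store 21 (.var 54) (.var 55 / .var 2 + ♯1) ;;
          53 ≔ .var 53 + ♯1).wp w (fun σ'' => (∃ p, PassInv k R M d (σ''.var 53) (σ''.var 54) p
            (σ''.arr 20) (σ''.arr 21) (σ''.arr 22) (σ''.arr 19)) ∧
            2 * (k - σ''.var 53) + σ''.var 54 < 2 * (k - i) + s) τ' := by
      intro τ' SA' SP' hSA hSP e20 e21 e22 e19 e53 e54 e55 e2
      refine Stmt.wp_store_seq i (SP' s) (by simp) (by simp [e53]) (by simp) (by simp [e54, e22]) ?_
      refine Stmt.wp_assign_seq (s + 1) (by simp [e54]; omega) (by simp [e54]) ?_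
      refine Stmt.wp_store_seq (s + 1) (R i) (by simp) (by simp) (by simp) (by simp [e55]) ?_
      refine Stmt.wp_store_seq (s + 1) (R i / k + 1) (by simp) (by simp)
        (by simp [e55, e2]; omega) (by simp [e55, e2]) ?_
      have hQ : ∀ τ'' : State, τ''.var 53 = i + 1 → τ''.var 54 = s + 1 →
          (∀ e, τ''.arr 20 e = if e = s + 1 then R i else σ6.arr 20 e) →
          (∀ e, τ''.arr 21 e = if e = s + 1 then R i / k + 1 else
            if e = s ∧ 1 ≤ s then min (σ6.arr 21 s) (M (i - 1) i + 1) else σ6.arr 21 e) →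
          (∀ e, τ''.arr 22 e = SP' e) → (∀ t, τ''.arr 19 t = if t = i then SP' s else σ6.arr 19 t) →
          (∃ p, PassInv k R M d (τ''.var 53) (τ''.var 54) p (τ''.arr 20) (τ''.arr 21)
            (τ''.arr 22) (τ''.arr 19)) ∧ 2 * (k - τ''.var 53) + τ''.var 54 < 2 * (k - i) + s := by
        intro τ'' q53 q54 q20 q21 q22 q19
        rw [q53, q54]
        refine ⟨⟨_, h.push D hc h1 hg q20 q21 (fun e => by rw [q22, hSP]) ?_⟩, by omega⟩
        intro t
        rw [q19, q22]
      refine Stmt.wp_assign_of (i + 1) (by simp [e53]; omega) (by simp [e53]) (hQ _ ?_ ?_ ?_ ?_ ?_ ?_)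
      · simp
      · simp
      · simp [e20]
      · simp [e21, hSA]
      · simp [e22]
      · simp [e19]
    rw [Stmt.wp_seq]
    refine (Stmt.wp_ite _ _ _ _ _ _).2 ⟨by simp, fun h4 => ?_, fun h4 => ?_⟩
    · simp [hs] at h4
      have c18 := b18 (by omega)
      have hMi : M (i - 1) i ≤ R i / k := D.le _ _ (by omega) hc
      refine Stmt.wp_assign_seq (min (σ6.arr 21 s) (M (i - 1) i + 1)) (by simp [c18]; omega)
        (by simp [c18, hs]; omega) ?_
      refine Stmt.wp_store_seq s (min (σ6.arr 21 s) (M (i - 1) i + 1)) (by simp) (by simp [hs])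
        (by simp) (by simp) ?_
      refine Stmt.wp_assign_seq (σ6.arr 20 s / k - (min (σ6.arr 21 s) (M (i - 1) i + 1) - 1))
        (by simp; omega) (by simp [hs, w2]) ?_
      refine Stmt.wp_assign_seq (σ6.arr 22 (s - 1)) (by simp; omega) (by simp [hs]) ?_
      refine Stmt.wp_store_of s (min (σ6.arr 22 (s - 1))
        (σ6.arr 20 s / k - (min (σ6.arr 21 s) (M (i - 1) i + 1) - 1))) (by simp) (by simp [hs])
        (by simp) (by simp; omega) ?_
      refine fin _ _ _ (fun e => ?_) (fun e => ?_) ?_ rfl rfl ?_ (by simp [hi]) (by simp [hs])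
        (by simp) (by simp [w2])
      · by_cases hes : e = s
        · simp [hes, h4, Nat.one_le_iff_ne_zero]
        · simp [hes]
      · by_cases hes : e = s
        · simp [hes, h4, Nat.one_le_iff_ne_zero]
        · simp [hes]
      · funext e; simp
      · funext e; simp
    · simp [hs] at h4
      refine fin _ _ _ (fun e => ?_) (fun e => ?_) rfl rfl rfl rfl (by simp [hi]) (by simp [hs])
        (by simp) (by simp [w2])
      · rw [if_neg (by omega)]; rfl
      · rw [if_neg (by omega)]; rfl
  · rintro σ6 hσ6 hf ⟨⟨p, h⟩, hc⟩
    simp [hf.var 2 rfl, v2] at hc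
    intro t ht
    exact h.out_spec t (by omega)

end KServer

/-! ### Sorting with a tournament tree -/

namespace KServer

open WordRAM

/-- Every inner node of the tournament tree holds the least value of its two children. -/
def TreeInv (k : ℕ) (f : ℕ → ℕ) : Prop :=
  ∀ y, 1 ≤ y → y < k → f y = min (f (2 * y)) (f (2 * y + 1))

variable {k N w : ℕ} {f : ℕ → ℕ} {σ : State}

theorem TreeInv.root_le (h : TreeInv k f) {x : ℕ} (h1 : 1 ≤ x) (h2 : x < 2 * k) : f 1 ≤ f x := by
  induction x using Nat.strong_induction_on with
  | _ x ih =>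
    rcases Nat.lt_or_ge 1 x with hx | hx
    · refine (ih (x / 2) (by omega) (by omega) (by omega)).trans ?_
      rw [h (x / 2) (by omega) (by omega)]
      rcases Nat.mod_two_eq_zero_or_one x with h3 | h3
      · rw [show 2 * (x / 2) = x by omega]; exact min_le_left _ _
      · rw [show 2 * (x / 2) + 1 = x by omega]; exact min_le_right _ _
    · rw [show x = 1 by omega]

theorem TreeInv.exists_leaf (h : TreeInv k f) {x : ℕ} (h1 : 1 ≤ x) (h2 : x < 2 * k) :
    ∃ i < k, f (k + i) = f x := by
  by_cases hx : x < k
  · rcases le_total (f (2 * x)) (f (2 * x + 1)) with h3 | h3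
    · obtain ⟨i, hi, e⟩ := h.exists_leaf (x := 2 * x) (by omega) (by omega)
      exact ⟨i, hi, by rw [e, h x h1 hx, min_eq_left h3]⟩
    · obtain ⟨i, hi, e⟩ := h.exists_leaf (x := 2 * x + 1) (by omega) (by omega)
      exact ⟨i, hi, by rw [e, h x h1 hx, min_eq_right h3]⟩
  · exact ⟨x - k, by omega, by rw [Nat.add_sub_cancel' (by omega)]⟩
termination_by 2 * k - x

theorem _root_.WordRAM.Expr.val_lt_eq_zero (σ : State) (a b : Expr) :
    (a.lt b).val σ = 0 ↔ b.val σ ≤ a.val σ := by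
  rw [Expr.val_lt_eq]
  split <;> omega

/-- Replace the value of the leaf in register `60` by the one in register `61`. -/
def treeUpdate : Stmt :=
  .store 15 (.var 60) (.var 61) ;;
  .loop ((♯1).lt (.var 60))
    (60 ≔ .var 60 / ♯2 ;;
      62 ≔ .get 15 (♯2 * .var 60) ;;
      63 ≔ .get 15 (♯2 * .var 60 + ♯1) ;;
      .store 15 (.var 60) (.var 62 - (.var 62 - .var 63)))

/-- While the update climbs, the equation may fail only at the parent of the current node. When the
current node is `1`, this parent is `0`, which is no node of the tree. The number `k` of leaves need
not be a power of two. -/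
theorem treeUpdate_run {x v : ℕ} (hσ : σ.WF w) (hw : 1 < w) (hkw : 2 * k < 2 ^ w) (hx : k ≤ x)
    (hxk : x < 2 * k) (hf : TreeInv k (σ.arr 15)) (h60 : σ.var 60 = x) (h61 : σ.var 61 = v) :
    Run w treeUpdate σ (3 + (Nat.log 2 k + 2) * 29) (fun σ' => TreeInv k (σ'.arr 15) ∧
      ∀ y, k ≤ y → σ'.arr 15 y = if y = x then v else σ.arr 15 y) := by
  refine Run.seq hσ (T₁ := 3) (P := fun σ' => σ' = σ.setArr 15 x v)
    (Run.of_wp hσ (Stmt.wp_store_of x v (by simp) (by simp [h60]) (by simp) (by simp [h61]) rfl)) ?_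
  rintro σ1 hσ1 - rfl
  refine (Run.loop (fun σ' => 1 ≤ σ'.var 60 ∧ σ'.var 60 < 2 * k ∧
    (∀ y, 1 ≤ y → y < k → y ≠ σ'.var 60 / 2 →
      σ'.arr 15 y = min (σ'.arr 15 (2 * y)) (σ'.arr 15 (2 * y + 1))) ∧
    ∀ y, k ≤ y → σ'.arr 15 y = if y = x then v else σ.arr 15 y) (fun σ' => Nat.log 2 (σ'.var 60)) 25
    hσ1 ?_ (fun _ _ _ => by simp; omega) ?_).mono hσ1 ?_ ?_
  · refine ⟨by simp [h60]; omega, by simp [h60]; omega, fun y h1 h2 h3 => ?_, fun y hy => by simp⟩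
    simp [h60] at h3
    have e1 : y ≠ x := by omega
    have e2 : 2 * y ≠ x := by omega
    have e3 : 2 * y + 1 ≠ x := by omega
    simpa [e1, e2, e3] using hf y h1 h2
  · rintro σ2 hσ2 - ⟨a1, a2, a3, a4⟩ hc
    rw [ne_eq, Expr.val_lt_eq_zero, not_le, Expr.val_const, Expr.val_var] at hc
    obtain ⟨z, hz⟩ : ∃ z, σ2.var 60 = z := ⟨_, rfl⟩
    simp only [hz] at a1 a2 a3 hc ⊢
    refine Run.mono_time (Run.of_wp hσ2 ?_) (T := _) (T' := 25) (by decide)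
    refine Stmt.wp_assign_seq (z / 2) (by simp; omega) (by simp [hz]) ?_
    refine Stmt.wp_assign_seq (σ2.arr 15 (2 * (z / 2))) (by simp; omega) (by simp) ?_
    refine Stmt.wp_assign_seq (σ2.arr 15 (2 * (z / 2) + 1)) (by simp; omega) (by simp) ?_
    refine Stmt.wp_store_of (z / 2) (min (σ2.arr 15 (2 * (z / 2))) (σ2.arr 15 (2 * (z / 2) + 1)))
      (by simp) (by simp) (by simp) (by simp; omega) ?_
    refine ⟨⟨by simp; omega, by simp; omega, fun y h1 h2 h3 => ?_, fun y hy => ?_⟩, ?_⟩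
    · simp at h3
      have e2 : 2 * y ≠ z / 2 := by omega
      have e3 : 2 * y + 1 ≠ z / 2 := by omega
      by_cases hyz : y = z / 2
      · subst hyz
        simp [e2, e3]
      · simpa [hyz, e2, e3] using a3 y h1 h2 hyz
    · have : y ≠ z / 2 := by omega
      simpa [this] using a4 y hy
    · have := Nat.log_of_one_lt_of_le (b := 2) (n := z) (by norm_num) (by omega)
      simp; omega
  · have h1 : Nat.log 2 x ≤ Nat.log 2 k + 1 := by
      rw [← Nat.log_mul_base (b := 2) (by norm_num) (by omega)]
      exact Nat.log_mono_right (by omega)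
    have h2 : (σ.setArr 15 x v).var 60 = x := h60
    rw [h2]
    exact Nat.mul_le_mul (by omega) (by decide)
  · rintro σ2 - - ⟨⟨a1, a2, a3, a4⟩, hc⟩
    rw [Expr.val_lt_eq_zero, Expr.val_const, Expr.val_var] at hc
    exact ⟨fun y h1 h2 => a3 y h1 h2 (by omega), a4⟩

/-- The array `o` lists `0, …, k - 1` in an order in which `a` increases. -/
structure SortedBy (k : ℕ) (a o : ℕ → ℕ) : Prop where
  lt : ∀ t < k, o t < k
  le : ∀ s t, s ≤ t → t < k → a (o s) ≤ a (o t)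
  inj : ∀ s < k, ∀ t < k, o s = o t → s = t
  surj : ∀ i < k, ∃ t < k, o t = i

/-- Extract the least key of the tournament tree. -/
def extractBody : Stmt :=
  65 ≔ .get 15 ♯1 % .var 2 ;;
  .store 16 (.var 50) (.var 65) ;;
  60 ≔ .var 2 + .var 65 ;;
  61 ≔ .var 64 ;;
  treeUpdate

/-- The keys `a i * k + i` are distinct and reveal the index modulo `k`. An extracted leaf gets the
value `N * k`, which exceeds every key. -/
theorem extractLoop_run {a : ℕ → ℕ} (hσ : σ.WF w) (hw : 1 < w) (hk : 0 < k)
    (hkw : 2 * k < 2 ^ w) (h2 : σ.var 2 = k) (h64 : σ.var 64 = N * k) (ha : ∀ i < k, a i < N)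
    (hf : TreeInv k (σ.arr 15)) (h15 : ∀ i < k, σ.arr 15 (k + i) = a i * k + i) :
    Run w (.for 50 2 extractBody) σ (2 + (k + 1) * (19 + (Nat.log 2 k + 2) * 29 + 8))
      (fun σ' => SortedBy k a (σ'.arr 16)) := by
  have hkey : ∀ i < k, a i * k + i < N * k := fun i hi => index_lt (ha i hi) hi
  refine (Run.for (N := k) (fun t σ' => TreeInv k (σ'.arr 15) ∧ (∀ s < t, σ'.arr 16 s < k) ∧
    (∀ i < k, σ'.arr 15 (k + i) = N * k ∧ (∃ s < t, σ'.arr 16 s = i) ∨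
      σ'.arr 15 (k + i) = a i * k + i ∧ ¬ ∃ s < t, σ'.arr 16 s = i) ∧
    (∀ s t', s < t' → t' < t → a (σ'.arr 16 s) * k + σ'.arr 16 s <
      a (σ'.arr 16 t') * k + σ'.arr 16 t') ∧
    ∀ s < t, ∀ i < k, σ'.arr 15 (k + i) < N * k →
      a (σ'.arr 16 s) * k + σ'.arr 16 s < a i * k + i) _ hσ rfl rfl rfl h2 ?_ ?_).mono hσ le_rfl ?_
  · exact ⟨by simpa using hf, by simp, fun i hi => Or.inr (by simp [h15 i hi]), by simp, by simp⟩
  · rintro t ht σ1 hσ1 hfr hvar ⟨J0, J1, J2, J3, J4⟩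
    have w2 := (hfr.var 2 rfl).trans h2
    have w64 := (hfr.var 64 rfl).trans h64
    -- Fewer than `k` leaves have been extracted, so a key is left and the root holds a key rather
    -- than `N * k`.
    obtain ⟨i₁, hi₁, hn₁⟩ : ∃ i < k, ¬ ∃ s < t, σ1.arr 16 s = i := by
      by_contra hall
      push Not at hall
      have h1 : Finset.range k ⊆ (Finset.range t).image (σ1.arr 16) := by
        intro i hi
        obtain ⟨s, hs, e⟩ := hall i (Finset.mem_range.1 hi)
        exact Finset.mem_image.2 ⟨s, Finset.mem_range.2 hs, e⟩
      have h2 := (Finset.card_le_card h1).trans Finset.card_image_le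
      rw [Finset.card_range, Finset.card_range] at h2
      omega
    have hroot := J0.root_le (x := k + i₁) (by omega) (by omega)
    obtain ⟨i, hi, hleaf⟩ := J0.exists_leaf (x := 1) le_rfl (by omega)
    have hlt : σ1.arr 15 (k + i) < N * k := by
      rcases J2 i₁ hi₁ with h | h
      · exact absurd h.2 hn₁
      · have := hkey i₁ hi₁; omega
    obtain ⟨e15, hn⟩ : σ1.arr 15 (k + i) = a i * k + i ∧ ¬ ∃ s < t, σ1.arr 16 s = i := by
      rcases J2 i hi with h | h
      · omega
      · exact h
    have hmod : σ1.arr 15 1 % k = i := by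
      rw [← hleaf, e15, Nat.mul_comm, Nat.mul_add_mod, Nat.mod_eq_of_lt hi]
    refine Run.mono_time (T := (4 + 1) + ((1 + 1 + 1) + ((3 + 1) + ((1 + 1) +
      (3 + (Nat.log 2 k + 2) * 29))))) ?_ (by omega)
    refine Run.assign_seq i hσ1 (by simp; omega) (by simp [w2, hmod]) fun hσ2 => ?_
    refine Run.seq hσ2 (P := fun σ' => σ' = _) (Run.of_wp hσ2 (Stmt.wp_store_of t i (by simp)
      (by simp [hvar]) (by simp) (by simp) rfl)) ?_
    rintro σ3 hσ3 - rfl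
    refine Run.assign_seq (k + i) hσ3 (by simp [w2]; omega) (by simp [w2]) fun hσ4 => ?_
    refine Run.assign_seq (N * k) hσ4 (by simp) (by simp [w64]) fun hσ5 => ?_
    refine (treeUpdate_run (x := k + i) (v := N * k) hσ5 hw hkw (by omega) (by omega)
      (fun y h1 h2 => by simpa using J0 y h1 h2) rfl rfl).mono hσ5 le_rfl ?_
    rintro σ6 hσ6 hf6 ⟨K0, K1⟩
    have q15 : ∀ j < k, σ6.arr 15 (k + j) = if j = i then N * k else σ1.arr 15 (k + j) := by
      intro j hj
      rw [K1 _ (by omega)]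
      simp
    have q16 : ∀ s, σ6.arr 16 s = if s = t then i else σ1.arr 16 s := by
      intro s
      rw [hf6.arr 16 rfl]
      simp
    simp only [State.setVar_arr]
    refine ⟨K0, fun s hs => ?_, fun j hj => ?_, fun s t' hst ht' => ?_, fun s hs j hj hlt' => ?_⟩
    · rw [q16]; split
      · exact hi
      · exact J1 s (by omega)
    · rw [q15 j hj]
      by_cases hji : j = i
      · subst hji
        exact Or.inl ⟨if_pos rfl, t, by omega, by rw [q16, if_pos rfl]⟩
      · rw [if_neg hji]
        refine (J2 j hj).imp (And.imp_right ?_) (And.imp_right ?_)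
        · rintro ⟨s, hs, e⟩
          exact ⟨s, by omega, by rw [q16, if_neg (by omega)]; exact e⟩
        · rintro h ⟨s, hs, e⟩
          rw [q16] at e
          split at e
          · exact hji e.symm
          · exact h ⟨s, by omega, e⟩
    · rw [q16 s, q16 t', if_neg (by omega)]
      by_cases htt : t' = t
      · rw [if_pos htt]
        exact J4 s (by omega) i hi hlt
      · rw [if_neg htt]
        exact J3 s t' hst (by omega)
    · rw [q15 j hj] at hlt'
      have hji : j ≠ i := by rintro rfl; rw [if_pos rfl] at hlt'; exact lt_irrefl _ hlt'
      rw [if_neg hji] at hlt'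
      rw [q16]
      by_cases hst : s = t
      · rw [if_pos hst]
        have h1 := J0.root_le (x := k + j) (by omega) (by omega)
        have h2 : σ1.arr 15 (k + j) = a j * k + j := by
          rcases J2 j hj with h | h
          · omega
          · exact h.1
        rw [h2, ← hleaf, e15] at h1
        refine lt_of_le_of_ne h1 fun e => hji ?_
        exact (index_inj hi hj e).2.symm
      · rw [if_neg hst]
        exact J4 s (by omega) j hj hlt'
  · rintro σ1 - - ⟨⟨J0, J1, J2, J3, J4⟩, -⟩
    have hinj : ∀ s < k, ∀ t < k, σ1.arr 16 s = σ1.arr 16 t → s = t := by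
      intro s hs t ht e
      rcases lt_trichotomy s t with h | h | h
      · have := J3 s t h ht; rw [e] at this; omega
      · exact h
      · have := J3 t s h hs; rw [e] at this; omega
    refine ⟨J1, fun s t hst ht => ?_, hinj, fun i hi => ?_⟩
    · rcases hst.lt_or_eq with h | h
      · have h1 := J3 s t h ht
        by_contra hle
        have h2 := index_lt (not_le.1 hle) (J1 t ht)
        omega
      · rw [h]
    · have h1 : (Finset.range k).image (σ1.arr 16) = Finset.range k := by
        refine Finset.eq_of_subset_of_card_le (fun x hx => ?_) ?_
        · obtain ⟨s, hs, rfl⟩ := Finset.mem_image.1 hx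
          exact Finset.mem_range.2 (J1 s (Finset.mem_range.1 hs))
        · rw [Finset.card_image_of_injOn]
          intro s hs t ht e
          exact hinj s (by simpa using hs) t (by simpa using ht) e
      rw [← Finset.mem_range, ← h1] at hi
      obtain ⟨s, hs, e⟩ := Finset.mem_image.1 hi
      exact ⟨s, Finset.mem_range.1 hs, e⟩

end KServer

/-! ### Keys, gaps and moves of the servers -/

namespace KServer

open WordRAM

variable {n : ℕ} {G : SimpleGraph (Fin n)} {r q : Fin n} {w B nb N k : ℕ} {E : ℕ → Fin n}
  {pos : Fin n → ℕ} {σ : State} {c : ℕ → Fin n}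

/-- The program does not write to the memory of the preprocessing. -/
def keepsReady (s : Stmt) : Bool :=
  keepsBase s && s.keepsArr 8 && s.keepsArr 9 && s.keepsArr 10 && s.keepsArr 11 && s.keepsArr 12

theorem Ready.frame {s : Stmt} {σ' : State} (h : Ready G r w B nb N E pos σ) (hf : Frame s σ σ')
    (hk : keepsReady s = true) : Ready G r w B nb N E pos σ' := by
  simp only [keepsReady, Bool.and_eq_true] at hk
  obtain ⟨⟨⟨⟨⟨k0, k8⟩, k9⟩, k10⟩, k11⟩, k12⟩ := hk
  refine ⟨h.setup, h.base.frame hf k0, ?_, ?_, ?_, ?_, ?_⟩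
  · rw [hf.arr _ k8]; exact h.occ
  · rw [hf.arr _ k9]; exact h.mask
  · rw [hf.arr _ k10]; exact h.sparse
  · rw [hf.arr _ k11]; exact h.near
  · rw [hf.arr _ k12]; exact h.far

theorem Ready.setVar (h : Ready G r w B nb N E pos σ) (x v : ℕ)
    (hk : keepsReady (x ≔ ♯0) = true) : Ready G r w B nb N E pos (σ.setVar x v) :=
  h.frame (Frame.setVar σ x v) hk

theorem Ready.lca_run (h : Ready G r w B nb N E pos σ) (hσ : σ.WF w) {u v : Fin n}
    (hu : σ.var 4 = u) (hv : σ.var 5 = v) :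
    Run w lcaCode σ lcaCode.time (fun σ' => σ'.var 6 = ancAt G r u (meetDepth G r u v)) :=
  lcaCode_run h.setup hσ h.base h.occ h.mask h.sparse h.near h.far hu hv

theorem Ready.lcaDepth_run (h : Ready G r w B nb N E pos σ) (hσ : σ.WF w) {u v : Fin n}
    (hu : σ.var 4 = u) (hv : σ.var 5 = v) :
    Run w lcaDepth σ lcaDepth.time (fun σ' => σ'.var 34 = meetDepth G r u v) :=
  KServer.lcaDepth_run h.setup hσ h.base h.mask h.sparse hu hv

theorem Ready.levelAncestor_run (h : Ready G r w B nb N E pos σ) (hσ : σ.WF w) {v : Fin n} {d : ℕ}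
    (hv : σ.var 4 = v) (hd : σ.var 5 = d) (hdv : d ≤ G.dist r v) :
    Run w levelAncestorCode σ levelAncestorCode.time (fun σ' => σ'.var 6 = ancAt G r v d) :=
  levelAncestorCode_run h.setup hσ h.base h.occ h.near h.far hv hd hdv

/-- Register `66` receives the distance of the nodes in registers `4` and `5`. -/
def distCode : Stmt :=
  lcaDepth ;; 66 ≔ .get 4 (.var 4) + .get 4 (.var 5) - ♯2 * .var 34

theorem Ready.dist_run (h : Ready G r w B nb N E pos σ) (hσ : σ.WF w) {u v : Fin n}
    (hu : σ.var 4 = u) (hv : σ.var 5 = v) :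
    Run w distCode σ distCode.time (fun σ' => σ'.var 66 = G.dist u v) := by
  have hw := h.setup.word
  have hB := h.setup.B_lt
  have h1 := h.setup.dist_lt u
  have h2 := h.setup.dist_lt v
  obtain ⟨m1, m2, -⟩ := meetDepth_spec h.setup.tree r u v
  have hd := dist_add_meetDepth h.setup.tree r u v
  refine Run.seq_time hσ (h.lcaDepth_run hσ hu hv) fun σ1 hσ1 hf h34 => ?_
  have hb := h.base.frame hf rfl
  have w4 := (hf.var 4 rfl).trans hu
  have w5 := (hf.var 5 rfl).trans hv
  refine Run.assign_time (G.dist u v) hσ1 ?_ ?_ (by simp)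
  · have h1w : 1 < w := by
      by_contra hle
      have := Nat.pow_le_pow_right (n := 2) (by norm_num) (not_lt.1 hle)
      omega
    simp [w4, w5, hb.dep_eq, h34]; omega
  · simp [w4, w5, hb.dep_eq, h34]; omega

/-- The position of the first visit of `v` in the tour that starts at the visit of `q`. -/
def tourKey (N : ℕ) (pos : Fin n → ℕ) (q v : Fin n) : ℕ := (pos v + N - pos q) % N

/-- The key and the rank of the server in register `50`. -/
def keyHead : Stmt :=
  4 ≔ .get 1 (.var 50) ;;
  5 ≔ .var 3 ;;
  distCode ;;
  .store 14 (.var 50) (.var 66 * .var 2 + .var 50) ;;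
  52 ≔ .var 52 - (.var 52 - .var 66) ;;
  60 ≔ .var 2 + .var 50 ;;
  61 ≔ (.get 7 (.var 4) + .var 8 - .get 7 (.var 5)) % .var 8 * .var 2 + .var 50

/-- The numbers that the handling of a request computes with are words. -/
structure Fits (n k w : ℕ) : Prop where
  pos : 0 < k
  word : 4 * (n * k + n + k + 1) ≤ 2 ^ w

theorem Fits.one_lt (h : Fits n k w) : 1 < w := by
  have := h.word
  by_contra hle
  have := Nat.pow_le_pow_right (n := 2) (by norm_num) (not_lt.1 hle)
  omega

theorem dist_lt_card (hG : G.IsTree) (u v : Fin n) : G.dist u v < n := by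
  obtain ⟨p, hp, hl⟩ := hG.connected.exists_path_of_dist u v
  rw [← hl]
  simpa using hp.length_lt

/-- Register `52` ends with the least distance to the request; its initial value `n` exceeds every
distance, so it cannot survive. -/
theorem keyLoop_run (h : Ready G r w B nb N E pos σ) (hσ : σ.WF w) (hk : Fits n k w)
    (h2 : σ.var 2 = k) (h3 : σ.var 3 = q) (h1 : ∀ i < k, σ.arr 1 i = c i) (h52 : σ.var 52 = n)
    (hf : TreeInv k (σ.arr 15)) :
    Run w (.for 50 2 (keyHead ;; treeUpdate)) σ
      (2 + (k + 1) * (keyHead.time + (3 + (Nat.log 2 k + 2) * 29) + 8))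
      (fun σ' => TreeInv k (σ'.arr 15) ∧
        (∀ i < k, σ'.arr 14 i = G.dist q (c i) * k + i ∧
          σ'.arr 15 (k + i) = tourKey N pos q (c i) * k + i ∧ σ'.var 52 ≤ G.dist q (c i)) ∧
        ∃ i < k, G.dist q (c i) = σ'.var 52) := by
  have S := h.setup
  have hN := S.N_le
  have hw := S.word
  have hw1 := hk.one_lt
  have hkw := hk.word
  have hk0 := hk.pos
  have hdlt := dist_lt_card S.tree
  refine (Run.for (N := k) (fun t σ' => TreeInv k (σ'.arr 15) ∧
    (∀ i < t, σ'.arr 14 i = G.dist q (c i) * k + i ∧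
      σ'.arr 15 (k + i) = tourKey N pos q (c i) * k + i ∧ σ'.var 52 ≤ G.dist q (c i)) ∧
    (σ'.var 52 = n ∨ ∃ i < t, G.dist q (c i) = σ'.var 52)) _ hσ rfl rfl rfl h2
    ⟨hf, by simp, by simp [h52]⟩ ?_).mono hσ le_rfl ?_
  · rintro t ht σ1 hσ1 hfr hvar ⟨J0, J1, J2⟩
    have w2 := (hfr.var 2 rfl).trans h2
    have w3 := (hfr.var 3 rfl).trans h3
    have w1 : σ1.arr 1 t = c t := by rw [hfr.arr 1 rfl]; exact h1 t ht
    have hr1 := h.frame hfr rfl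
    have hd := hdlt q (c t)
    have hrank := index_lt hd ht
    have hpt := S.pos_lt (c t)
    have hpq := S.pos_lt q
    have hkey : tourKey N pos q (c t) < N := Nat.mod_lt _ (by omega)
    have hkey2 := index_lt hkey ht
    have hNk : N * k ≤ 3 * (n * k) := by rw [← Nat.mul_assoc]; exact Nat.mul_le_mul_right _ hN
    have hmul1 : G.dist q (c t) * k ≤ n * k := Nat.mul_le_mul_right _ hd.le
    refine Run.seq (P := fun σ' => σ'.arr 14 t = G.dist q (c t) * k + t ∧
      (∀ i < t, σ'.arr 14 i = G.dist q (c i) * k + i) ∧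
      σ'.var 52 = min (σ1.var 52) (G.dist q (c t)) ∧ σ'.var 60 = k + t ∧
      σ'.var 61 = tourKey N pos q (c t) * k + t) hσ1 ?_ ?_
    · refine Run.assign_seq_time (c t : Fin n) hσ1 (by simp) (by simp [hvar, w1]) fun hσ2 => ?_
      refine Run.assign_seq_time q hσ2 (by simp) (by simp [w3]) fun hσ3 => ?_
      have hr3 := (hr1.setVar 4 (c t : Fin n) rfl).setVar 5 q rfl
      refine Run.seq_time hσ3 (hr3.dist_run hσ3 (u := c t) (v := q) (by simp) (by simp))
        fun σ4 hσ4 hf4 h66 => ?_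
      have hr4 := hr3.frame hf4 rfl
      have x2 : σ4.var 2 = k := by rw [hf4.var 2 rfl]; simp [w2]
      have x50 : σ4.var 50 = t := by rw [hf4.var 50 rfl]; simp [hvar]
      have x4 : σ4.var 4 = c t := by rw [hf4.var 4 rfl]; simp
      have x5 : σ4.var 5 = q := by rw [hf4.var 5 rfl]; simp
      have x52 : σ4.var 52 = σ1.var 52 := by rw [hf4.var 52 rfl]; simp
      have x14 : σ4.arr 14 = σ1.arr 14 := by rw [hf4.arr 14 rfl]; rfl
      rw [G.dist_comm] at h66
      have p1 := hr4.base.pos_eq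
      have p8 := hr4.base.N_eq
      apply Run.of_wp hσ4
      refine Stmt.wp_store_seq t (G.dist q (c t) * k + t) (by simp) (by simp [x50])
        (by simp [x2, x50, h66]; omega) (by simp [x2, x50, h66]) ?_
      refine Stmt.wp_assign_seq (min (σ1.var 52) (G.dist q (c t))) (by simp)
        (by simp [x52, h66]; omega) ?_
      refine Stmt.wp_assign_seq (k + t) (by simp [x2, x50]; omega) (by simp [x2, x50]) ?_
      refine Stmt.wp_assign_of (tourKey N pos q (c t) * k + t) ?_
        (by simp [x2, x50, x4, x5, p1, p8, tourKey]) ?_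
      · unfold tourKey at hkey2
        simp [x2, x50, x4, x5, p1, p8]; omega
      · refine ⟨by simp, fun i hi => ?_, by simp, by simp, by simp⟩
        have : i ≠ t := by omega
        simpa [this, x14] using (J1 i hi).1
    · rintro σ2 hσ2 hf2 ⟨K1, K2, K3, K4, K5⟩
      have e15 := hf2.arr 15 rfl
      refine (treeUpdate_run hσ2 hw1 (by omega) (x := k + t) (by omega) (by omega)
        (by rw [e15]; exact J0) K4 K5).mono hσ2 le_rfl ?_
      rintro σ3 hσ3 hf3 ⟨L0, L1⟩
      have e52 : σ3.var 52 = min (σ1.var 52) (G.dist q (c t)) := by rw [hf3.var 52 rfl, K3]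
      have e14 := hf3.arr 14 rfl
      simp only [State.setVar_arr, State.setVar_var, if_neg (show (52 : ℕ) ≠ 50 by decide), e52,
        e14]
      refine ⟨L0, fun i hi => ?_, ?_⟩
      · rw [L1 _ (by omega), e15]
        by_cases hit : i = t
        · subst hit
          exact ⟨K1, if_pos rfl, min_le_right _ _⟩
        · obtain ⟨a1, a2, a3⟩ := J1 i (by omega)
          exact ⟨K2 i (by omega), by rw [if_neg (by omega), a2], (min_le_left _ _).trans a3⟩
      · rcases J2 with h4 | ⟨i, hi, h4⟩
        · exact Or.inr ⟨t, by omega, by omega⟩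
        · by_cases hle : σ1.var 52 ≤ G.dist q (c t)
          · exact Or.inr ⟨i, by omega, by omega⟩
          · exact Or.inr ⟨t, by omega, by omega⟩
  · rintro σ1 - - ⟨⟨J0, J1, J2⟩, -⟩
    refine ⟨J0, J1, J2.resolve_left fun e => ?_⟩
    have h4 := (J1 0 hk0).2.2
    have h5 := hdlt q (c 0)
    omega

/-- The gap before the server at place `50` of the order of the tour, and both orders. -/
def gapBody : Stmt :=
  67 ≔ .get 16 (.var 50) ;;
  68 ≔ .get 16 (.var 50 - ♯1) ;;
  4 ≔ .get 1 (.var 67) ;;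
  5 ≔ .get 1 (.var 68) ;;
  distCode ;;
  69 ≔ .get 14 (.var 67) ;;
  70 ≔ (.var 69 / .var 2 + .get 14 (.var 68) / .var 2 - .var 66) / ♯2 ;;
  .store 17 (.var 50) (.var 69) ;;
  .store 18 (.var 50) (.var 70) ;;
  .store 23 (.var 2 - ♯1 - .var 50) (.var 69) ;;
  .store 24 (.var 2 - .var 50) (.var 70)

/-- By `dist_add_meetDepth`, meeting depths for the root `q` are half of a combination of three
distances, so no table depends on `q`. Under reversal, the gap before place `t` becomes the gap
before place `k - t`, which explains the index in array `24`. -/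
theorem gapLoop_run (h : Ready G r w B nb N E pos σ) (hσ : σ.WF w) (hk : Fits n k w)
    (h2 : σ.var 2 = k) (h1 : ∀ i < k, σ.arr 1 i = c i)
    (h14 : ∀ i < k, σ.arr 14 i = G.dist q (c i) * k + i) {o : ℕ → ℕ} (ho : ∀ t < k, o t < k)
    (h16 : ∀ t < k, σ.arr 16 t = o t) :
    Run w (.for 50 2 gapBody) σ (2 + (k + 1) * (gapBody.time + 8))
      (fun σ' => ∀ t < k, σ'.arr 17 t = G.dist q (c (o t)) * k + o t ∧
        σ'.arr 18 t = meetDepth G q (c (o (t - 1))) (c (o t)) ∧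
        σ'.arr 23 (k - 1 - t) = G.dist q (c (o t)) * k + o t ∧
        σ'.arr 24 (k - t) = meetDepth G q (c (o (t - 1))) (c (o t))) := by
  have S := h.setup
  have hw1 := hk.one_lt
  have hkw := hk.word
  have hk0 := hk.pos
  refine (Run.for (N := k) (fun t σ' => ∀ s < t, σ'.arr 17 s = G.dist q (c (o s)) * k + o s ∧
        σ'.arr 18 s = meetDepth G q (c (o (s - 1))) (c (o s)) ∧
        σ'.arr 23 (k - 1 - s) = G.dist q (c (o s)) * k + o s ∧
        σ'.arr 24 (k - s) = meetDepth G q (c (o (s - 1))) (c (o s))) _ hσ rfl rfl rfl h2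
    (by simp) ?_).mono hσ le_rfl (fun σ' _ _ h => h.1)
  intro t ht σ1 hσ1 hfr hvar J
  have w2 := (hfr.var 2 rfl).trans h2
  have w1 : ∀ i < k, σ1.arr 1 i = c i := by rw [hfr.arr 1 rfl]; exact h1
  have w14 : ∀ i < k, σ1.arr 14 i = G.dist q (c i) * k + i := by rw [hfr.arr 14 rfl]; exact h14
  have w16 : ∀ i < k, σ1.arr 16 i = o i := by rw [hfr.arr 16 rfl]; exact h16
  have hr1 := h.frame hfr rfl
  have o1 := ho t ht
  have o2 := ho (t - 1) (by omega)
  have d1 := S.dist_lt (c (o t))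
  refine Run.assign_seq_time (o t) hσ1 (by simp) (by simp [hvar, w16 t ht]) fun hσ2 => ?_
  refine Run.assign_seq_time (o (t - 1)) hσ2 (by simp; omega)
    (by simp [hvar, w16 (t - 1) (by omega)]) fun hσ3 => ?_
  refine Run.assign_seq_time (c (o t) : Fin n) hσ3 (by simp) (by simp [w1 _ o1]) fun hσ4 => ?_
  refine Run.assign_seq_time (c (o (t - 1)) : Fin n) hσ4 (by simp) (by simp [w1 _ o2])
    fun hσ5 => ?_
  have hr5 := (((hr1.setVar 67 (o t) rfl).setVar 68 (o (t - 1)) rfl).setVar 4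
    (c (o t) : Fin n) rfl).setVar 5 (c (o (t - 1)) : Fin n) rfl
  refine Run.seq_time hσ5 (hr5.dist_run hσ5 (u := c (o t)) (v := c (o (t - 1))) (by simp)
    (by simp)) fun σ6 hσ6 hf6 h66 => ?_
  have x2 : σ6.var 2 = k := by rw [hf6.var 2 rfl]; simp [w2]
  have x50 : σ6.var 50 = t := by rw [hf6.var 50 rfl]; simp [hvar]
  have x67 : σ6.var 67 = o t := by rw [hf6.var 67 rfl]; simp
  have x68 : σ6.var 68 = o (t - 1) := by rw [hf6.var 68 rfl]; simp
  have x14 : σ6.arr 14 = σ1.arr 14 := by rw [hf6.arr 14 rfl]; rfl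
  have x17 : σ6.arr 17 = σ1.arr 17 := by rw [hf6.arr 17 rfl]; rfl
  have x18 : σ6.arr 18 = σ1.arr 18 := by rw [hf6.arr 18 rfl]; rfl
  have x23 : σ6.arr 23 = σ1.arr 23 := by rw [hf6.arr 23 rfl]; rfl
  have x24 : σ6.arr 24 = σ1.arr 24 := by rw [hf6.arr 24 rfl]; rfl
  have hdm := dist_add_meetDepth S.tree q (c (o t)) (c (o (t - 1)))
  rw [meetDepth_comm S.tree] at hdm
  have hdiv : ∀ i < k, (G.dist q (c i) * k + i) / k = G.dist q (c i) := by
    intro i hi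
    rw [Nat.mul_comm, Nat.mul_add_div hk0, Nat.div_eq_of_lt hi, Nat.add_zero]
  have hd1 : G.dist q (c (o t)) * k + o t < 2 ^ w := by rw [← w14 _ o1]; exact hσ1.arr _ _
  have hdlt := dist_lt_card S.tree
  have hlt1 := hdlt q (c (o t))
  have hlt2 := hdlt q (c (o (t - 1)))
  apply Run.of_wp hσ6
  refine Stmt.wp_assign_seq (G.dist q (c (o t)) * k + o t) (by simp)
    (by simp [x67, x14, w14 _ o1]) ?_
  refine Stmt.wp_assign_seq (meetDepth G q (c (o (t - 1))) (c (o t))) ?_ ?_ ?_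
  · simp [x68, x14, w14 _ o2, x2, hdiv _ o1, hdiv _ o2]; omega
  · simp [x68, x14, w14 _ o2, x2, hdiv _ o1, hdiv _ o2, h66]; omega
  refine Stmt.wp_store_seq t _ (by simp) (by simp [x50]) (by simp) rfl ?_
  refine Stmt.wp_store_seq t _ (by simp) (by simp [x50]) (by simp) rfl ?_
  refine Stmt.wp_store_seq (k - 1 - t) _ (by simp; omega) (by simp [x50, x2]) (by simp) rfl ?_
  refine Stmt.wp_store_of (k - t) _ (by simp) (by simp [x50, x2]) (by simp) rfl ?_
  intro s hs
  by_cases hst : s = t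
  · subst hst
    simp
  · obtain ⟨j1, j2, j3, j4⟩ := J s (by omega)
    have e1 : k - 1 - s ≠ k - 1 - t := by omega
    have e2 : k - s ≠ k - t := by omega
    simp only [State.setVar_arr, State.setArr_arr, hst, e1, e2, and_false, if_false, x17, x18, x23,
      x24]
    exact ⟨j1, j2, j3, j4⟩

/-- Save the result of the first pass, and reverse the order. -/
def copyBody : Stmt :=
  .store 25 (.var 50) (.get 19 (.var 50)) ;;
  .store 17 (.var 50) (.get 23 (.var 50)) ;;
  .store 18 (.var 50) (.get 24 (.var 50))

theorem copyLoop_run (hσ : σ.WF w) (h2 : σ.var 2 = k) :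
    Run w (.for 50 2 copyBody) σ (2 + (k + 1) * (copyBody.time + 8))
      (fun σ' => ∀ t < k, σ'.arr 25 t = σ.arr 19 t ∧ σ'.arr 17 t = σ.arr 23 t ∧
        σ'.arr 18 t = σ.arr 24 t) := by
  refine (Run.for (N := k) (fun t σ' => ∀ s < t, σ'.arr 25 s = σ.arr 19 s ∧
    σ'.arr 17 s = σ.arr 23 s ∧ σ'.arr 18 s = σ.arr 24 s) _ hσ rfl rfl rfl h2
    (by simp) ?_).mono hσ le_rfl (fun σ' _ _ h => h.1)
  intro t ht σ1 hσ1 hfr hvar J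
  apply Run.of_wp hσ1
  refine Stmt.wp_store_seq t (σ.arr 19 t) (by simp) (by simp [hvar]) (by simp)
    (by simp [hvar, hfr.arr 19 rfl]) ?_
  refine Stmt.wp_store_seq t (σ.arr 23 t) (by simp) (by simp [hvar]) (by simp)
    (by simp [hvar, hfr.arr 23 rfl]) ?_
  refine Stmt.wp_store_of t (σ.arr 24 t) (by simp) (by simp [hvar]) (by simp)
    (by simp [hvar, hfr.arr 24 rfl]) ?_
  intro s hs
  by_cases hst : s = t
  · subst hst; simp
  · simpa [hst] using J s (by omega)

/-- Move the server at place `50` of the order of the tour. -/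
def moveBody : Stmt :=
  67 ≔ .get 16 (.var 50) ;;
  68 ≔ .get 25 (.var 50) ;;
  69 ≔ .get 19 (.var 2 - ♯1 - .var 50) ;;
  68 ≔ .var 68 - (.var 68 - .var 69) ;;
  4 ≔ .get 1 (.var 67) ;;
  5 ≔ .var 3 ;;
  lcaDepth ;;
  69 ≔ .get 4 (.var 4) ;;
  .ite ((Expr.var 69).lt (.var 68 + .var 34))
    (4 ≔ .var 5 ;; 5 ≔ ♯2 * .var 34 + .var 68 - .var 69)
    (5 ≔ .var 69 - .var 68) ;;
  levelAncestorCode ;;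
  .store 1 (.var 67) (.var 6)

/-- By `walkToward_eq` the new node is an ancestor of the server or of `q` in the tree rooted at
`r`, according to whether the common ancestor is passed. As `o` is injective, no position is
overwritten before it is read. -/
theorem moveLoop_run (h : Ready G r w B nb N E pos σ) (hσ : σ.WF w) (hk : Fits n k w)
    (h2 : σ.var 2 = k) (h3 : σ.var 3 = q) (h1 : ∀ i < k, σ.arr 1 i = c i) {a o : ℕ → ℕ}
    (ho : SortedBy k a o) (h16 : ∀ t < k, σ.arr 16 t = o t)
    (hT : ∀ t < k, σ.arr 25 t ≤ G.dist q (c (o t))) :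
    Run w (.for 50 2 moveBody) σ (2 + (k + 1) * (moveBody.time + 8))
      (fun σ' => ∀ t < k, σ'.arr 1 (o t) =
        walkToward G q (c (o t)) (min (σ.arr 25 t) (σ.arr 19 (k - 1 - t)))) := by
  have S := h.setup
  have hw := S.word
  have hw1 := hk.one_lt
  have hkw := hk.word
  have hk0 := hk.pos
  have hdlt := dist_lt_card S.tree
  refine (Run.for (N := k) (fun t σ' => ∀ s < k, σ'.arr 1 (o s) = if s < t then
    ((walkToward G q (c (o s)) (min (σ.arr 25 s) (σ.arr 19 (k - 1 - s))) : Fin n) : ℕ)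
    else c (o s)) _ hσ rfl rfl rfl h2 (fun s hs => by simp [h1 _ (ho.lt s hs)])
    ?_).mono hσ le_rfl (fun σ' _ _ h t ht => by rw [h.1 t ht, if_pos ht])
  intro t ht σ1 hσ1 hfr hvar J
  have w2 := (hfr.var 2 rfl).trans h2
  have w3 := (hfr.var 3 rfl).trans h3
  have w16 : ∀ i < k, σ1.arr 16 i = o i := by rw [hfr.arr 16 rfl]; exact h16
  have w25 := hfr.arr 25 rfl
  have w19 := hfr.arr 19 rfl
  have hr1 := h.frame hfr rfl
  have w1 := J t ht
  rw [if_neg (lt_irrefl t)] at w1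
  set T := min (σ.arr 25 t) (σ.arr 19 (k - 1 - t)) with hTdef
  set v := c (o t) with hv
  have hTle : T ≤ G.dist q v := (min_le_left _ _).trans (hT t ht)
  have hwalk := walkToward_eq S.tree r q v hTle
  obtain ⟨m1, m2, -⟩ := meetDepth_spec S.tree r v q
  have hdm := dist_add_meetDepth S.tree r v q
  rw [G.dist_comm (u := v) (v := q)] at hdm
  have hd1 := hdlt r v
  have hd2 := hdlt r q
  have hd3 := hdlt q v
  refine Run.assign_seq_time (o t) hσ1 (by simp) (by simp [hvar, w16 t ht]) fun hσ2 => ?_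
  refine Run.assign_seq_time (σ.arr 25 t) hσ2 (by simp) (by simp [hvar, w25]) fun hσ3 => ?_
  refine Run.assign_seq_time (σ.arr 19 (k - 1 - t)) hσ3 (by simp; omega)
    (by simp [hvar, w19, w2]) fun hσ4 => ?_
  refine Run.assign_seq_time T hσ4 (by simp) (by simp; omega) fun hσ5 => ?_
  refine Run.assign_seq_time v hσ5 (by simp) (by simp [w1]) fun hσ6 => ?_
  refine Run.assign_seq_time q hσ6 (by simp) (by simp [w3]) fun hσ7 => ?_
  have hr7 := (((((hr1.setVar 67 (o t) rfl).setVar 68 (σ.arr 25 t) rfl).setVar 69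
    (σ.arr 19 (k - 1 - t)) rfl).setVar 68 T rfl).setVar 4 v rfl).setVar 5 q rfl
  refine Run.seq_time hσ7 (hr7.lcaDepth_run hσ7 (u := v) (v := q) (by simp) (by simp))
    fun σ8 hσ8 hf8 h34 => ?_
  have hr8 := hr7.frame hf8 rfl
  have x4 : σ8.var 4 = v := by rw [hf8.var 4 rfl]; simp
  have x5 : σ8.var 5 = q := by rw [hf8.var 5 rfl]; simp
  have x67 : σ8.var 67 = o t := by rw [hf8.var 67 rfl]; simp
  have x68 : σ8.var 68 = T := by rw [hf8.var 68 rfl]; simp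
  have xa : σ8.arr 1 = σ1.arr 1 := by rw [hf8.arr 1 rfl]; rfl
  refine Run.assign_seq_time (G.dist r v) hσ8 (by simp) (by simp [x4, hr8.base.dep_eq])
    fun hσ9 => ?_
  have hr9 := hr8.setVar 69 (G.dist r v) rfl
  refine Run.seq_time (P := fun σ' => ∃ u : Fin n, ∃ d, σ'.var 4 = u ∧ σ'.var 5 = d ∧
    d ≤ G.dist r u ∧ walkToward G q v T = ancAt G r u d) hσ9 ?_ ?_
  · refine Run.ite_time hσ9 (by simp [x68, h34]; omega) (fun hc => ?_) (fun hc => ?_)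
    · simp [x68, h34] at hc
      refine Run.assign_seq_time q hσ9 (by simp) (by simp [x5]) fun hσ10 => ?_
      refine Run.assign_time (2 * meetDepth G r v q + T - G.dist r v) hσ10
        (by simp [x68, h34]; omega) (by simp [x68, h34]) ?_
      refine ⟨q, 2 * meetDepth G r v q + T - G.dist r v, by simp, by simp, by omega, ?_⟩
      rw [hwalk, if_neg (by omega)]
    · simp [x68, h34] at hc
      refine Run.assign_time (G.dist r v - T) hσ9 (by simp) (by simp [x68]) ?_
      refine ⟨v, G.dist r v - T, by simp [x4], by simp, by omega, ?_⟩
      rw [hwalk, if_pos (by omega)]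
  · rintro σ10 hσ10 hf10 ⟨u, d, y4, y5, hd, hw⟩
    have hr10 := hr9.frame hf10 rfl
    refine Run.seq_time hσ10 (hr10.levelAncestor_run hσ10 y4 y5 hd) fun σ11 hσ11 hf11 h6 => ?_
    have z67 : σ11.var 67 = o t := by
      rw [hf11.var 67 rfl, hf10.var 67 rfl]; simp [x67]
    have za : σ11.arr 1 = σ1.arr 1 := by
      rw [hf11.arr 1 rfl, hf10.arr 1 rfl]; exact xa
    apply Run.of_wp hσ11
    refine Stmt.wp_store_of (o t) (walkToward G q v T : Fin n) (by simp) (by simp [z67]) (by simp)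
      (by simp [h6, hw]) ?_
    intro s hs
    by_cases hst : s = t
    · subst hst
      simp [hTdef, hv]
    · have hne : o s ≠ o t := fun e => hst (ho.inj s hs t ht e)
      have := J s hs
      simp only [State.setVar_arr, State.setArr_arr, hne, and_false, if_false, za, this]
      by_cases hlt : s < t
      · rw [if_pos hlt, if_pos (by omega)]
      · rw [if_neg hlt, if_neg (by omega)]

end KServer

/-! ### Correctness of the handling of a request -/

namespace KServer

open WordRAM

variable {n : ℕ} {G : SimpleGraph (Fin n)} {r q : Fin n} {w B nb N k d : ℕ} {E : ℕ → Fin n}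
  {pos : Fin n → ℕ} {σ : State} {c : ℕ → Fin n} {o : ℕ → ℕ}

theorem Setup.E_tourKey (S : Setup G r w B nb N E pos) (q v : Fin n) :
    E ((pos q + tourKey N pos q v) % N) = v := by
  have h1 := S.pos_lt q
  have h2 := S.pos_lt v
  rw [tourKey, Nat.add_mod_mod, show pos q + (pos v + N - pos q) = pos v + N by omega,
    Nat.add_mod_right, Nat.mod_eq_of_lt h2, S.E_pos]

/-- One inequality holds for any three nodes; the other is the interval property of the tour read
from `q` on. -/
theorem Setup.meetDepth_eq_min (S : Setup G r w B nb N E pos) {q x y z : Fin n}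
    (hxy : tourKey N pos q x ≤ tourKey N pos q y) (hyz : tourKey N pos q y ≤ tourKey N pos q z) :
    meetDepth G q x z = min (meetDepth G q x y) (meetDepth G q y z) := by
  refine le_antisymm ?_ ((rootedTree_of_isTree S.tree q).min_meet_le x y z)
  have := S.tour.meetDepth_le_of_between S.tree (S.pos_lt q) hxy hyz
    (Nat.mod_lt _ (by have := S.pos_lt q; omega))
  rwa [S.E_pos, S.E_tourKey, S.E_tourKey, S.E_tourKey] at this

theorem rank_div {a i : ℕ} (hi : i < k) : (a * k + i) / k = a := by
  rw [Nat.mul_comm, Nat.mul_add_div (by omega), Nat.div_eq_of_lt hi, Nat.add_zero]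

theorem passData_of_order (hG : G.IsTree) (q : Fin n) (c : ℕ → Fin n) (ho : ∀ t < k, o t < k)
    (hinj : ∀ s < k, ∀ t < k, o s = o t → s = t)
    (hmin : ∀ j i, j ≤ i → i + 1 < k → meetDepth G q (c (o j)) (c (o (i + 1))) =
      min (meetDepth G q (c (o j)) (c (o i))) (meetDepth G q (c (o i)) (c (o (i + 1))))) :
    PassData k (fun t => G.dist q (c (o t)) * k + o t)
      (fun j t => meetDepth G q (c (o j)) (c (o t))) where
  self i hi := by
    rw [rank_div (ho i hi)]
    exact (rootedTree_of_isTree hG q).meet_self _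
  le j i _ hi := by
    rw [rank_div (ho i hi)]
    exact (meetDepth_spec hG q _ _).2.1
  step := hmin
  inj i hi j hj h := by
    refine hinj i hi j hj ?_
    have := congrArg (· % k) h
    simpa [Nat.mul_comm, Nat.mul_add_mod, Nat.mod_eq_of_lt (ho i hi), Nat.mod_eq_of_lt (ho j hj)]
      using this

/-- Every other server comes before or after server `i` in the order, so the two passes together see
all servers of smaller rank. Here `τ` gives the place of a server in the order. -/
theorem chrobakLarmore_of_passes (hG : G.IsTree) (q : Fin n) (c : ℕ → Fin n)
    (ho : ∀ t < k, o t < k) {τ P P' : ℕ → ℕ} (hτ : ∀ i < k, τ i < k ∧ o (τ i) = i)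
    (hd : ∀ i < k, d ≤ G.dist q (c i)) (hex : ∃ i < k, G.dist q (c i) = d)
    (hP : ∀ t < k, PassOut k (fun t => G.dist q (c (o t)) * k + o t)
      (fun j t => meetDepth G q (c (o j)) (c (o t))) d t (P t))
    (hP' : ∀ t < k, PassOut k (fun t => G.dist q (c (o (k - 1 - t))) * k + o (k - 1 - t))
      (fun j t => meetDepth G q (c (o (k - 1 - j))) (c (o (k - 1 - t)))) d t (P' t)) :
    ChrobakLarmore G q (fun i : Fin k => c i)
      (fun i => walkToward G q (c i) (min (P (τ i)) (P' (k - 1 - τ i)))) := by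
  have back : ∀ t < k, k - 1 - (k - 1 - t) = t := fun t ht => by omega
  refine chrobakLarmore_of_steps hG q (fun i : Fin k => c i) d
    (fun i => min (P (τ i)) (P' (k - 1 - τ i))) (fun i => hd i i.2) ?_ (fun i => ?_)
    (fun i j hlt => ?_) (fun i => ?_)
  · obtain ⟨i, hi, h⟩ := hex
    exact ⟨⟨i, hi⟩, h⟩
  · exact (min_le_left _ _).trans (hP _ (hτ i i.2).1).le
  · obtain ⟨a1, a2⟩ := hτ i i.2
    obtain ⟨b1, b2⟩ := hτ j j.2
    have hne : τ j ≠ τ i := by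
      intro h
      rw [h, a2] at b2
      rw [Fin.ext b2] at hlt
      exact lt_irrefl _ hlt
    rcases lt_or_gt_of_ne hne with h | h
    · refine (min_le_left _ _).trans ?_
      have := (hP _ a1).block (τ j) h (by simpa only [rank, a2, b2] using hlt)
      simpa only [a2, b2, rank_div j.2] using this
    · refine (min_le_right _ _).trans ?_
      have := (hP' (k - 1 - τ i) (by omega)).block (k - 1 - τ j) (by omega)
        (by simpa only [back _ a1, back _ b1, rank, a2, b2] using hlt)
      simpa only [back _ a1, back _ b1, a2, b2, rank_div j.2] using this
  · obtain ⟨a1, a2⟩ := hτ i i.2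
    rcases le_total (P (τ i)) (P' (k - 1 - τ i)) with h | h
    · simp only [min_eq_left h]
      refine (hP _ a1).attained.imp_right ?_
      rintro ⟨j, hj, h1, h2⟩
      have hj' := ho j (by omega)
      refine ⟨⟨o j, hj'⟩, by simpa only [rank, a2] using h1, ?_⟩
      simpa only [a2, rank_div hj'] using h2
    · simp only [min_eq_right h]
      refine (hP' (k - 1 - τ i) (by omega)).attained.imp_right ?_
      rintro ⟨j, hj, h1, h2⟩
      have hj' := ho (k - 1 - j) (by omega)
      refine ⟨⟨o (k - 1 - j), hj'⟩, by simpa only [rank, back _ a1, a2] using h1, ?_⟩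
      simpa only [back _ a1, a2, rank_div hj'] using h2

/-- Handle a request: sort the servers in the order of the tour from the request on, compute the
time at which each of them is blocked from either side, and move the servers. -/
def queryCode : Stmt :=
  52 ≔ .var 0 ;;
  64 ≔ .var 8 * .var 2 ;;
  51 ≔ ♯2 * .var 2 ;;
  .for 50 51 (.store 15 (.var 50) (.var 64)) ;;
  .for 50 2 (keyHead ;; treeUpdate) ;;
  .for 50 2 extractBody ;;
  .for 50 2 gapBody ;;
  passCode ;;
  .for 50 2 copyBody ;;
  passCode ;;
  .for 50 2 moveBody

theorem clearTree_run {z : ℕ} (hσ : σ.WF w) (h51 : σ.var 51 = 2 * k) (h64 : σ.var 64 = z) :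
    Run w (.for 50 51 (.store 15 (.var 50) (.var 64))) σ (2 + (2 * k + 1) * (3 + 8))
      (fun σ' => TreeInv k (σ'.arr 15)) := by
  refine (Run.for (N := 2 * k) (fun t σ' => ∀ s < t, σ'.arr 15 s = z) 3 hσ rfl rfl rfl h51
    (by simp) ?_).mono hσ le_rfl ?_
  · intro t ht σ1 hσ1 hfr hvar J
    have w64 := (hfr.var 64 rfl).trans h64
    refine Run.of_wp hσ1 (Stmt.wp_store_of t z (by simp) (by simp [hvar]) (by simp)
      (by simp [w64]) ?_)
    intro s hs
    by_cases hst : s = t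
    · simp [hst]
    · simpa [hst] using J s (by omega)
  · rintro σ1 - - ⟨J, -⟩ y h1 h2
    rw [J y (by omega), J (2 * y) (by omega), J (2 * y + 1) (by omega), min_self]

theorem queryCode_run (h : Ready G r w B nb N E pos σ) (hσ : σ.WF w) (hk : Fits n k w)
    (h2 : σ.var 2 = k) (h3 : σ.var 3 = q) (h1 : ∀ i < k, σ.arr 1 i = c i) :
    Run w queryCode σ (5000 * (k * (Nat.log 2 k + 1))) (fun σ' => ∃ c' : Fin k → Fin n,
      ChrobakLarmore G q (fun i : Fin k => c i) c' ∧ HoldsServers σ' c') := by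
  have S := h.setup
  have hN := S.N_le
  have hw1 := hk.one_lt
  have hkw := hk.word
  have hk0 := hk.pos
  have hdlt := dist_lt_card S.tree
  have hNk : N * k ≤ 3 * (n * k) := by rw [← Nat.mul_assoc]; exact Nat.mul_le_mul_right _ hN
  refine Run.mono_time (T := (1 + 1) + ((1 + 1 + 1 + 1) + ((1 + 1 + 1 + 1) +
    ((2 + (2 * k + 1) * (3 + 8)) +
    ((2 + (k + 1) * (keyHead.time + (3 + (Nat.log 2 k + 2) * 29) + 8)) +
    ((2 + (k + 1) * (19 + (Nat.log 2 k + 2) * 29 + 8)) +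
    ((2 + (k + 1) * (gapBody.time + 8)) +
    ((13 + (2 * k + 1) * (passBody.time + 4)) +
    ((2 + (k + 1) * (copyBody.time + 8)) +
    ((13 + (2 * k + 1) * (passBody.time + 4)) +
    (2 + (k + 1) * (moveBody.time + 8)))))))))))) ?_ ?_
  swap
  · have t1 : keyHead.time = 229 := rfl
    have t2 : gapBody.time = 241 := rfl
    have t3 : copyBody.time = 12 := rfl
    have t4 : moveBody.time = 348 := rfl
    have t5 : passBody.time = 85 := rfl
    rw [t1, t2, t3, t4, t5]
    have : Nat.log 2 k ≤ k * Nat.log 2 k := Nat.le_mul_of_pos_left _ hk0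
    nlinarith
  refine Run.assign_seq n hσ (by simp) (by simp [h.base.n_eq]) fun hσ1 => ?_
  refine Run.assign_seq (N * k) hσ1 (by simp [h.base.N_eq, h2]; omega)
    (by simp [h.base.N_eq, h2]) fun hσ2 => ?_
  refine Run.assign_seq (2 * k) hσ2 (by simp [h2]; omega) (by simp [h2]) fun hσ3 => ?_
  refine Run.seq hσ3 (clearTree_run (k := k) (z := N * k) hσ3 (by simp) (by simp))
    fun σ4 hσ4 hf4 T4 => ?_
  have hr4 := (((h.setVar 52 n rfl).setVar 64 (N * k) rfl).setVar 51 (2 * k) rfl).frame hf4 rfl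
  have v4_2 : σ4.var 2 = k := by rw [hf4.var 2 rfl]; simp [h2]
  have v4_3 : σ4.var 3 = q := by rw [hf4.var 3 rfl]; simp [h3]
  have v4_52 : σ4.var 52 = n := by rw [hf4.var 52 rfl]; simp
  have v4_64 : σ4.var 64 = N * k := by rw [hf4.var 64 rfl]; simp
  have a4 : ∀ i < k, σ4.arr 1 i = c i := by rw [hf4.arr 1 rfl]; exact h1
  refine Run.seq hσ4 (keyLoop_run hr4 hσ4 hk v4_2 v4_3 a4 v4_52 T4) fun σ5 hσ5 hf5 K5 => ?_
  obtain ⟨T5, K5, hex⟩ := K5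
  obtain ⟨d, hd⟩ : ∃ d, σ5.var 52 = d := ⟨_, rfl⟩
  rw [hd] at hex
  have hr5 := hr4.frame hf5 rfl
  have v5_2 := (hf5.var 2 rfl).trans v4_2
  have v5_3 := (hf5.var 3 rfl).trans v4_3
  have v5_64 := (hf5.var 64 rfl).trans v4_64
  have a5 : ∀ i < k, σ5.arr 1 i = c i := by rw [hf5.arr 1 rfl]; exact a4
  refine Run.seq hσ5 (extractLoop_run hσ5 hw1 hk0 (by omega) v5_2 v5_64
    (fun i _ => Nat.mod_lt _ S.tour.pos) T5 (fun i hi => (K5 i hi).2.1)) fun σ6 hσ6 hf6 ho => ?_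
  obtain ⟨o, ho'⟩ : ∃ o, σ6.arr 16 = o := ⟨_, rfl⟩
  rw [ho'] at ho
  have hr6 := hr5.frame hf6 rfl
  have v6_2 := (hf6.var 2 rfl).trans v5_2
  have v6_3 := (hf6.var 3 rfl).trans v5_3
  have v6_52 := (hf6.var 52 rfl).trans hd
  have a6 : ∀ i < k, σ6.arr 1 i = c i := by rw [hf6.arr 1 rfl]; exact a5
  refine Run.seq hσ6 (gapLoop_run hr6 hσ6 hk v6_2 a6
    (by rw [hf6.arr 14 rfl]; exact fun i hi => (K5 i hi).1) ho.lt
    (fun t _ => congrFun ho' t)) fun σ7 hσ7 hf7 K7 => ?_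
  have hr7 := hr6.frame hf7 rfl
  have v7_2 := (hf7.var 2 rfl).trans v6_2
  have v7_3 := (hf7.var 3 rfl).trans v6_3
  have v7_52 := (hf7.var 52 rfl).trans v6_52
  have a7 : ∀ i < k, σ7.arr 1 i = c i := by rw [hf7.arr 1 rfl]; exact a6
  have o7 := (hf7.arr 16 rfl).trans ho'
  have hRk : ∀ t < k, (G.dist q (c (o t)) * k + o t) / k + 1 < 2 ^ w := by
    intro t ht
    rw [rank_div (ho.lt t ht)]
    have := hdlt q (c (o t))
    omega
  have D := passData_of_order S.tree q c ho.lt ho.inj fun j i hj hi =>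
    S.meetDepth_eq_min (ho.le j i hj (by omega)) (ho.le i (i + 1) (by omega) hi)
  -- Meeting depths are symmetric, so the reversed sequence obeys the same law for its gaps.
  have D' := passData_of_order (o := fun t => o (k - 1 - t)) S.tree q c
    (fun t ht => ho.lt _ (by omega))
    (fun s hs t ht e => by have := ho.inj _ (by omega) _ (by omega) e; omega) fun j i hj hi => by
      rw [meetDepth_comm S.tree, meetDepth_comm S.tree q _ (c (o (k - 1 - i))),
        meetDepth_comm S.tree q _ (c (o (k - 1 - (i + 1)))), min_comm]
      exact S.meetDepth_eq_min (ho.le _ _ (by omega) (by omega)) (ho.le _ _ (by omega) (by omega))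
  refine Run.seq hσ7 (passCode_run D hσ7 hw1 hk0 (by omega) hRk v7_2 v7_52
    (fun t ht => (K7 t ht).1) (fun t ht _ => (K7 t ht).2.1)) fun σ8 hσ8 hf8 P8 => ?_
  have hr8 := hr7.frame hf8 rfl
  have v8_2 := (hf8.var 2 rfl).trans v7_2
  have v8_3 := (hf8.var 3 rfl).trans v7_3
  have v8_52 := (hf8.var 52 rfl).trans v7_52
  have a8 : ∀ i < k, σ8.arr 1 i = c i := by rw [hf8.arr 1 rfl]; exact a7
  have o8 := (hf8.arr 16 rfl).trans o7
  refine Run.seq hσ8 (copyLoop_run hσ8 v8_2) fun σ9 hσ9 hf9 K9 => ?_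
  have hr9 := hr8.frame hf9 rfl
  have v9_2 := (hf9.var 2 rfl).trans v8_2
  have v9_3 := (hf9.var 3 rfl).trans v8_3
  have v9_52 := (hf9.var 52 rfl).trans v8_52
  have a9 : ∀ i < k, σ9.arr 1 i = c i := by rw [hf9.arr 1 rfl]; exact a8
  have o9 := (hf9.arr 16 rfl).trans o8
  refine Run.seq hσ9 (passCode_run D' hσ9 hw1 hk0 (by omega) (fun t ht => hRk _ (by omega))
    v9_2 v9_52 (fun t ht => ?_) (fun t ht ht1 => ?_)) fun σ10 hσ10 hf10 P10 => ?_
  · rw [(K9 t ht).2.1, hf8.arr 23 rfl]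
    have := (K7 (k - 1 - t) (by omega)).2.2.1
    rwa [show k - 1 - (k - 1 - t) = t by omega] at this
  · rw [(K9 t ht).2.2, hf8.arr 24 rfl]
    have := (K7 (k - t) (by omega)).2.2.2
    rw [show k - (k - t) = t by omega] at this
    rw [this, meetDepth_comm S.tree, show k - 1 - (t - 1) = k - t by omega,
      show k - 1 - t = k - t - 1 by omega]
  have hr10 := hr9.frame hf10 rfl
  have v10_2 := (hf10.var 2 rfl).trans v9_2
  have v10_3 := (hf10.var 3 rfl).trans v9_3
  have a10 : ∀ i < k, σ10.arr 1 i = c i := by rw [hf10.arr 1 rfl]; exact a9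
  have o10 := (hf10.arr 16 rfl).trans o9
  have e25 : ∀ t < k, σ10.arr 25 t = σ8.arr 19 t := fun t ht => by
    rw [hf10.arr 25 rfl, (K9 t ht).1]
  have hdle : ∀ i < k, d ≤ G.dist q (c i) := fun i hi => hd ▸ (K5 i hi).2.2
  refine (moveLoop_run hr10 hσ10 hk v10_2 v10_3 a10 ho (fun t _ => congrFun o10 t) fun t ht => ?_).mono
    hσ10 le_rfl fun σ11 _ _ K11 => ?_
  · rw [e25 t ht]
    exact (P8 t ht).le.trans (hdle _ (ho.lt t ht))
  · choose! τ hτ using ho.surj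
    refine ⟨_, chrobakLarmore_of_passes S.tree q c ho.lt hτ hdle hex P8 P10, fun i => ?_⟩
    obtain ⟨b1, b2⟩ := hτ i i.2
    have := K11 _ b1
    rwa [b2, e25 _ b1] at this

end KServer

/-! ### Request sequences and the final assembly -/

namespace KServer

open WordRAM

variable {n k w : ℕ} {G : SimpleGraph (Fin n)} {r : Fin n}

theorem treeInput_wf (G : SimpleGraph (Fin n)) (r : Fin n) (hw : n < 2 ^ w) :
    (treeInput G r).WF w := by
  have hr := r.2
  refine ⟨by omega, fun x => ?_, fun a i => ?_⟩
  · simp only [treeInput]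
    split_ifs <;> omega
  · simp only [treeInput]
    split_ifs with h
    · exact (Fin.is_lt _).trans hw
    · omega

/-- The memory between two requests, with the tables of the preprocessing and the servers at `c`. -/
structure Serving (G : SimpleGraph (Fin n)) (r : Fin n) (w : ℕ) (c : Fin k → Fin n) (σ : State) :
    Prop where
  wf : σ.WF w
  ready : ∃ B nb N E pos, Ready G r w B nb N E pos σ
  var_two : σ.var 2 = k
  holds : HoldsServers σ c

theorem serving_loadServers {σ : State} (hσ : σ.WF w)
    (h : ∃ B nb N E pos, Ready G r w B nb N E pos σ) (hn : n < 2 ^ w) (hk : k < 2 ^ w)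
    (c : Fin k → Fin n) : Serving G r w c (loadServers σ c) where
  wf := by
    refine ⟨hσ.one_lt, fun x => ?_, fun a i => ?_⟩
    · simp only [loadServers, Function.update_apply]
      split_ifs
      · exact hk
      · exact hσ.var x
    · simp only [loadServers, Function.update_apply]
      split_ifs
      · dsimp only
        split_ifs
        · exact (Fin.is_lt _).trans hn
        · exact hσ.arr 1 i
      · exact hσ.arr a i
  ready := by
    obtain ⟨B, nb, N, E, pos, h⟩ := h
    -- Loading the servers is not a program, but it changes only what this stand-in may change:
    -- register `2` and array `1`.
    refine ⟨B, nb, N, E, pos, h.frame (s := 2 ≔ ♯0 ;; .store 1 ♯0 ♯0) ⟨fun x hx => ?_,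
      fun a ha => ?_⟩ rfl⟩
    · exact Function.update_of_ne (by rintro rfl; simp [Stmt.keepsVar] at hx) _ _
    · exact Function.update_of_ne (by rintro rfl; simp [Stmt.keepsArr] at ha) _ _
  var_two := by simp [loadServers]
  holds i := by simp [loadServers]

theorem Serving.query {c : Fin k → Fin n} {σ : State} (h : Serving G r w c σ) (hk : Fits n k w)
    (q : Fin n) : ∃ (c' : Fin k → Fin n) (σ' : State), Serving G r w c' σ' ∧
      ChrobakLarmore G q c c' ∧ ∃ t, Exec w queryCode (loadRequest σ q) σ' t ∧
        t ≤ 5000 * (k * (Nat.log 2 k + 1)) := by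
  obtain ⟨B, nb, N, E, pos, hr⟩ := h.ready
  have hqw : (q : ℕ) < 2 ^ w := by
    have := hr.base.n_eq ▸ h.wf.var 0
    omega
  have hwf := h.wf.setVar 3 hqw
  have hr' := hr.setVar 3 q rfl
  have hc : (fun i : Fin k => (fun i : ℕ => if h : i < k then c ⟨i, h⟩ else r) i) = c := by
    funext i; simp
  obtain ⟨σ', t, he, ht, c', h1, h2⟩ := queryCode_run (q := q)
    (c := fun i => if h : i < k then c ⟨i, h⟩ else r) hr' hwf hk
    (by simp [h.var_two]) (by simp) (fun i hi => by simpa [hi] using h.holds ⟨i, hi⟩)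
  rw [hc] at h1
  refine ⟨c', σ', ⟨he.wf hwf, ⟨B, nb, N, E, pos, hr'.frame he.frame rfl⟩, ?_, h2⟩, h1, t, he, ht⟩
  rw [he.frame.var 2 rfl]
  simp [h.var_two]

/-- The invariant `Serving` is carried along in a subtype, so that the runs for single requests can
be iterated; step `i` uses only the request `q i`. -/
theorem Serving.queries {c₀ : Fin k → Fin n} {σ₀ : State} (h : Serving G r w c₀ σ₀)
    (hk : Fits n k w) (q : ℕ → Fin n) : ∃ (c : ℕ → Fin k → Fin n) (σ : ℕ → State),
      c 0 = c₀ ∧ σ 0 = σ₀ ∧ ∀ i, ChrobakLarmore G (q i) (c i) (c (i + 1)) ∧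
        HoldsServers (σ (i + 1)) (c (i + 1)) ∧
        ∃ t, Exec w queryCode (loadRequest (σ i) (q i)) (σ (i + 1)) t ∧
          t ≤ 5000 * (k * (Nat.log 2 k + 1)) := by
  choose f g hs hcl ht using fun (p : {p : (Fin k → Fin n) × State // Serving G r w p.1 p.2})
    (q : Fin n) => p.2.query hk q
  let s : ℕ → {p : (Fin k → Fin n) × State // Serving G r w p.1 p.2} := fun i =>
    Nat.rec ⟨(c₀, σ₀), h⟩ (fun i p => ⟨(f p (q i), g p (q i)), hs p (q i)⟩) i
  exact ⟨fun i => (s i).1.1, fun i => (s i).1.2, rfl, rfl, fun i =>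
    ⟨hcl (s i) (q i), (s (i + 1)).2.holds, ht (s i) (q i)⟩⟩

theorem fits_of_pow_le {C : ℕ} (hC : 4 ≤ C) (hk : 0 < k) (h : (n + k + 2) ^ C ≤ 2 ^ w) :
    Fits n k w := by
  refine ⟨hk, le_trans ?_ ((Nat.pow_le_pow_right (by omega) hC).trans h)⟩
  have h1 : n + 1 ≤ n + k + 2 := by omega
  have h2 : k + 1 ≤ n + k + 2 := by omega
  have h3 : 2 ≤ n + k + 2 := by omega
  calc 4 * (n * k + n + k + 1) = (n + 1) * (k + 1) * (2 * 2) := by ring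
    _ ≤ (n + k + 2) * (n + k + 2) * ((n + k + 2) * (n + k + 2)) := by gcongr
    _ = (n + k + 2) ^ 4 := by ring

theorem mul_le_of_pow_le {C : ℕ} (hC : 11 ≤ C) (h : (n + 2) ^ C ≤ 2 ^ w) :
    1000 * (n + 1) ≤ 2 ^ w := by
  refine le_trans ?_ ((Nat.pow_le_pow_right (by omega) hC).trans h)
  have h1 : 2 ^ 10 ≤ (n + 2) ^ 10 := Nat.pow_le_pow_left (by omega) 10
  calc 1000 * (n + 1) ≤ 2 ^ 10 * (n + 2) := by omega
    _ ≤ (n + 2) ^ 10 * (n + 2) := Nat.mul_le_mul_right _ h1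
    _ = (n + 2) ^ 11 := rfl

end KServer

theorem mainTheorem1 :
    ∃ (preprocess lca levelAncestor query : WordRAM.Stmt) (C : ℕ),
      ∀ (n : ℕ) (G : SimpleGraph (Fin n)) (_ : G.IsTree) (r : Fin n) (w : ℕ),
        (n + 2) ^ C ≤ 2 ^ w →
        -- preprocessing, once for the tree
        ∃ (σ₀ : WordRAM.State) (t₀ : ℕ),
          WordRAM.Exec w preprocess (KServer.treeInput G r) σ₀ t₀ ∧ t₀ ≤ C * n ∧
          -- afterwards, lowest common ancestor queries take constant time
          (∀ u v : Fin n, ∃ (σ : WordRAM.State) (t : ℕ),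
            WordRAM.Exec w lca ((σ₀.setVar 4 u).setVar 5 v) σ t ∧ t ≤ C ∧
            ∃ a : Fin n, KServer.IsLCA G r u v a ∧ σ.var 6 = a) ∧
          -- and so do level ancestor queries
          (∀ (v : Fin n) (d : ℕ), d ≤ G.dist r v → ∃ (σ : WordRAM.State) (t : ℕ),
            WordRAM.Exec w levelAncestor ((σ₀.setVar 4 v).setVar 5 d) σ t ∧ t ≤ C ∧
            ∃ a : Fin n, KServer.IsAncestor G r a v ∧ G.dist r a = d ∧ σ.var 6 = a) ∧
          -- every request of every online request sequence is handled in time `O(k log k)`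
          ∀ (k : ℕ), 1 ≤ k → (n + k + 2) ^ C ≤ 2 ^ w →
          ∀ (c₀ : Fin k → Fin n) (q : ℕ → Fin n),
            ∃ (c : ℕ → Fin k → Fin n) (σ : ℕ → WordRAM.State),
              c 0 = c₀ ∧ σ 0 = KServer.loadServers σ₀ c₀ ∧
              ∀ i : ℕ, KServer.ChrobakLarmore G (q i) (c i) (c (i + 1)) ∧
                KServer.HoldsServers (σ (i + 1)) (c (i + 1)) ∧
                ∃ t : ℕ, WordRAM.Exec w query (KServer.loadRequest (σ i) (q i)) (σ (i + 1)) t ∧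
                  t ≤ C * (k * (Nat.log 2 k + 1)) := by
  -- The value is the constant of `preprocessCode_run`, which exceeds those of all the queries. It
  -- is kept as a variable so that powers with this exponent are not evaluated.
  obtain ⟨C, hC⟩ : ∃ C : ℕ, C = 10000 := ⟨_, rfl⟩
  refine ⟨KServer.preprocessCode, KServer.lcaCode, KServer.levelAncestorCode, KServer.queryCode, C,
    fun n G hG r w hw => ?_⟩
  have hw' := KServer.mul_le_of_pow_le (by omega) hw
  have hwf := KServer.treeInput_wf (w := w) G r (by omega)
  obtain ⟨σ₀, t₀, he, ht, hready⟩ := KServer.preprocessCode_run hG r hw' hwf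
  have hwf₀ := he.wf hwf
  have hlt : ∀ v : Fin n, (v : ℕ) < 2 ^ w := fun v => v.2.trans (by omega)
  refine ⟨σ₀, t₀, he, by rwa [hC], fun u v => ?_, fun v d hd => ?_, fun k hk hkw c₀ q => ?_⟩
  · obtain ⟨B, nb, N, E, pos, h⟩ := hready
    obtain ⟨σ, t, he, ht, h6⟩ := ((h.setVar 4 u rfl).setVar 5 v rfl).lca_run
      ((hwf₀.setVar 4 (hlt u)).setVar 5 (hlt v)) (u := u) (v := v) (by simp) (by simp)
    exact ⟨σ, t, he, ht.trans (by rw [hC]; decide), _, KServer.isLCA_ancAt hG r u v, h6⟩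
  · obtain ⟨B, nb, N, E, pos, h⟩ := hready
    have hdw : d < 2 ^ w := by
      have := KServer.dist_lt_card hG r v
      omega
    obtain ⟨σ, t, he, ht, h6⟩ := ((h.setVar 4 v rfl).setVar 5 d rfl).levelAncestor_run
      ((hwf₀.setVar 4 (hlt v)).setVar 5 hdw) (v := v) (d := d) (by simp) (by simp) hd
    exact ⟨σ, t, he, ht.trans (by rw [hC]; decide), _, KServer.isAncestor_ancAt hG hd,
      KServer.dist_ancAt hG hd, h6⟩
  · have hfits := KServer.fits_of_pow_le (by omega) hk hkw
    have hword := hfits.word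
    obtain ⟨c, σ, h0, h1, h⟩ := (KServer.serving_loadServers hwf₀ hready (by omega)
      (by omega) c₀).queries hfits q
    refine ⟨c, σ, h0, h1, fun i => ?_⟩
    obtain ⟨a1, a2, t, a3, a4⟩ := h i
    exact ⟨a1, a2, t, a3, a4.trans (Nat.mul_le_mul_right _ (by omega))⟩
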